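/- **Proposition 4.5.** For $\varepsilon>0$ let $\Omega_\varepsilon=\{(R,Z)\in\mathbb R^2 : 1+\varepsilon R>0\}$, write $X=(R,Z)$, $dX=dR\,dZ$, $\rho=(R^2+Z^2)^{1/2}$, and let $A(\rho)=\frac{4}{\rho^2}\bigl(e^{\rho^2/4}-1\bigr)$, $A(0)=1$. Fix $0<\sigma_1<1<\sigma_2$, put $\gamma=\sigma_1/\sigma_2$, and fix a smooth function $\chi_1:\mathbb R\to[\frac12,3]$ with $\chi_1(x)=\frac1{1+x}$ for $|x|\le\frac12$ and $\chi_1'(x)=0$ for $|x|\ge\frac34$. Consider weights on $\Omega_\varepsilon$ of the form $W_\varepsilon(R,Z)=\chi_1(\varepsilon R)\,\widehat W_\varepsilon(R,Z)$ with $\widehat W_\varepsilon$ measurable, and let $\Omega_\varepsilon'=\{X\in\Omega_\varepsilon : \widehat W_\varepsilon(X)<\exp(\varepsilon^{-2\sigma_1}/4)\}$ be the inner region. Let $C_1,C_2,C_3>0$ and $\gamma_1\in(0,1)$. There exist $C_6,C_7,\varepsilon_0>0$, depending only on $\chi_1,\sigma_1,\sigma_2,\gamma_1,C_1,C_2,C_3$,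 such that the following holds for every $\varepsilon\in(0,\varepsilon_0)$ and every such weight satisfying $$C_1\exp(\rho^{2\gamma}/4)\le W_\varepsilon\le C_2A(\rho)\quad\text{in }\Omega_\varepsilon,$$ and such that in $\Omega_\varepsilon'$ the function $W_\varepsilon$ is differentiable with $$|W_\varepsilon-A(\rho)|+|\nabla W_\varepsilon-\nabla A(\rho)|\le C_3\,\varepsilon^{\gamma_1}A(\rho).$$ Let $\mathcal X_\varepsilon$ be the space of all $\eta\in L^2(\Omega_\varepsilon)$ with $\|\eta\|_{\mathcal X_\varepsilon}^2=\int_{\Omega_\varepsilon}W_\varepsilon\,\eta^2\,dX<\infty$. For every $\eta\in\mathcal X_\varepsilon$ the integrals below converge absolutely, and $$\|\eta\|_{\mathcal X_\varepsilon}^2\le C_6\,E_\varepsilon[\eta]+C_7\Bigl(\log\tfrac1\varepsilon\;\mu_0^2+\mu_1^2+\mu_2^2\Bigr),$$ where $\mu_0=\int_{\Omega_\varepsilon}\eta\,dX$, $\mu_1=\int_{\Omega_\varepsilon}R\,\eta\,dX$, $\mu_2=\int_{\Omega_\varepsilon}Z\,\eta\,dX$, and $$E_\varepsilon[\eta]=\frac12\|\eta\|_{\mathcal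 X_\varepsilon}^2-\frac12\int_{\Omega_\varepsilon}\phi\,\eta\,dX,$$ $$\phi(R,Z)=\frac1{2\pi}\int_{\Omega_\varepsilon}\sqrt{(1+\varepsilon R)(1+\varepsilon R')}\;F\Bigl(\varepsilon^2\,\frac{(R-R')^2+(Z-Z')^2}{(1+\varepsilon R)(1+\varepsilon R')}\Bigr)\,\eta(R',Z')\,dR'\,dZ',$$ $$F(s)=\int_0^{\pi/2}\frac{1-2\sin^2\psi}{\sqrt{\sin^2\psi+s/4}}\,d\psi\qquad(s>0).$$ -/

import Mathlib

open MeasureTheory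

noncomputable section

namespace VortexRing

/-! Points of the plane are pairs `X = (R, Z)`; `volume` on `ℝ × ℝ` is the Lebesgue measure `dR dZ`. -/

/-- The half-plane `Ω_ε = {(R, Z) : 1 + ε R > 0}`. -/
def Om (ε : ℝ) : Set (ℝ × ℝ) := {X | 0 < 1 + ε * X.1}

/-- The Euclidean radius `ρ = (R² + Z²)^{1/2}`. -/
def rad (X : ℝ × ℝ) : ℝ := Real.sqrt (X.1 ^ 2 + X.2 ^ 2)

/-- `F(s) = ∫₀^{π/2} (1 - 2 sin² ψ) / √(sin² ψ + s/4) dψ`, for `s > 0`. -/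
def F (s : ℝ) : ℝ :=
  ∫ ψ in (0 : ℝ)..(Real.pi / 2),
    (1 - 2 * Real.sin ψ ^ 2) / Real.sqrt (Real.sin ψ ^ 2 + s / 4)

/-- The kernel
`K_ε(X; X') = √((1+εR)(1+εR')) F(ε² ((R-R')² + (Z-Z')²) / ((1+εR)(1+εR')))`. -/
def kernel (ε : ℝ) (X Y : ℝ × ℝ) : ℝ :=
  Real.sqrt ((1 + ε * X.1) * (1 + ε * Y.1)) *
    F (ε ^ 2 * ((X.1 - Y.1) ^ 2 + (X.2 - Y.2) ^ 2) / ((1 + ε * X.1) * (1 + ε * Y.1)))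

/-- The stream function `φ = BS^ε[η]` given by the axisymmetric Biot-Savart law. -/
def BS (ε : ℝ) (η : ℝ × ℝ → ℝ) (X : ℝ × ℝ) : ℝ :=
  1 / (2 * Real.pi) * ∫ Y in Om ε, kernel ε X Y * η Y

/-- The radial function `A(ρ) = (4/ρ²)(e^{ρ²/4} - 1)`, extended by continuity: `A(0) = 1`. -/
def A (ρ : ℝ) : ℝ := if ρ = 0 then 1 else 4 / ρ ^ 2 * (Real.exp (ρ ^ 2 / 4) - 1)

/-- A smooth cut-off `χ : ℝ → [1/2, 3]` with `χ(x) = 1/(1+x)` for `|x| ≤ 1/2` and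
`χ'(x) = 0` for `|x| ≥ 3/4`. -/
structure IsCutoff (χ : ℝ → ℝ) : Prop where
  smooth : ContDiff ℝ ((⊤ : ℕ∞) : WithTop ℕ∞) χ
  mem_Icc : ∀ x, χ x ∈ Set.Icc (1 / 2 : ℝ) 3
  eq_inv : ∀ x, |x| ≤ 1 / 2 → χ x = 1 / (1 + x)
  deriv_eq_zero : ∀ x, 3 / 4 ≤ |x| → deriv χ x = 0

/-- The weight `W_ε(R, Z) = χ(ε R) Ŵ(R, Z)` with profile `Ŵ`.

For the vortex ring the profile is `Φ_ε'(ζ_*)` where this is smaller than the threshold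
`exp(ε^{-2σ₁}/4)`, it equals the threshold in the remaining part of `{ρ ≤ ε^{-σ₂}}`, and it is
`exp(ρ^{2γ}/4)` for `ρ > ε^{-σ₂}`, where `γ = σ₁/σ₂`. -/
def weight (χ : ℝ → ℝ) (ε : ℝ) (What : ℝ × ℝ → ℝ) (X : ℝ × ℝ) : ℝ :=
  χ (ε * X.1) * What X

/-- The inner region: the part of `Ω_ε` where the profile lies below `exp(ε^{-2σ₁}/4)`.

For the profile of the vortex ring this is `{Φ_ε'(ζ_*) < exp(ε^{-2σ₁}/4)}`, since in the other
two regions that profile is at least `exp(ε^{-2σ₁}/4)`. -/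
def innerRegion (σ₁ ε : ℝ) (What : ℝ × ℝ → ℝ) : Set (ℝ × ℝ) :=
  {X | X ∈ Om ε ∧ What X < Real.exp (ε ^ (-(2 * σ₁)) / 4)}

/-- The Euclidean length `|∇f(X) - ∇g(X)|`. -/
def gradDist (f g : ℝ × ℝ → ℝ) (X : ℝ × ℝ) : ℝ :=
  Real.sqrt ((fderiv ℝ f X (1, 0) - fderiv ℝ g X (1, 0)) ^ 2 +
    (fderiv ℝ f X (0, 1) - fderiv ℝ g X (0, 1)) ^ 2)

/-- The uniform bounds `C₁ exp(ρ^{2γ}/4) ≤ W ≤ C₂ A(ρ)` on `Ω_ε`. -/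
def UniformBounds (γ C₁ C₂ ε : ℝ) (W : ℝ × ℝ → ℝ) : Prop :=
  ∀ X ∈ Om ε, C₁ * Real.exp (rad X ^ (2 * γ) / 4) ≤ W X ∧ W X ≤ C₂ * A (rad X)

/-- `W` is differentiable in `S` and `|W - A| + |∇W - ∇A| ≤ C₃ ε^{γ₁} A(ρ)` there. -/
def CloseToA (γ₁ C₃ ε : ℝ) (W : ℝ × ℝ → ℝ) (S : Set (ℝ × ℝ)) : Prop :=
  ∀ X ∈ S, DifferentiableAt ℝ W X ∧
    |W X - A (rad X)| + gradDist W (fun Y => A (rad Y)) X ≤ C₃ * ε ^ γ₁ * A (rad X)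

/-- Membership in `𝒳_ε = {η ∈ L²(Ω_ε) : ∫_{Ω_ε} W η² < ∞}`. -/
def MemX (ε : ℝ) (W η : ℝ × ℝ → ℝ) : Prop :=
  MemLp η 2 (volume.restrict (Om ε)) ∧ IntegrableOn (fun X => W X * η X ^ 2) (Om ε)

/-- The squared norm `‖η‖²_{𝒳_ε} = ∫_{Ω_ε} W η² dX`. -/
def normSq (ε : ℝ) (W η : ℝ × ℝ → ℝ) : ℝ := ∫ X in Om ε, W X * η X ^ 2

/-- The kinetic energy `½ ∫_{Ω_ε} φ η dX`, where `φ = BS^ε[η]`. -/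
def Ekin (ε : ℝ) (η : ℝ × ℝ → ℝ) : ℝ := 1 / 2 * ∫ X in Om ε, BS ε η X * η X

/-- The energy `E_ε[η] = ½ ‖η‖²_{𝒳_ε} - E^kin_ε[η]`. -/
def energy (ε : ℝ) (W η : ℝ × ℝ → ℝ) : ℝ := 1 / 2 * normSq ε W η - Ekin ε η

/-- `μ₀ = ∫_{Ω_ε} η dX`. -/
def mu0 (ε : ℝ) (η : ℝ × ℝ → ℝ) : ℝ := ∫ X in Om ε, η X

/-- `μ₁ = ∫_{Ω_ε} R η dX`. -/
def mu1 (ε : ℝ) (η : ℝ × ℝ → ℝ) : ℝ := ∫ X in Om ε, X.1 * η X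

/-- `μ₂ = ∫_{Ω_ε} Z η dX`. -/
def mu2 (ε : ℝ) (η : ℝ × ℝ → ℝ) : ℝ := ∫ X in Om ε, X.2 * η X

/-- All integrals in the kinetic energy and in the moments of `η` converge absolutely. -/
structure IntegralsConverge (ε : ℝ) (η : ℝ × ℝ → ℝ) : Prop where
  stream : ∀ X ∈ Om ε, IntegrableOn (fun Y => kernel ε X Y * η Y) (Om ε)
  kinetic : IntegrableOn (fun X => BS ε η X * η X) (Om ε)
  mass : IntegrableOn η (Om ε)
  radial : IntegrableOn (fun X => X.1 * η X) (Om ε)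
  vertical : IntegrableOn (fun X => X.2 * η X) (Om ε)

end VortexRing

end

namespace VortexRing

/-! Near `s = 0` one has `F s = ½ log (1 + 1/s) + c₀ + O(√s)`. Hence, up to a constant and an error
`O(√ε)` with polynomial weights, the kinetic form is that of the kernel `(1/4π) log (1 +
ε⁻²/|X-Y|²)` (`exists_kernel_asymptotic`). The core is `logKernel_form_le`: modulo mass and first
moments, the logarithmic form costs at most `7/8` of `∫ A η²`.

To see this, write the logarithmic kernel as a superposition over `r ∈ (0,1)` of heat kernels at
time `t = (1-r)/r`, and `A(ρ) = ∫₀¹ exp((1-r)ρ²/4) dr` as a superposition of Gaussians over the same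
parameter. For fixed `r`, conjugation by `exp((1-r)ρ²/8)` turns the heat kernel into `r` times a
Mehler kernel with eigenvalues `1, r, r², …` (`heatKernel_eq_mehler`). Off the first two levels the
heat form is thus at most `r³ ∫ exp((1-r)ρ²/4) η²`. The density `|dt/dr| = r⁻²` leaves the factor
`r`, and averaging `r exp((1-r)ρ²/4)` over `r` gives at most `A/2`.

The first two levels see Gaussian-damped moments such as `∫ exp(-rρ²/4) η` instead of true moments.
The difference is controlled by a weighted `L²` norm, paid for by the room between `1/2` and `1`.
Mass concerns only the even part of `η` and first moments only the odd part, so the two costs fall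
on different functions and each sector stays below `7/8`. The mass term has a `1/r` singularity at
large times, cut off at `r ~ ε²`; this is the source of `log (1/ε)`.

The weight `W` resembles `A` only in the inner region, so the logarithmic form is kept only on a
disc `(1+ρ)^n ≤ 1/ε` inside that region, where `A ≤ (15/14) W`. What is discarded is again `√ε`
times a polynomially weighted form, which `W ≥ C₁ exp(ρ^{2γ}/4)` dominates. Altogether `2 Ekin` is
at most `(7/8)(15/14) + 1/32 = 31/32` of the norm plus moment terms, which is coercivity. -/

/-! ### Logarithmic asymptotics of `F` at small argument. -/

theorem one_sub_two_sin_sq_sub_cos_bound {ψ : ℝ} (h : 0 ≤ Real.cos ψ) :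
    |1 - 2 * Real.sin ψ ^ 2 - Real.cos ψ| ≤ 2 * Real.sin ψ ^ 2 := by
  have h1 := Real.sin_sq_add_cos_sq ψ
  have h2 := Real.cos_le_one ψ
  rw [abs_le]
  constructor <;> nlinarith

theorem abs_div_sqrt_sub_div_le {N a s : ℝ} (ha : 0 ≤ a) (hs : 0 < s) (hN : |N| ≤ 2 * a ^ 2) :
    |N / Real.sqrt (a ^ 2 + s / 4) - N / a| ≤ Real.sqrt s := by
  -- For `a = 0` the bound forces `N = 0`, so the conventional value of `N / 0` does no harm.
  rcases ha.eq_or_lt with rfl | ha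
  · have : N = 0 := by simpa using hN
    simp [this]
  · set b := Real.sqrt (a ^ 2 + s / 4) with hb
    set q := Real.sqrt s with hq
    have hqq : q ^ 2 = s := Real.sq_sqrt hs.le
    have hq0 : 0 < q := Real.sqrt_pos.2 hs
    have hbb : b ^ 2 = a ^ 2 + s / 4 := Real.sq_sqrt (by positivity)
    have hb0 : 0 < b := Real.sqrt_pos.2 (by positivity)
    have hab : a ≤ b := by nlinarith
    have hba : b ≤ a + q / 2 := by nlinarith [mul_pos ha hq0]
    have : N / b - N / a = - (N * ((b - a) / (a * b))) := by field_simp; ring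
    rw [this, abs_neg, abs_mul, abs_of_nonneg (div_nonneg (sub_nonneg.2 hab) (by positivity))]
    calc |N| * ((b - a) / (a * b)) ≤ (2 * a ^ 2) * ((q / 2) / (a * a)) := by
          gcongr
          linarith
      _ = q := by field_simp

theorem integral_cos_div_sqrt {s : ℝ} (hs : 0 < s) :
    ∫ ψ in (0 : ℝ)..(Real.pi / 2), Real.cos ψ / Real.sqrt (Real.sin ψ ^ 2 + s / 4) =
      Real.arsinh (2 / Real.sqrt s) := by
  have hq0 : 0 < Real.sqrt s := Real.sqrt_pos.2 hs
  have hd : ∀ ψ ∈ Set.uIcc (0 : ℝ) (Real.pi / 2),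
      HasDerivAt (fun ψ => Real.arsinh (2 * Real.sin ψ / Real.sqrt s))
        (Real.cos ψ / Real.sqrt (Real.sin ψ ^ 2 + s / 4)) ψ := by
    intro ψ _
    have h := (((Real.hasDerivAt_sin ψ).const_mul 2).div_const (Real.sqrt s)).arsinh
    convert h using 1
    have e : 1 + (2 * Real.sin ψ / Real.sqrt s) ^ 2 =
        (2 / Real.sqrt s) ^ 2 * (Real.sin ψ ^ 2 + s / 4) := by
      rw [div_pow, div_pow, Real.sq_sqrt hs.le]
      field_simp
      ring
    rw [e, Real.sqrt_mul (by positivity), Real.sqrt_sq (by positivity)]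
    have : 0 < Real.sqrt (Real.sin ψ ^ 2 + s / 4) := Real.sqrt_pos.2 (by positivity)
    simp only [smul_eq_mul]
    field_simp
  rw [intervalIntegral.integral_eq_sub_of_hasDerivAt hd]
  · simp
  · apply Continuous.intervalIntegrable
    refine Real.continuous_cos.div (by fun_prop) fun x => ?_
    exact (Real.sqrt_pos.2 (by positivity)).ne'

/-- With `q = √s`, the first term is `log (2 + √(4+s)) - log q` and `½ log (1 + 1/s) = ½ log (1+s) -
log q`. The singular parts cancel, and each regular part is within `q` of its value at `s = 0`. -/
theorem abs_arsinh_sub_log_le {s : ℝ} (hs : 0 < s) :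
    |Real.arsinh (2 / Real.sqrt s) - (1 / 2 * Real.log (1 + 1 / s) + Real.log 4)| ≤
      2 * Real.sqrt s := by
  set q := Real.sqrt s with hq
  have hqq : q ^ 2 = s := Real.sq_sqrt hs.le
  have hq0 : 0 < q := Real.sqrt_pos.2 hs
  set w := Real.sqrt (4 + s) with hw
  have hww : w ^ 2 = 4 + s := Real.sq_sqrt (by positivity)
  have hw0 : 0 < w := Real.sqrt_pos.2 (by positivity)
  have hw2 : 2 ≤ w := by nlinarith
  have hwq : w ≤ 2 + q := by nlinarith
  have e1 : Real.arsinh (2 / q) = Real.log (2 + w) - Real.log q := by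
    rw [Real.arsinh, ← Real.log_div (by positivity) hq0.ne']
    congr 1
    have : 1 + (2 / q) ^ 2 = (4 + s) / q ^ 2 := by
      rw [← hqq]; field_simp; ring
    rw [this, Real.sqrt_div (by positivity), Real.sqrt_sq hq0.le, ← hw]
    ring
  have e2 : Real.log (1 + 1 / s) = Real.log (1 + s) - 2 * Real.log q := by
    have : 1 + 1 / s = (1 + s) / q ^ 2 := by rw [hqq]; field_simp; ring
    rw [this, Real.log_div (by positivity) (by positivity), Real.log_pow]
    norm_num
  have e3 : Real.log (2 + w) - Real.log 4 ≤ q := by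
    rw [← Real.log_div (by positivity) (by norm_num)]
    have := Real.log_le_sub_one_of_pos (x := (2 + w) / 4) (by positivity)
    linarith
  have e4 : 0 ≤ Real.log (2 + w) - Real.log 4 := by
    have := Real.log_le_log (x := 4) (by norm_num) (show 4 ≤ 2 + w by linarith)
    linarith
  have e5 : 0 ≤ Real.log (1 + s) := Real.log_nonneg (by linarith)
  have e6 : Real.log (1 + s) ≤ 2 * q := by
    have h1 : Real.log (1 + s) ≤ Real.log ((1 + q) ^ 2) :=
      Real.log_le_log (by positivity) (by nlinarith)
    rw [Real.log_pow] at h1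
    have h2 := Real.log_le_sub_one_of_pos (x := 1 + q) (by positivity)
    push_cast at h1
    linarith
  rw [e1, e2, abs_le]
  constructor <;> linarith

/-- Split the numerator as `cos ψ + N ψ`. The cosine part integrates exactly to an `arsinh` and
carries the singularity. Since `N = O(sin² ψ)`, replacing `√(sin² ψ + s/4)` by `sin ψ` under `N`
costs only `√s` pointwise. -/
theorem exists_F_asymptotic :
    ∃ c₀ C : ℝ, 0 ≤ C ∧ ∀ s, 0 < s → |F s - (1 / 2 * Real.log (1 + 1 / s) + c₀)| ≤ C * Real.sqrt s := by
  set N : ℝ → ℝ := fun ψ => 1 - 2 * Real.sin ψ ^ 2 - Real.cos ψ with hN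
  set D : ℝ := ∫ ψ in (0 : ℝ)..(Real.pi / 2), N ψ / Real.sin ψ with hD
  have hpi := Real.pi_pos
  have hcos : ∀ ψ ∈ Set.uIoc (0 : ℝ) (Real.pi / 2), 0 ≤ Real.cos ψ ∧ 0 ≤ Real.sin ψ := by
    intro ψ h
    rw [Set.uIoc_of_le (by positivity)] at h
    exact ⟨Real.cos_nonneg_of_mem_Icc ⟨by linarith [h.1], h.2⟩,
      Real.sin_nonneg_of_nonneg_of_le_pi h.1.le (by linarith [h.2])⟩
  have hDi : IntervalIntegrable (fun ψ => N ψ / Real.sin ψ) volume 0 (Real.pi / 2) := by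
    have h2 : IntervalIntegrable (fun _ : ℝ => (2 : ℝ)) volume 0 (Real.pi / 2) :=
      continuous_const.intervalIntegrable _ _
    refine h2.mono_fun ?_ ?_
    · apply Measurable.aestronglyMeasurable
      simp only [hN]
      fun_prop
    · rw [Filter.EventuallyLE, ae_restrict_iff' measurableSet_uIoc]
      refine Filter.Eventually.of_forall fun ψ hψ => ?_
      obtain ⟨h1, h2⟩ := hcos ψ hψ
      have h3 := one_sub_two_sin_sq_sub_cos_bound h1
      rw [norm_div, Real.norm_eq_abs, Real.norm_eq_abs, abs_of_nonneg h2]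
      rcases h2.eq_or_lt with h4 | h4
      · rw [← h4]; simp
      · rw [div_le_iff₀ h4]
        have := Real.sin_le_one ψ
        simp only [hN, Real.norm_eq_abs]
        norm_num
        nlinarith
  -- The `2` comes from the `arsinh` estimate, `π/2` is the length of the interval of integration.
  refine ⟨Real.log 4 + D, 2 + Real.pi / 2, by positivity, fun s hs => ?_⟩
  have hc : Continuous fun ψ => (Real.sqrt (Real.sin ψ ^ 2 + s / 4))⁻¹ :=
    Continuous.inv₀ (by fun_prop) fun x => (Real.sqrt_pos.2 (by positivity)).ne'
  have hNi : IntervalIntegrable (fun ψ => N ψ / Real.sqrt (Real.sin ψ ^ 2 + s / 4)) volume 0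
      (Real.pi / 2) := by
    apply Continuous.intervalIntegrable
    simp only [div_eq_mul_inv, hN]
    fun_prop
  have hCi : IntervalIntegrable (fun ψ => Real.cos ψ / Real.sqrt (Real.sin ψ ^ 2 + s / 4)) volume 0
      (Real.pi / 2) := by
    apply Continuous.intervalIntegrable
    simp only [div_eq_mul_inv]
    fun_prop
  have hF : F s = Real.arsinh (2 / Real.sqrt s) +
      ∫ ψ in (0 : ℝ)..(Real.pi / 2), N ψ / Real.sqrt (Real.sin ψ ^ 2 + s / 4) := by
    rw [← integral_cos_div_sqrt hs, ← intervalIntegral.integral_add hCi hNi, F]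
    congr 1
    ext ψ
    simp only [hN]
    ring
  have hdiff : |(∫ ψ in (0 : ℝ)..(Real.pi / 2), N ψ / Real.sqrt (Real.sin ψ ^ 2 + s / 4)) - D| ≤
      Real.sqrt s * (Real.pi / 2) := by
    rw [hD, ← intervalIntegral.integral_sub hNi hDi]
    have := intervalIntegral.norm_integral_le_of_norm_le_const
      (f := fun ψ => N ψ / Real.sqrt (Real.sin ψ ^ 2 + s / 4) - N ψ / Real.sin ψ)
      (a := 0) (b := Real.pi / 2) (C := Real.sqrt s) (fun ψ hψ => by
        obtain ⟨h1, h2⟩ := hcos ψ hψ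
        exact abs_div_sqrt_sub_div_le h2 hs (one_sub_two_sin_sq_sub_cos_bound h1))
    rw [sub_zero, abs_of_pos (by positivity : 0 < Real.pi / 2)] at this
    exact this
  have h1 := abs_arsinh_sub_log_le hs
  rw [hF]
  rw [abs_le] at *
  constructor <;> nlinarith

/-! ### The Biot-Savart kernel as a logarithm plus a constant. -/

/-- The squared distance of two points of the plane. -/
noncomputable def sqDist (X Y : ℝ × ℝ) : ℝ := (X.1 - Y.1) ^ 2 + (X.2 - Y.2) ^ 2

theorem sqDist_nonneg (X Y : ℝ × ℝ) : 0 ≤ sqDist X Y := by unfold sqDist; positivity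

theorem sqDist_pos {X Y : ℝ × ℝ} (h : X ≠ Y) : 0 < sqDist X Y := by
  rcases (sqDist_nonneg X Y).eq_or_lt with h0 | h0
  · exfalso
    unfold sqDist at h0
    apply h
    have h1 : X.1 - Y.1 = 0 := by nlinarith [sq_nonneg (X.1 - Y.1), sq_nonneg (X.2 - Y.2)]
    have h2 : X.2 - Y.2 = 0 := by nlinarith [sq_nonneg (X.1 - Y.1), sq_nonneg (X.2 - Y.2)]
    exact Prod.ext (by linarith) (by linarith)
  · exact h0

theorem rad_nonneg (X : ℝ × ℝ) : 0 ≤ rad X := Real.sqrt_nonneg _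

theorem rad_sq (X : ℝ × ℝ) : rad X ^ 2 = X.1 ^ 2 + X.2 ^ 2 := Real.sq_sqrt (by positivity)

theorem abs_fst_le_rad (X : ℝ × ℝ) : |X.1| ≤ rad X :=
  Real.abs_le_sqrt (by nlinarith [sq_nonneg X.2])

theorem abs_snd_le_rad (X : ℝ × ℝ) : |X.2| ≤ rad X :=
  Real.abs_le_sqrt (by nlinarith [sq_nonneg X.1])

theorem sqrt_sqDist_le (X Y : ℝ × ℝ) : Real.sqrt (sqDist X Y) ≤ rad X + rad Y := by
  have hX := rad_nonneg X
  have hY := rad_nonneg Y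
  apply Real.sqrt_le_iff.2 ⟨by positivity, ?_⟩
  have h1 := rad_sq X
  have h2 := rad_sq Y
  have h3 : -(X.1 * Y.1 + X.2 * Y.2) ≤ rad X * rad Y := by
    apply le_of_sq_le_sq _ (by positivity)
    rw [mul_pow, h1, h2]
    nlinarith [sq_nonneg (X.1 * Y.2 - X.2 * Y.1)]
  unfold sqDist
  nlinarith

/-- From `log x ≤ 8 x^{1/8}` and subadditivity of the power `1/8`. A small exponent makes both the
loss in `ε` and the singularity in `d` mild. -/
theorem log_one_add_inv_le {ε d : ℝ} (hε : 0 < ε) (hε1 : ε ≤ 1) (hd : 0 < d) :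
    Real.log (1 + 1 / (ε ^ 2 * d)) ≤ 8 * ε ^ (-(1 / 4) : ℝ) * (1 + d ^ (-(1 / 8) : ℝ)) := by
  have h0 : 0 < 1 / (ε ^ 2 * d) := by positivity
  have h1 := Real.log_le_rpow_div (x := 1 + 1 / (ε ^ 2 * d)) (by positivity)
    (show (0 : ℝ) < 1 / 8 by norm_num)
  have h2 := Real.rpow_add_le_add_rpow (a := 1) (b := 1 / (ε ^ 2 * d)) (p := 1 / 8) (by norm_num) h0.le
    (by norm_num) (by norm_num)
  have h3 : (1 / (ε ^ 2 * d)) ^ (1 / 8 : ℝ) = ε ^ (-(1 / 4) : ℝ) * d ^ (-(1 / 8) : ℝ) := by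
    rw [one_div, ← Real.rpow_neg_one, ← Real.rpow_mul (by positivity), Real.mul_rpow (by positivity) hd.le,
      ← Real.rpow_natCast, ← Real.rpow_mul hε.le]
    norm_num
  have h4 : 1 ≤ ε ^ (-(1 / 4) : ℝ) := Real.one_le_rpow_of_pos_of_le_one_of_nonpos hε hε1 (by norm_num)
  rw [h3, Real.one_rpow] at h2
  have : (1 + 1 / (ε ^ 2 * d)) ^ (1 / 8 : ℝ) ≤ ε ^ (-(1 / 4) : ℝ) * (1 + d ^ (-(1 / 8) : ℝ)) := by linarith
  rw [div_eq_mul_inv] at h1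
  norm_num at h1 h2 this ⊢
  linarith

/-- The quotient `(s + p²)/(s + 1)` lies between `1` and `p²`, so its logarithm is at most `2 |log
p|`, and `p |log p| ≤ |p - 1| max(1, p)`. -/
theorem sqrt_mul_abs_log_le {p s : ℝ} (hp : 0 < p) (hs : 0 < s) :
    p * |Real.log (1 + p ^ 2 / s) - Real.log (1 + 1 / s)| ≤ 2 * |p - 1| * max 1 p := by
  have e : Real.log (1 + p ^ 2 / s) - Real.log (1 + 1 / s) = Real.log ((s + p ^ 2) / (s + 1)) := by
    rw [← Real.log_div (by positivity) (by positivity)]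
    congr 1
    field_simp
  rw [e]
  rcases le_total 1 p with h | h
  · rw [abs_of_nonneg (Real.log_nonneg ((one_le_div (by positivity)).2 (by nlinarith))),
      abs_of_nonneg (by linarith), max_eq_right h]
    have h1 : Real.log ((s + p ^ 2) / (s + 1)) ≤ Real.log (p ^ 2) := by
      apply Real.log_le_log (by positivity)
      rw [div_le_iff₀ (by positivity)]
      nlinarith [mul_nonneg hs.le (by nlinarith : 0 ≤ p ^ 2 - 1)]
    rw [Real.log_pow] at h1
    have h2 := Real.log_le_sub_one_of_pos hp
    push_cast at h1
    nlinarith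
  · rw [abs_of_nonpos (Real.log_nonpos (by positivity) ((div_le_one (by positivity)).2 (by nlinarith))),
      abs_of_nonpos (by linarith), max_eq_left h]
    have h1 : Real.log (p ^ 2) ≤ Real.log ((s + p ^ 2) / (s + 1)) := by
      apply Real.log_le_log (by positivity)
      rw [le_div_iff₀ (by positivity)]
      nlinarith [mul_nonneg hs.le (by nlinarith : 0 ≤ 1 - p ^ 2)]
    rw [Real.log_pow] at h1
    have h2 := Real.log_le_sub_one_of_pos (inv_pos.2 hp)
    rw [Real.log_inv] at h2
    have h3 : p * p⁻¹ = 1 := mul_inv_cancel₀ hp.ne'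
    push_cast at h1
    nlinarith

/-- The logarithmic kernel `(1/4π) log (1 + b / |X - Y|²)`. -/
noncomputable def logKernel (b : ℝ) (X Y : ℝ × ℝ) : ℝ := 1 / (4 * Real.pi) * Real.log (1 + b / sqDist X Y)

/-- The weakly singular majorant `1 + |X - Y|^{-1/4}`. -/
noncomputable def singKernel (X Y : ℝ × ℝ) : ℝ := 1 + sqDist X Y ^ (-(1 / 8) : ℝ)

theorem one_le_singKernel (X Y : ℝ × ℝ) : 1 ≤ singKernel X Y := by
  unfold singKernel
  have := Real.rpow_nonneg (sqDist_nonneg X Y) (-(1 / 8))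
  linarith

-- With `p = √((1+εR)(1+εR'))` and `s = ε²d/p²` the kernel is `p F(s)`. Three errors arise: the
-- remainder of `F`, where `p√s = ε√d` removes any degeneracy at the boundary; the replacement of
-- `s` by `ε²d` in the logarithm; and the replacement of the prefactor `p` by `1`.
set_option maxHeartbeats 800000 in
theorem exists_kernel_asymptotic :
    ∃ c₀ C : ℝ, 0 ≤ C ∧ ∀ ε, 0 < ε → ε ≤ 1 → ∀ X ∈ Om ε, ∀ Y ∈ Om ε, X ≠ Y →
      |1 / (2 * Real.pi) * kernel ε X Y - (logKernel (ε ^ (-2 : ℤ)) X Y + c₀)| ≤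
        C * Real.sqrt ε * ((1 + rad X) ^ 2 * (1 + rad Y) ^ 2 * singKernel X Y) := by
  obtain ⟨c₀, C, hC, hF⟩ := exists_F_asymptotic
  refine ⟨c₀ / (2 * Real.pi), C + |c₀| + 6, by positivity, ?_⟩
  intro ε hε hε1 X hX Y hY hXY
  have hX' : 0 < 1 + ε * X.1 := hX
  have hY' : 0 < 1 + ε * Y.1 := hY
  have hd := sqDist_pos hXY
  set d := sqDist X Y with hd'
  set p := Real.sqrt ((1 + ε * X.1) * (1 + ε * Y.1)) with hp'
  have hp : 0 < p := Real.sqrt_pos.2 (by positivity)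
  have hpp : p ^ 2 = (1 + ε * X.1) * (1 + ε * Y.1) := Real.sq_sqrt (by positivity)
  set P := (1 + rad X) * (1 + rad Y) with hP
  have hrX := rad_nonneg X
  have hrY := rad_nonneg Y
  have hP1 : 1 ≤ P := by nlinarith
  have hx := abs_le.1 (abs_fst_le_rad X)
  have hy := abs_le.1 (abs_fst_le_rad Y)
  have hpP : p ≤ P := by
    apply le_of_sq_le_sq _ (by positivity)
    rw [hpp]
    have h1 : 1 + ε * X.1 ≤ 1 + rad X := by nlinarith
    have h2 : 1 + ε * Y.1 ≤ 1 + rad Y := by nlinarith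
    calc (1 + ε * X.1) * (1 + ε * Y.1) ≤ P := by rw [hP]; gcongr
      _ ≤ P ^ 2 := by nlinarith
  have hp1 : |p - 1| ≤ ε * P := by
    have h1 : |p - 1| ≤ |p ^ 2 - 1| := by
      have : p ^ 2 - 1 = (p - 1) * (p + 1) := by ring
      rw [this, abs_mul]
      have h2 : 1 ≤ |p + 1| := by rw [abs_of_pos (by positivity)]; linarith
      nlinarith [abs_nonneg (p - 1)]
    refine h1.trans ?_
    rw [hpp, show (1 + ε * X.1) * (1 + ε * Y.1) - 1 = ε * (X.1 + Y.1 + ε * (X.1 * Y.1)) by ring, abs_mul,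
      abs_of_pos hε]
    gcongr
    have hXa := abs_fst_le_rad X
    have hYa := abs_fst_le_rad Y
    calc |X.1 + Y.1 + ε * (X.1 * Y.1)| ≤ |X.1| + |Y.1| + ε * (|X.1| * |Y.1|) := by
          refine (abs_add_le _ _).trans (add_le_add (abs_add_le _ _) ?_)
          rw [abs_mul, abs_mul, abs_of_pos hε]
      _ ≤ |X.1| + |Y.1| + 1 * (|X.1| * |Y.1|) := by gcongr
      _ ≤ rad X + rad Y + 1 * (rad X * rad Y) := by gcongr
      _ ≤ P := by rw [hP]; nlinarith
  set s := ε ^ 2 * d / p ^ 2 with hs'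
  have hs : 0 < s := by positivity
  have hker : kernel ε X Y = p * F s := by
    rw [kernel, hs', hpp]; rfl
  have hsq : Real.sqrt ε ^ 2 = ε := Real.sq_sqrt hε.le
  have hq0 : 0 < Real.sqrt ε := Real.sqrt_pos.2 hε
  have hq1 : Real.sqrt ε ≤ 1 := Real.sqrt_le_one.2 hε1
  have hεq : ε ≤ Real.sqrt ε := by nlinarith
  set S := singKernel X Y with hS
  have hS1 : 1 ≤ S := one_le_singKernel X Y
  have t1 : p * |F s - (1 / 2 * Real.log (1 + 1 / s) + c₀)| ≤ C * (ε * P) := by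
    have h1 := hF s hs
    have h2 : Real.sqrt s = ε * Real.sqrt d / p := by
      rw [hs', Real.sqrt_div (by positivity), Real.sqrt_sq hp.le, Real.sqrt_mul (by positivity),
        Real.sqrt_sq hε.le]
    have h3 : p * Real.sqrt s = ε * Real.sqrt d := by rw [h2]; field_simp
    have h4 := sqrt_sqDist_le X Y
    calc p * |F s - (1 / 2 * Real.log (1 + 1 / s) + c₀)| ≤ p * (C * Real.sqrt s) := by gcongr
      _ = C * (ε * Real.sqrt d) := by rw [← h3]; ring
      _ ≤ C * (ε * P) := by
        gcongr
        rw [hP]; nlinarith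
  set s₀ := ε ^ 2 * d with hs₀
  have hs₀0 : 0 < s₀ := by positivity
  have t2 : p * |Real.log (1 + 1 / s) - Real.log (1 + 1 / s₀)| ≤ 2 * (ε * P) * P := by
    have h1 := sqrt_mul_abs_log_le hp hs₀0
    have h2 : 1 / s = p ^ 2 / s₀ := by rw [hs']; field_simp
    rw [h2]
    refine h1.trans ?_
    gcongr
    exact max_le hP1 hpP
  -- `|p - 1|` gains a full power of `ε` and the logarithm loses only `ε^{-1/4}`, which leaves
  -- `ε^{3/4} ≤ √ε`.
  have t3 : |p - 1| * Real.log (1 + 1 / s₀) ≤ 8 * (Real.sqrt ε * P * S) := by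
    have h1 := log_one_add_inv_le hε hε1 hd
    have h2 : ε * ε ^ (-(1 / 4) : ℝ) ≤ Real.sqrt ε := by
      rw [Real.sqrt_eq_rpow]
      nth_rewrite 1 [← Real.rpow_one ε]
      rw [← Real.rpow_add hε]
      exact Real.rpow_le_rpow_of_exponent_ge hε hε1 (by norm_num)
    have h3 : 0 ≤ Real.log (1 + 1 / s₀) := Real.log_nonneg (by
      have : 0 < 1 / s₀ := by positivity
      linarith)
    calc |p - 1| * Real.log (1 + 1 / s₀) ≤ (ε * P) * (8 * ε ^ (-(1 / 4) : ℝ) * S) := by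
          gcongr
          exact h1
      _ = 8 * ((ε * ε ^ (-(1 / 4) : ℝ)) * P * S) := by ring
      _ ≤ _ := by gcongr
  have hlog : logKernel (ε ^ (-2 : ℤ)) X Y = 1 / (4 * Real.pi) * Real.log (1 + 1 / s₀) := by
    rw [logKernel, hs₀, ← hd', zpow_neg]
    congr 3
    rw [div_eq_div_iff hd.ne' (by positivity)]
    rw [← zpow_natCast]
    field_simp
    norm_cast
  have hpi := Real.pi_gt_three
  have key : 1 / (2 * Real.pi) * kernel ε X Y - (logKernel (ε ^ (-2 : ℤ)) X Y + c₀ / (2 * Real.pi)) =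
      1 / (2 * Real.pi) * (p * (F s - (1 / 2 * Real.log (1 + 1 / s) + c₀)) +
        1 / 2 * (p * (Real.log (1 + 1 / s) - Real.log (1 + 1 / s₀))) +
        1 / 2 * ((p - 1) * Real.log (1 + 1 / s₀)) + (p - 1) * c₀) := by
    rw [hker, hlog]
    field_simp
    ring
  rw [key, abs_mul, abs_of_pos (by positivity)]
  have h1 : 1 / (2 * Real.pi) ≤ 1 := by
    rw [div_le_one (by positivity)]; linarith
  have hl0 : 0 ≤ Real.log (1 + 1 / s₀) := Real.log_nonneg (by
      have : 0 < 1 / s₀ := by positivity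
      linarith)
  have hbig : |p * (F s - (1 / 2 * Real.log (1 + 1 / s) + c₀)) +
        1 / 2 * (p * (Real.log (1 + 1 / s) - Real.log (1 + 1 / s₀))) +
        1 / 2 * ((p - 1) * Real.log (1 + 1 / s₀)) + (p - 1) * c₀| ≤
        C * (ε * P) + 1 / 2 * (2 * (ε * P) * P) + 1 / 2 * (8 * (Real.sqrt ε * P * S)) + (ε * P) * |c₀| := by
    refine (abs_add_le _ _).trans (add_le_add ((abs_add_le _ _).trans (add_le_add
      ((abs_add_le _ _).trans (add_le_add ?_ ?_)) ?_)) ?_)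
    · rw [abs_mul, abs_of_pos hp]; exact t1
    · rw [abs_mul, abs_mul, abs_of_pos hp, abs_of_pos (by norm_num : (0 : ℝ) < 1 / 2)]; gcongr
    · rw [abs_mul, abs_mul, abs_of_nonneg hl0, abs_of_pos (by norm_num : (0 : ℝ) < 1 / 2)]; gcongr
    · rw [abs_mul]; gcongr
  have hQ : (1 + rad X) ^ 2 * (1 + rad Y) ^ 2 * S = P ^ 2 * S := by rw [hP]; ring
  rw [hQ]
  set q := Real.sqrt ε with hq
  set T := q * (P ^ 2 * S) with hT
  have b1 : ε * P ≤ T := by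
    calc ε * P ≤ q * P := by gcongr
      _ ≤ q * (P ^ 2 * S) := by
        gcongr
        nlinarith [mul_nonneg (sub_nonneg.2 hS1) (sq_nonneg P)]
  have b2 : (ε * P) * P ≤ T := by
    calc (ε * P) * P ≤ (q * P) * P := by gcongr
      _ = q * (P ^ 2 * 1) := by ring
      _ ≤ _ := by rw [hT]; gcongr
  have b3 : q * P * S ≤ T := by
    calc q * P * S = q * (P * S) := by ring
      _ ≤ _ := by rw [hT]; gcongr; nlinarith
  calc _ ≤ 1 * (C * (ε * P) + 1 / 2 * (2 * (ε * P) * P) + 1 / 2 * (8 * (q * P * S)) + (ε * P) * |c₀|) := by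
        gcongr
    _ ≤ (C + |c₀| + 6) * T := by
        have hT0 : 0 ≤ T := by positivity
        rw [one_mul]
        have h5 := mul_le_mul_of_nonneg_left b1 hC
        have h6 := mul_le_mul_of_nonneg_left b1 (abs_nonneg c₀)
        linarith
    _ = _ := by rw [hT]; ring

/-! ### Gaussian integrals on the line and on the plane. -/

theorem integrable_exp_quadratic {β : ℝ} (hβ : 0 < β) (c : ℝ) :
    Integrable fun x : ℝ => Real.exp (-β * x ^ 2 + c * x) := by
  have h := ((integrable_exp_neg_mul_sq hβ).comp_sub_right (c / (2 * β))).const_mul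
    (Real.exp (c ^ 2 / (4 * β)))
  refine h.congr (Filter.Eventually.of_forall fun x => ?_)
  simp only [← Real.exp_add]
  congr 1
  field_simp
  ring

theorem integrable_mul_exp_quadratic {β : ℝ} (hβ : 0 < β) (c : ℝ) :
    Integrable fun x : ℝ => x * Real.exp (-β * x ^ 2 + c * x) := by
  have h := (((integrable_mul_exp_neg_mul_sq hβ).comp_sub_right (c / (2 * β))).const_mul
    (Real.exp (c ^ 2 / (4 * β)))).add ((integrable_exp_quadratic hβ c).const_mul (c / (2 * β)))
  refine h.congr (Filter.Eventually.of_forall fun x => ?_)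
  have e : Real.exp (-β * x ^ 2 + c * x) =
      Real.exp (c ^ 2 / (4 * β)) * Real.exp (-β * (x - c / (2 * β)) ^ 2) := by
    rw [← Real.exp_add]
    congr 1
    field_simp
    ring
  simp only [Pi.add_apply, e]
  ring

theorem integral_exp_quadratic {β : ℝ} (c : ℝ) (hβ : 0 < β) :
    ∫ x : ℝ, Real.exp (-β * x ^ 2 + c * x) = Real.sqrt (Real.pi / β) * Real.exp (c ^ 2 / (4 * β)) := by
  rw [← integral_gaussian, ← integral_sub_right_eq_self (fun x => Real.exp (-β * x ^ 2)) (c / (2 * β)),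
    ← integral_mul_const]
  congr 1
  ext x
  simp only [← Real.exp_add]
  congr 1
  field_simp
  ring

theorem integral_mul_exp_quadratic {β : ℝ} (c : ℝ) (hβ : 0 < β) :
    ∫ x : ℝ, x * Real.exp (-β * x ^ 2 + c * x) =
      c / (2 * β) * (Real.sqrt (Real.pi / β) * Real.exp (c ^ 2 / (4 * β))) := by
  have hodd : ∫ x : ℝ, x * Real.exp (-β * x ^ 2) = 0 := by
    have := integral_neg_eq_self (fun x : ℝ => x * Real.exp (-β * x ^ 2)) volume
    simp only [neg_mul, even_two.neg_pow, integral_neg] at this ⊢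
    linarith
  have h1 : ∫ x : ℝ, (x - c / (2 * β)) * Real.exp (-β * x ^ 2 + c * x) = 0 := by
    have := integral_sub_right_eq_self (fun x : ℝ => x * Real.exp (-β * x ^ 2)) (μ := volume) (c / (2 * β))
    rw [hodd] at this
    rw [← mul_zero (Real.exp (c ^ 2 / (4 * β))), ← this, ← integral_const_mul]
    congr 1
    ext x
    have e : Real.exp (-β * x ^ 2 + c * x) =
        Real.exp (c ^ 2 / (4 * β)) * Real.exp (-β * (x - c / (2 * β)) ^ 2) := by
      rw [← Real.exp_add]
      congr 1
      field_simp
      ring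
    rw [e]; ring
  have h2 : ∫ x : ℝ, x * Real.exp (-β * x ^ 2 + c * x) =
      (∫ x : ℝ, (x - c / (2 * β)) * Real.exp (-β * x ^ 2 + c * x)) +
        ∫ x : ℝ, c / (2 * β) * Real.exp (-β * x ^ 2 + c * x) := by
    rw [← integral_add]
    · congr 1; ext x; ring
    · simp only [sub_mul]
      exact (integrable_mul_exp_quadratic hβ c).sub ((integrable_exp_quadratic hβ c).const_mul _)
    · exact (integrable_exp_quadratic hβ c).const_mul _
  rw [h2, h1, zero_add, integral_const_mul, integral_exp_quadratic c hβ]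

/-- The Gaussian `exp (-β |Z|² + c · Z)` on the plane. -/
noncomputable def gaussLin (β : ℝ) (c Z : ℝ × ℝ) : ℝ :=
  Real.exp (-β * (Z.1 ^ 2 + Z.2 ^ 2) + (c.1 * Z.1 + c.2 * Z.2))

theorem gaussLin_eq_mul (β : ℝ) (c Z : ℝ × ℝ) : gaussLin β c Z =
    Real.exp (-β * Z.1 ^ 2 + c.1 * Z.1) * Real.exp (-β * Z.2 ^ 2 + c.2 * Z.2) := by
  rw [gaussLin, ← Real.exp_add]; congr 1; ring

theorem integrable_gaussLin {β : ℝ} (hβ : 0 < β) (c : ℝ × ℝ) : Integrable (gaussLin β c) := by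
  have := (integrable_exp_quadratic hβ c.1).mul_prod (integrable_exp_quadratic hβ c.2)
  refine this.congr (Filter.Eventually.of_forall fun Z => ?_)
  simp only [gaussLin_eq_mul]

theorem integral_gaussLin {β : ℝ} (hβ : 0 < β) (c : ℝ × ℝ) :
    ∫ Z, gaussLin β c Z = Real.pi / β * Real.exp ((c.1 ^ 2 + c.2 ^ 2) / (4 * β)) := by
  have := integral_prod_mul (μ := (volume : Measure ℝ)) (ν := (volume : Measure ℝ))
    (fun x => Real.exp (-β * x ^ 2 + c.1 * x)) (fun x => Real.exp (-β * x ^ 2 + c.2 * x))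
  rw [← Measure.volume_eq_prod] at this
  simp only [gaussLin_eq_mul]
  rw [this, integral_exp_quadratic _ hβ, integral_exp_quadratic _ hβ, add_div, Real.exp_add]
  have h := Real.mul_self_sqrt (show 0 ≤ Real.pi / β by have := Real.pi_pos; positivity)
  linear_combination (Real.exp (c.1 ^ 2 / (4 * β)) * Real.exp (c.2 ^ 2 / (4 * β))) * h

theorem integral_fst_mul_gaussLin {β : ℝ} (hβ : 0 < β) (c : ℝ × ℝ) :
    ∫ Z : ℝ × ℝ, Z.1 * gaussLin β c Z =
      c.1 / (2 * β) * (Real.pi / β * Real.exp ((c.1 ^ 2 + c.2 ^ 2) / (4 * β))) := by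
  have := integral_prod_mul (μ := (volume : Measure ℝ)) (ν := (volume : Measure ℝ))
    (fun x => x * Real.exp (-β * x ^ 2 + c.1 * x)) (fun x => Real.exp (-β * x ^ 2 + c.2 * x))
  rw [← Measure.volume_eq_prod] at this
  simp only [gaussLin_eq_mul, ← mul_assoc]
  rw [this, integral_exp_quadratic _ hβ, integral_mul_exp_quadratic _ hβ, add_div, Real.exp_add]
  have h := Real.mul_self_sqrt (show 0 ≤ Real.pi / β by have := Real.pi_pos; positivity)
  linear_combination (c.1 / (2 * β)) *
    (Real.exp (c.1 ^ 2 / (4 * β)) * Real.exp (c.2 ^ 2 / (4 * β))) * h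

theorem integral_comp_swap (f : ℝ × ℝ → ℝ) : ∫ Z : ℝ × ℝ, f Z.swap = ∫ Z, f Z := by
  rw [Measure.volume_eq_prod]
  exact integral_prod_swap f

theorem integral_snd_mul_gaussLin {β : ℝ} (hβ : 0 < β) (c : ℝ × ℝ) :
    ∫ Z : ℝ × ℝ, Z.2 * gaussLin β c Z =
      c.2 / (2 * β) * (Real.pi / β * Real.exp ((c.1 ^ 2 + c.2 ^ 2) / (4 * β))) := by
  have := integral_fst_mul_gaussLin hβ c.swap
  rw [← integral_comp_swap] at this
  convert this using 2
  · ext Z; simp [gaussLin, add_comm]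
  · simp only [Prod.fst_swap]
  · simp only [Prod.fst_swap, Prod.snd_swap, add_comm]

/-- The centred Gaussian `exp (-β |Z|²)`. -/
noncomputable def gauss (β : ℝ) (Z : ℝ × ℝ) : ℝ := Real.exp (-β * (Z.1 ^ 2 + Z.2 ^ 2))

theorem gauss_eq_gaussLin (β : ℝ) : gauss β = gaussLin β 0 := by
  ext Z; simp [gauss, gaussLin]

theorem gauss_pos (β : ℝ) (Z : ℝ × ℝ) : 0 < gauss β Z := Real.exp_pos _

@[fun_prop]
theorem continuous_gauss (β : ℝ) : Continuous (gauss β) := by unfold gauss; fun_prop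

theorem gauss_mul_gauss (β β' : ℝ) (Z : ℝ × ℝ) : gauss β Z * gauss β' Z = gauss (β + β') Z := by
  rw [gauss, gauss, gauss, ← Real.exp_add]; congr 1; ring

theorem gauss_sq (β : ℝ) (Z : ℝ × ℝ) : gauss β Z ^ 2 = gauss (2 * β) Z := by
  rw [sq, gauss_mul_gauss, two_mul]

theorem integrable_gauss {β : ℝ} (hβ : 0 < β) : Integrable (gauss β) := by
  rw [gauss_eq_gaussLin]; exact integrable_gaussLin hβ 0

theorem integral_gauss {β : ℝ} (hβ : 0 < β) : ∫ Z, gauss β Z = Real.pi / β := by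
  rw [gauss_eq_gaussLin, integral_gaussLin hβ]; simp

theorem rad_sq_mul_gauss_le {β : ℝ} (hβ : 0 < β) (Z : ℝ × ℝ) :
    (Z.1 ^ 2 + Z.2 ^ 2) * gauss β Z ≤ 2 / β * gauss (β / 2) Z := by
  have := Real.add_one_le_exp (β / 2 * (Z.1 ^ 2 + Z.2 ^ 2))
  have h : gauss (β / 2) Z = Real.exp (β / 2 * (Z.1 ^ 2 + Z.2 ^ 2)) * gauss β Z := by
    rw [gauss, gauss, ← Real.exp_add]; congr 1; ring
  rw [h, ← mul_assoc]
  apply mul_le_mul_of_nonneg_right _ (gauss_pos _ _).le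
  rw [div_mul_eq_mul_div, le_div_iff₀ hβ]
  linarith

theorem integrable_quadratic_mul_gauss {β : ℝ} (hβ : 0 < β) {q : ℝ × ℝ → ℝ} (hq : Continuous q)
    (hb : ∀ Z, |q Z| ≤ Z.1 ^ 2 + Z.2 ^ 2) : Integrable fun Z => q Z * gauss β Z := by
  refine ((integrable_gauss (half_pos hβ)).const_mul (2 / β)).mono'
    (by fun_prop) (Filter.Eventually.of_forall fun Z => ?_)
  rw [Real.norm_eq_abs, abs_mul, abs_of_pos (gauss_pos _ _)]
  exact (mul_le_mul_of_nonneg_right (hb Z) (gauss_pos _ _).le).trans (rad_sq_mul_gauss_le hβ Z)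

theorem integral_sq_mul_exp_neg {β : ℝ} (hβ : 0 < β) :
    ∫ x : ℝ, x ^ 2 * Real.exp (-β * x ^ 2) = 1 / (2 * β) * Real.sqrt (Real.pi / β) := by
  have hint : Integrable fun x : ℝ => x ^ 2 * Real.exp (-β * x ^ 2) := by
    refine ((integrable_exp_neg_mul_sq (half_pos hβ)).const_mul (2 / β)).mono' (by fun_prop)
      (Filter.Eventually.of_forall fun x => ?_)
    have := rad_sq_mul_gauss_le hβ (x, 0)
    simp only [gauss] at this
    rw [Real.norm_eq_abs, abs_of_nonneg (by positivity)]
    simpa using this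
  have hd : ∀ x : ℝ, HasDerivAt (fun x => x * Real.exp (-β * x ^ 2))
      (Real.exp (-β * x ^ 2) - 2 * β * (x ^ 2 * Real.exp (-β * x ^ 2))) x := by
    intro x
    refine ((hasDerivAt_id' x).mul (((hasDerivAt_pow 2 x).const_mul (-β)).exp)).congr_deriv ?_
    push_cast
    ring
  have h0 := integral_eq_zero_of_hasDerivAt_of_integrable hd
    ((integrable_exp_neg_mul_sq hβ).sub (hint.const_mul _)) (integrable_mul_exp_neg_mul_sq hβ)
  rw [integral_sub (integrable_exp_neg_mul_sq hβ) (hint.const_mul _), integral_const_mul,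
    integral_gaussian] at h0
  rw [one_div_mul_eq_div, eq_div_iff (by positivity)]
  linarith

theorem integral_fst_sq_mul_gauss {β : ℝ} (hβ : 0 < β) :
    ∫ Z : ℝ × ℝ, Z.1 ^ 2 * gauss β Z = Real.pi / (2 * β ^ 2) := by
  have := integral_prod_mul (μ := (volume : Measure ℝ)) (ν := (volume : Measure ℝ))
    (fun x => x ^ 2 * Real.exp (-β * x ^ 2)) (fun x => Real.exp (-β * x ^ 2))
  rw [← Measure.volume_eq_prod, integral_gaussian, integral_sq_mul_exp_neg hβ] at this
  have h := Real.mul_self_sqrt (show 0 ≤ Real.pi / β by have := Real.pi_pos; positivity)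
  calc ∫ Z : ℝ × ℝ, Z.1 ^ 2 * gauss β Z
      = ∫ Z : ℝ × ℝ, Z.1 ^ 2 * Real.exp (-β * Z.1 ^ 2) * Real.exp (-β * Z.2 ^ 2) := by
        congr 1; ext Z; rw [gauss, mul_assoc, ← Real.exp_add]; congr 2; ring
    _ = 1 / (2 * β) * (Real.sqrt (Real.pi / β) * Real.sqrt (Real.pi / β)) := by rw [this]; ring
    _ = _ := by rw [h]; field_simp

theorem integral_snd_sq_mul_gauss {β : ℝ} (hβ : 0 < β) :
    ∫ Z : ℝ × ℝ, Z.2 ^ 2 * gauss β Z = Real.pi / (2 * β ^ 2) := by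
  rw [← integral_fst_sq_mul_gauss hβ, ← integral_comp_swap]
  congr 1; ext Z; simp [gauss, add_comm]

theorem integral_fst_mul_gauss {β : ℝ} (hβ : 0 < β) : ∫ Z : ℝ × ℝ, Z.1 * gauss β Z = 0 := by
  rw [gauss_eq_gaussLin, integral_fst_mul_gaussLin hβ]; simp

theorem integral_snd_mul_gauss {β : ℝ} (hβ : 0 < β) : ∫ Z : ℝ × ℝ, Z.2 * gauss β Z = 0 := by
  rw [gauss_eq_gaussLin, integral_snd_mul_gaussLin hβ]; simp

theorem integral_fst_mul_snd_mul_gauss (β : ℝ) :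
    ∫ Z : ℝ × ℝ, Z.1 * Z.2 * gauss β Z = 0 := by
  have h0 : ∫ x : ℝ, x * Real.exp (-β * x ^ 2) = 0 := by
    have := integral_neg_eq_self (fun x : ℝ => x * Real.exp (-β * x ^ 2)) volume
    simp only [neg_mul, even_two.neg_pow, integral_neg] at this ⊢
    linarith
  have := integral_prod_mul (μ := (volume : Measure ℝ)) (ν := (volume : Measure ℝ))
    (fun x => x * Real.exp (-β * x ^ 2)) (fun x => x * Real.exp (-β * x ^ 2))
  rw [← Measure.volume_eq_prod, h0, zero_mul] at this
  rw [← this]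
  congr 1; ext Z
  have : gauss β Z = Real.exp (-β * Z.1 ^ 2) * Real.exp (-β * Z.2 ^ 2) := by
    rw [gauss, ← Real.exp_add]; congr 1; ring
  rw [this]; ring

/-! ### The Mehler kernel: composition rule and low eigenfunctions. -/

/-- The Mehler kernel on the plane, symmetric with respect to Lebesgue measure, with ground state
`exp (-a |X|² / 4)`. -/
noncomputable def mehler (a k : ℝ) (X Y : ℝ × ℝ) : ℝ :=
  a / (2 * Real.pi * (1 - k ^ 2)) * Real.exp (-(a / (4 * (1 - k ^ 2))) *
    ((1 + k ^ 2) * (X.1 ^ 2 + X.2 ^ 2 + (Y.1 ^ 2 + Y.2 ^ 2)) - 4 * k * (X.1 * Y.1 + X.2 * Y.2)))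

theorem mehler_comm (a k : ℝ) (X Y : ℝ × ℝ) : mehler a k X Y = mehler a k Y X := by
  unfold mehler; congr 2; ring

@[fun_prop]
theorem continuous_mehler (a k : ℝ) : Continuous fun p : (ℝ × ℝ) × (ℝ × ℝ) => mehler a k p.1 p.2 := by
  unfold mehler; fun_prop

theorem mehler_pos {a k : ℝ} (ha : 0 < a) (hk : 0 ≤ k) (hk1 : k < 1) (X Y : ℝ × ℝ) : 0 < mehler a k X Y := by
  have h1 : 0 < 1 - k ^ 2 := by nlinarith
  have := Real.pi_pos
  unfold mehler; positivity

/-- The quadratic form in the exponent is `(1-k)² (|X|² + |Y|²) + 2k |X-Y|²`; the second term is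
dropped. -/
theorem mehler_le {a k : ℝ} (ha : 0 < a) (hk : 0 ≤ k) (hk1 : k < 1) (X Y : ℝ × ℝ) :
    mehler a k X Y ≤ a / (2 * Real.pi * (1 - k ^ 2)) *
      (gauss (a * (1 - k) / (4 * (1 + k))) X * gauss (a * (1 - k) / (4 * (1 + k))) Y) := by
  have h1 : 0 < 1 - k ^ 2 := by nlinarith
  have hpi := Real.pi_pos
  unfold mehler gauss
  rw [← Real.exp_add]
  gcongr
  have e : a * (1 - k) / (4 * (1 + k)) = a / (4 * (1 - k ^ 2)) * (1 - k) ^ 2 := by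
    have : 1 - k ≠ 0 := by linarith
    rw [show 1 - k ^ 2 = (1 - k) * (1 + k) by ring]
    field_simp
  rw [e]
  have hc : 0 < a / (4 * (1 - k ^ 2)) := by positivity
  have hq : 0 ≤ 2 * k * ((X.1 - Y.1) ^ 2 + (X.2 - Y.2) ^ 2) := by positivity
  nlinarith [mul_nonneg hc.le hq]

theorem mehler_eq_gaussLin (a k : ℝ) (X Z : ℝ × ℝ) : mehler a k X Z =
    a / (2 * Real.pi * (1 - k ^ 2)) * (gauss (a * (1 + k ^ 2) / (4 * (1 - k ^ 2))) X *
      gaussLin (a * (1 + k ^ 2) / (4 * (1 - k ^ 2)))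
        (a * k / (1 - k ^ 2) * X.1, a * k / (1 - k ^ 2) * X.2) Z) := by
  rw [mehler, gauss, gaussLin, ← Real.exp_add]
  congr 2
  simp only
  have : a / (4 * (1 - k ^ 2)) * (4 * k) = a * k / (1 - k ^ 2) := by
    rw [div_mul_eq_mul_div, show a * (4 * k) = 4 * (a * k) by ring, mul_div_mul_left _ _ (by norm_num)]
  linear_combination (X.1 * Z.1 + X.2 * Z.2) * this

theorem integral_mehler_mul_mehler {a k : ℝ} (ha : 0 < a) (hk : 0 ≤ k) (hk1 : k < 1) (X Y : ℝ × ℝ) :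
    ∫ Z, mehler a k X Z * mehler a k Z Y = mehler a (k ^ 2) X Y := by
  have h1 : 0 < 1 - k ^ 2 := by nlinarith
  have h2 : 0 < 1 - (k ^ 2) ^ 2 := by nlinarith [sq_nonneg k]
  have hpi := Real.pi_pos
  set β := a * (1 + k ^ 2) / (4 * (1 - k ^ 2)) with hβ
  have hβ0 : 0 < β := by positivity
  have e : ∀ Z, mehler a k X Z * mehler a k Z Y = (a / (2 * Real.pi * (1 - k ^ 2))) ^ 2 *
      (gauss β X * gauss β Y) * gaussLin (2 * β)
        (a * k / (1 - k ^ 2) * (X.1 + Y.1), a * k / (1 - k ^ 2) * (X.2 + Y.2)) Z := by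
    intro Z
    rw [mehler_comm a k Z Y, mehler_eq_gaussLin, mehler_eq_gaussLin, ← hβ]
    have : gaussLin (2 * β) (a * k / (1 - k ^ 2) * (X.1 + Y.1), a * k / (1 - k ^ 2) * (X.2 + Y.2)) Z =
        gaussLin β (a * k / (1 - k ^ 2) * X.1, a * k / (1 - k ^ 2) * X.2) Z *
        gaussLin β (a * k / (1 - k ^ 2) * Y.1, a * k / (1 - k ^ 2) * Y.2) Z := by
      simp only [gaussLin, ← Real.exp_add]; congr 1; ring
    rw [this]; ring
  simp only [e]
  rw [integral_const_mul, integral_gaussLin (by positivity), mehler, gauss, gauss]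
  have e3 : (a / (2 * Real.pi * (1 - k ^ 2))) ^ 2 * (Real.pi / (2 * β)) =
      a / (2 * Real.pi * (1 - (k ^ 2) ^ 2)) := by
    rw [hβ, show 1 - (k ^ 2) ^ 2 = (1 - k ^ 2) * (1 + k ^ 2) by ring]
    field_simp
    ring
  rw [← e3, ← Real.exp_add]
  rw [show ∀ u v w z : ℝ, u * v * (w * z) = u * w * (v * z) by intros; ring, ← Real.exp_add]
  congr 2
  simp only
  rw [hβ, show 1 - (k ^ 2) ^ 2 = (1 - k ^ 2) * (1 + k ^ 2) by ring]
  field_simp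
  ring

section
variable {a k : ℝ}

theorem mehler_mul_gauss (X Z : ℝ × ℝ) (h1 : 0 < 1 - k ^ 2) :
    mehler a k X Z * gauss (a / 4) Z = a / (2 * Real.pi * (1 - k ^ 2)) *
      gauss (a * (1 + k ^ 2) / (4 * (1 - k ^ 2))) X *
      gaussLin (a / (2 * (1 - k ^ 2))) (a * k / (1 - k ^ 2) * X.1, a * k / (1 - k ^ 2) * X.2) Z := by
  rw [mehler_eq_gaussLin]
  have : gaussLin (a / (2 * (1 - k ^ 2))) (a * k / (1 - k ^ 2) * X.1, a * k / (1 - k ^ 2) * X.2) Z =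
      gaussLin (a * (1 + k ^ 2) / (4 * (1 - k ^ 2)))
        (a * k / (1 - k ^ 2) * X.1, a * k / (1 - k ^ 2) * X.2) Z * gauss (a / 4) Z := by
    simp only [gaussLin, gauss, ← Real.exp_add]; congr 1
    field_simp
    ring
  rw [this]; ring

/-- The common Gaussian integral behind the three eigenfunction identities below, with eigenvalues
`1`, `k`, `k`. -/
theorem mehler_ground_aux (ha : 0 < a) (hk : 0 ≤ k) (hk1 : k < 1) (X : ℝ × ℝ) :
    a / (2 * Real.pi * (1 - k ^ 2)) * gauss (a * (1 + k ^ 2) / (4 * (1 - k ^ 2))) X *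
      (Real.pi / (a / (2 * (1 - k ^ 2))) * Real.exp (((a * k / (1 - k ^ 2) * X.1) ^ 2 +
        (a * k / (1 - k ^ 2) * X.2) ^ 2) / (4 * (a / (2 * (1 - k ^ 2)))))) = gauss (a / 4) X := by
  have h1 : 0 < 1 - k ^ 2 := by nlinarith
  have hpi := Real.pi_pos
  have e1 : a / (2 * Real.pi * (1 - k ^ 2)) * (Real.pi / (a / (2 * (1 - k ^ 2)))) = 1 := by
    field_simp
  rw [show ∀ u v w z : ℝ, u * v * (w * z) = u * w * (v * z) by intros; ring, e1, one_mul, gauss, gauss,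
    ← Real.exp_add]
  congr 1
  field_simp
  ring

theorem integral_mehler_mul_gauss (ha : 0 < a) (hk : 0 ≤ k) (hk1 : k < 1) (X : ℝ × ℝ) :
    ∫ Z, mehler a k X Z * gauss (a / 4) Z = gauss (a / 4) X := by
  have h1 : 0 < 1 - k ^ 2 := by nlinarith
  simp only [mehler_mul_gauss X _ h1]
  rw [integral_const_mul, integral_gaussLin (by positivity)]
  exact mehler_ground_aux ha hk hk1 X

theorem integral_mehler_mul_fst_mul_gauss (ha : 0 < a) (hk : 0 ≤ k) (hk1 : k < 1) (X : ℝ × ℝ) :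
    ∫ Z : ℝ × ℝ, mehler a k X Z * (Z.1 * gauss (a / 4) Z) = k * (X.1 * gauss (a / 4) X) := by
  have h1 : 0 < 1 - k ^ 2 := by nlinarith
  have e : ∀ Z : ℝ × ℝ, mehler a k X Z * (Z.1 * gauss (a / 4) Z) =
      a / (2 * Real.pi * (1 - k ^ 2)) * gauss (a * (1 + k ^ 2) / (4 * (1 - k ^ 2))) X *
      (Z.1 * gaussLin (a / (2 * (1 - k ^ 2))) (a * k / (1 - k ^ 2) * X.1, a * k / (1 - k ^ 2) * X.2) Z) := by
    intro Z
    rw [mul_left_comm, mehler_mul_gauss X Z h1]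
    ring
  simp only [e]
  rw [integral_const_mul, integral_fst_mul_gaussLin (by positivity), ← mehler_ground_aux ha hk hk1 X]
  have : a * k / (1 - k ^ 2) * X.1 / (2 * (a / (2 * (1 - k ^ 2)))) = k * X.1 := by field_simp
  simp only [this]
  ring

theorem integral_mehler_mul_snd_mul_gauss (ha : 0 < a) (hk : 0 ≤ k) (hk1 : k < 1) (X : ℝ × ℝ) :
    ∫ Z : ℝ × ℝ, mehler a k X Z * (Z.2 * gauss (a / 4) Z) = k * (X.2 * gauss (a / 4) X) := by
  have h1 : 0 < 1 - k ^ 2 := by nlinarith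
  have e : ∀ Z : ℝ × ℝ, mehler a k X Z * (Z.2 * gauss (a / 4) Z) =
      a / (2 * Real.pi * (1 - k ^ 2)) * gauss (a * (1 + k ^ 2) / (4 * (1 - k ^ 2))) X *
      (Z.2 * gaussLin (a / (2 * (1 - k ^ 2))) (a * k / (1 - k ^ 2) * X.1, a * k / (1 - k ^ 2) * X.2) Z) := by
    intro Z
    rw [mul_left_comm, mehler_mul_gauss X Z h1]
    ring
  simp only [e]
  rw [integral_const_mul, integral_snd_mul_gaussLin (by positivity), ← mehler_ground_aux ha hk hk1 X]
  have : a * k / (1 - k ^ 2) * X.2 / (2 * (a / (2 * (1 - k ^ 2)))) = k * X.2 := by field_simp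
  simp only [this]
  ring

end

/-! ### The Mehler operators on `L²`. -/

theorem sq_integral_mul_le {α : Type*} [MeasurableSpace α] {μ : Measure α} {f h : α → ℝ}
    (hf : MemLp f 2 μ) (hh : MemLp h 2 μ) :
    (∫ x, f x * h x ∂μ) ^ 2 ≤ (∫ x, f x ^ 2 ∂μ) * ∫ x, h x ^ 2 ∂μ := by
  have hff : Integrable (fun x => f x ^ 2) μ := hf.integrable_sq
  have hhh : Integrable (fun x => h x ^ 2) μ := hh.integrable_sq
  have hfh : Integrable (fun x => f x * h x) μ := hf.integrable_mul hh
  have key : ∀ t : ℝ, 0 ≤ (∫ x, h x ^ 2 ∂μ) * (t * t) + (2 * ∫ x, f x * h x ∂μ) * t +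
      ∫ x, f x ^ 2 ∂μ := by
    intro t
    have h0 : 0 ≤ ∫ x, (f x + t * h x) ^ 2 ∂μ := integral_nonneg fun x => sq_nonneg _
    have e : ∫ x, (f x + t * h x) ^ 2 ∂μ =
        ∫ x, (h x ^ 2 * (t * t) + (2 * t) * (f x * h x) + f x ^ 2) ∂μ := by
      congr 1; ext x; ring
    rw [e, integral_add ((hhh.mul_const _).fun_add (hfh.const_mul _)) hff,
      integral_add (hhh.mul_const _) (hfh.const_mul _), integral_mul_const, integral_const_mul] at h0
    linarith
  have := discrim_le_zero key
  rw [discrim] at this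
  nlinarith

theorem memLp_gauss {β : ℝ} (hβ : 0 < β) : MemLp (gauss β) 2 := by
  rw [memLp_two_iff_integrable_sq (by fun_prop)]
  simp only [gauss_sq]
  exact integrable_gauss (by positivity)

theorem memLp_fst_mul_gauss {β : ℝ} (hβ : 0 < β) :
    MemLp (fun Z : ℝ × ℝ => Z.1 * gauss β Z) 2 := by
  rw [memLp_two_iff_integrable_sq (by fun_prop)]
  simp only [mul_pow, gauss_sq]
  exact integrable_quadratic_mul_gauss (by positivity) (by fun_prop)
    fun Z => by rw [abs_of_nonneg (sq_nonneg _)]; nlinarith [sq_nonneg Z.2]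

theorem memLp_snd_mul_gauss {β : ℝ} (hβ : 0 < β) :
    MemLp (fun Z : ℝ × ℝ => Z.2 * gauss β Z) 2 := by
  rw [memLp_two_iff_integrable_sq (by fun_prop)]
  simp only [mul_pow, gauss_sq]
  exact integrable_quadratic_mul_gauss (by positivity) (by fun_prop)
    fun Z => by rw [abs_of_nonneg (sq_nonneg _)]; nlinarith [sq_nonneg Z.1]

theorem integrable_gauss_mul {β : ℝ} (hβ : 0 < β) {f : ℝ × ℝ → ℝ} (hf : MemLp f 2) :
    Integrable fun Z => gauss β Z * f Z := (memLp_gauss hβ).integrable_mul hf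

/-- The integral operator with kernel `mehler a k`. -/
noncomputable def mehlerOp (a k : ℝ) (f : ℝ × ℝ → ℝ) (X : ℝ × ℝ) : ℝ := ∫ Y, mehler a k X Y * f Y

theorem exists_mehler_le {a k : ℝ} (ha : 0 < a) (hk : 0 ≤ k) (hk1 : k < 1) :
    ∃ C β : ℝ, 0 < C ∧ 0 < β ∧ ∀ X Y, ‖mehler a k X Y‖ ≤ C * (gauss β X * gauss β Y) := by
  have h1 : 0 < 1 - k ^ 2 := by nlinarith
  have h2 : 0 < 1 - k := by linarith
  have hpi := Real.pi_pos
  refine ⟨a / (2 * Real.pi * (1 - k ^ 2)), a * (1 - k) / (4 * (1 + k)), by positivity, by positivity,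
    fun X Y => ?_⟩
  rw [Real.norm_of_nonneg (mehler_pos ha hk hk1 _ _).le]
  exact mehler_le ha hk hk1 X Y

section
variable {a k : ℝ}

theorem integrable_mehler_mul_prod (ha : 0 < a) (hk : 0 ≤ k) (hk1 : k < 1) {f h : ℝ × ℝ → ℝ}
    (hf : MemLp f 2) (hh : MemLp h 2) :
    Integrable (fun p : (ℝ × ℝ) × (ℝ × ℝ) => mehler a k p.1 p.2 * (f p.1 * h p.2))
      (volume.prod volume) := by
  obtain ⟨C, β, hC, hβ, hle⟩ := exists_mehler_le ha hk hk1
  have h1 := ((integrable_gauss_mul hβ hf).norm.mul_prod (integrable_gauss_mul hβ hh).norm).const_mul C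
  refine h1.mono' ?_ (Filter.Eventually.of_forall fun p => ?_)
  · exact (continuous_mehler a k).aestronglyMeasurable.mul (hf.1.comp_fst.mul hh.1.comp_snd)
  · rw [norm_mul]
    refine (mul_le_mul_of_nonneg_right (hle p.1 p.2) (norm_nonneg _)).trans ?_
    rw [norm_mul, norm_mul, norm_mul, Real.norm_of_nonneg (gauss_pos _ p.1).le,
      Real.norm_of_nonneg (gauss_pos _ p.2).le]
    apply le_of_eq
    ring

theorem memLp_mehler (ha : 0 < a) (hk : 0 ≤ k) (hk1 : k < 1) (X : ℝ × ℝ) :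
    MemLp (mehler a k X) 2 := by
  obtain ⟨C, β, hC, hβ, hle⟩ := exists_mehler_le ha hk hk1
  have hc : Continuous fun Z => mehler a k X Z := by unfold mehler; fun_prop
  have hg : MemLp (fun Z => (C * gauss β X) * gauss β Z) 2 volume := (memLp_gauss hβ).const_mul _
  refine hg.mono' hc.aestronglyMeasurable (Filter.Eventually.of_forall fun Z => ?_)
  rw [mul_assoc]
  exact hle X Z

theorem integrable_mehler_mul (ha : 0 < a) (hk : 0 ≤ k) (hk1 : k < 1) {f : ℝ × ℝ → ℝ}
    (hf : MemLp f 2) (X : ℝ × ℝ) : Integrable fun Y => mehler a k X Y * f Y :=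
  (memLp_mehler ha hk hk1 X).integrable_mul hf

theorem memLp_mehlerOp (ha : 0 < a) (hk : 0 ≤ k) (hk1 : k < 1) {f : ℝ × ℝ → ℝ} (hf : MemLp f 2) :
    MemLp (mehlerOp a k f) 2 := by
  obtain ⟨C, β, hC, hβ, hle⟩ := exists_mehler_le ha hk hk1
  have hm : AEStronglyMeasurable (mehlerOp a k f) volume := by
    have : AEStronglyMeasurable (fun p : (ℝ × ℝ) × (ℝ × ℝ) => mehler a k p.1 p.2 * f p.2)
        (volume.prod volume) := (continuous_mehler a k).aestronglyMeasurable.mul hf.1.comp_snd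
    exact this.integral_prod_right'
  set J := ∫ Y, ‖gauss β Y * f Y‖ with hJ
  refine MemLp.mono' (g := fun Z => (C * J) * gauss β Z) ((memLp_gauss hβ).const_mul _) hm
    (Filter.Eventually.of_forall fun X => ?_)
  have h1 : ‖mehlerOp a k f X‖ ≤ ∫ Y, (C * gauss β X) * ‖gauss β Y * f Y‖ := by
    refine norm_integral_le_of_norm_le ((integrable_gauss_mul hβ hf).norm.const_mul _)
      (Filter.Eventually.of_forall fun Y => ?_)
    rw [norm_mul, norm_mul, Real.norm_of_nonneg (gauss_pos _ Y).le]
    refine (mul_le_mul_of_nonneg_right (hle X Y) (norm_nonneg _)).trans (le_of_eq ?_)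
    ring
  rw [integral_const_mul, ← hJ] at h1
  linarith

theorem integral_mehlerOp_mul_comm (ha : 0 < a) (hk : 0 ≤ k) (hk1 : k < 1) {f h : ℝ × ℝ → ℝ}
    (hf : MemLp f 2) (hh : MemLp h 2) :
    ∫ X, mehlerOp a k f X * h X = ∫ X, f X * mehlerOp a k h X := by
  calc ∫ X, mehlerOp a k f X * h X = ∫ X, ∫ Y, mehler a k X Y * (h X * f Y) := by
        congr 1; ext X
        rw [mehlerOp, ← integral_mul_const]
        congr 1; ext Y; ring
    _ = ∫ Y, ∫ X, mehler a k X Y * (h X * f Y) :=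
        integral_integral_swap (integrable_mehler_mul_prod ha hk hk1 hh hf)
    _ = _ := by
        congr 1; ext Y
        rw [mehlerOp, ← integral_const_mul]
        congr 1; ext X
        rw [mehler_comm]; ring

theorem mehlerOp_mehlerOp (ha : 0 < a) (hk : 0 ≤ k) (hk1 : k < 1) {f : ℝ × ℝ → ℝ}
    (hf : MemLp f 2) (X : ℝ × ℝ) : mehlerOp a k (mehlerOp a k f) X = mehlerOp a (k ^ 2) f X := by
  calc mehlerOp a k (mehlerOp a k f) X = ∫ Z, ∫ Y, mehler a k Z Y * (mehler a k X Z * f Y) := by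
        rw [mehlerOp]
        congr 1; ext Z
        rw [mehlerOp, ← integral_const_mul]
        congr 1; ext Y; ring
    _ = ∫ Y, ∫ Z, mehler a k Z Y * (mehler a k X Z * f Y) :=
        integral_integral_swap (integrable_mehler_mul_prod ha hk hk1 (memLp_mehler ha hk hk1 X) hf)
    _ = _ := by
        rw [mehlerOp]
        congr 1; ext Y
        rw [← integral_mehler_mul_mehler ha hk hk1, ← integral_mul_const]
        congr 1; ext Z; ring

/-- Symmetry and the composition rule give `‖S_k f‖² = ⟨S_{k²} f, f⟩`; Cauchy-Schwarz does the rest.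
Iterated, this relates `k` to arbitrarily small parameters. -/
theorem sq_integral_mehlerOp_mul_self_le (ha : 0 < a) (hk : 0 ≤ k) (hk1 : k < 1) {f : ℝ × ℝ → ℝ}
    (hf : MemLp f 2) : (∫ X, mehlerOp a k f X * f X) ^ 2 ≤
      (∫ X, f X ^ 2) * ∫ X, mehlerOp a (k ^ 2) f X * f X := by
  have hS := memLp_mehlerOp ha hk hk1 hf
  have h1 := sq_integral_mul_le hS hf
  have h2 : ∫ X, mehlerOp a k f X ^ 2 = ∫ X, mehlerOp a (k ^ 2) f X * f X := by
    simp only [sq (mehlerOp a k f _)]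
    rw [← integral_mehlerOp_mul_comm ha hk hk1 hS hf]
    simp only [mehlerOp_mehlerOp ha hk hk1 hf]
  rw [h2] at h1
  linarith

end

/-! ### Spectral gap of the Mehler operators above the first two levels. -/

theorem abs_exp_sub_one_sub_id_le_sq_mul (E : ℝ) :
    |Real.exp E - 1 - E| ≤ E ^ 2 * Real.exp |E| := by
  have h1 := Real.add_one_le_exp E
  rw [abs_of_nonneg (by linarith)]
  have h2 := Real.add_one_le_exp (-E)
  have h3 : Real.exp E * Real.exp (-E) = 1 := by rw [← Real.exp_add]; simp
  have h4 : Real.exp E - 1 ≤ E * Real.exp E := by nlinarith [Real.exp_pos E]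
  rcases le_total 0 E with h | h
  · rw [abs_of_nonneg h]
    nlinarith
  · have h5 : 1 ≤ Real.exp |E| := Real.one_le_exp (abs_nonneg _)
    nlinarith [sq_nonneg E]

-- Taylor expansion in `k` to first order. The terms of order `0` and `1` are tensor products of the
-- ground state and of the first-level eigenfunctions. Polynomial growth in the remainder is
-- absorbed by weakening the Gaussians from `a/4` to `a/8`.
set_option maxHeartbeats 1000000 in
theorem mehler_expansion {a k : ℝ} (ha : 0 < a) (hk : 0 ≤ k) (hk1 : k ≤ 1 / 16) (X Y : ℝ × ℝ) :
    |mehler a k X Y - a / (2 * Real.pi) * (gauss (a / 4) X * gauss (a / 4) Y *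
      (1 + a * k * (X.1 * Y.1 + X.2 * Y.2)))| ≤
      (1000 * (a / (2 * Real.pi))) * k ^ 2 * (gauss (a / 8) X * gauss (a / 8) Y) := by
  have hpi := Real.pi_pos
  set D := 1 - k ^ 2 with hD
  have hD1 : (255 : ℝ) / 256 ≤ D := by nlinarith
  have hD0 : 0 < D := by linarith
  set N := X.1 ^ 2 + X.2 ^ 2 + (Y.1 ^ 2 + Y.2 ^ 2) with hN
  set I := X.1 * Y.1 + X.2 * Y.2 with hI
  have hN0 : 0 ≤ N := by positivity
  have hIN : |I| ≤ N / 2 := by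
    rw [abs_le]
    constructor <;>
      nlinarith [sq_nonneg (X.1 + Y.1), sq_nonneg (X.2 + Y.2), sq_nonneg (X.1 - Y.1), sq_nonneg (X.2 - Y.2)]
  obtain ⟨hI1, hI2⟩ := abs_le.1 hIN
  set σ := a * N with hσ
  have hσ0 : 0 ≤ σ := by positivity
  set E := a * (k * I - k ^ 2 * N / 2) / D with hE
  have hEσ : |E| ≤ k * σ := by
    rw [hE, abs_div, abs_of_pos hD0, div_le_iff₀ hD0, abs_mul, abs_of_pos ha, hσ]
    have : |k * I - k ^ 2 * N / 2| ≤ k * N * D := by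
      have hkN : 0 ≤ k * N := by positivity
      rw [abs_le]; constructor <;> nlinarith
    nlinarith
  have hE1 : |E - a * k * I| ≤ k ^ 2 * σ := by
    have e : E - a * k * I = a * k ^ 2 * (k * I - N / 2) / D := by
      rw [hE, hD]
      have : 1 - k ^ 2 ≠ 0 := by rw [← hD]; exact hD0.ne'
      field_simp
      ring
    rw [e, abs_div, abs_of_pos hD0, div_le_iff₀ hD0, abs_mul, abs_of_nonneg (by positivity), hσ]
    have : |k * I - N / 2| ≤ N * D := by
      have hkN : k * N ≤ 1 / 16 * N := by gcongr
      have h1 : |k * I| ≤ 1 / 16 * (N / 2) := by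
        rw [abs_mul, abs_of_nonneg hk]; gcongr
      obtain ⟨h3, h4⟩ := abs_le.1 h1
      rw [abs_le]; constructor <;> nlinarith
    calc a * k ^ 2 * |k * I - N / 2| ≤ a * k ^ 2 * (N * D) := by gcongr
      _ = _ := by ring
  have hexpE : Real.exp |E| ≤ Real.exp (k * σ) := Real.exp_le_exp.2 hEσ
  have h1e : 1 ≤ Real.exp (k * σ) := Real.one_le_exp (by positivity)
  have hDinv : |D⁻¹ - 1| ≤ 2 * k ^ 2 := by
    rw [show D⁻¹ - 1 = k ^ 2 / D by rw [hD] at *; field_simp; ring, abs_of_nonneg (by positivity),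
      div_le_iff₀ hD0]
    nlinarith [sq_nonneg k]
  have hmain : |D⁻¹ * Real.exp E - (1 + a * k * I)| ≤ k ^ 2 * (1000 * Real.exp (σ / 8)) := by
    have e : D⁻¹ * Real.exp E - (1 + a * k * I) = (D⁻¹ - 1) * Real.exp E + (Real.exp E - 1 - E) +
        (E - a * k * I) := by ring
    have b1 : |(D⁻¹ - 1) * Real.exp E| ≤ 2 * k ^ 2 * Real.exp (k * σ) := by
      rw [abs_mul, abs_of_pos (Real.exp_pos E)]
      gcongr
      exact (le_abs_self E).trans hEσ
    have b2 : |Real.exp E - 1 - E| ≤ (k * σ) ^ 2 * Real.exp (k * σ) := by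
      refine (abs_exp_sub_one_sub_id_le_sq_mul E).trans ?_
      rw [← sq_abs E]
      gcongr
    have b4 : Real.exp (k * σ) ≤ Real.exp (σ / 16) := by
      apply Real.exp_le_exp.2; nlinarith
    have b5 : Real.exp (σ / 8) = Real.exp (σ / 16) * Real.exp (σ / 16) := by
      rw [← Real.exp_add]; congr 1; ring
    have b6 : 1 + σ / 16 + (σ / 16) ^ 2 / 2 ≤ Real.exp (σ / 16) :=
      Real.quadratic_le_exp_of_nonneg (by positivity)
    rw [e]
    calc _ ≤ |(D⁻¹ - 1) * Real.exp E| + |Real.exp E - 1 - E| + |E - a * k * I| :=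
          (abs_add_le _ _).trans (by gcongr; exact abs_add_le _ _)
      _ ≤ 2 * k ^ 2 * Real.exp (k * σ) + (k * σ) ^ 2 * Real.exp (k * σ) + k ^ 2 * σ * Real.exp (k * σ) := by
          have : k ^ 2 * σ ≤ k ^ 2 * σ * Real.exp (k * σ) :=
            le_mul_of_one_le_right (by positivity) h1e
          linarith
      _ = k ^ 2 * ((2 + σ ^ 2 + σ) * Real.exp (k * σ)) := by ring
      -- One factor `exp(σ/16)` dominates `exp(kσ)` because `k ≤ 1/16`; the other dominates the
      -- quadratic in `σ`, since `1000/512 ≥ 1`.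
      _ ≤ k ^ 2 * ((1000 * Real.exp (σ / 16)) * Real.exp (σ / 16)) := by
          gcongr
          nlinarith [sq_nonneg σ]
      _ = _ := by rw [b5]; ring
  have hm : mehler a k X Y = a / (2 * Real.pi) * (gauss (a / 4) X * gauss (a / 4) Y) * (D⁻¹ * Real.exp E) := by
    have e2 : -(a / (4 * D)) * ((1 + k ^ 2) * N - 4 * k * I) =
        -(a / 4) * (X.1 ^ 2 + X.2 ^ 2) + -(a / 4) * (Y.1 ^ 2 + Y.2 ^ 2) + E := by
      rw [hE, show -(a / 4) * (X.1 ^ 2 + X.2 ^ 2) + -(a / 4) * (Y.1 ^ 2 + Y.2 ^ 2) = -(a / 4) * N by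
        rw [hN]; ring]
      field_simp
      rw [hD]; ring
    rw [mehler, ← hD, ← hN, ← hI, e2, Real.exp_add, Real.exp_add, gauss, gauss]
    field_simp
  have hg : gauss (a / 4) X * gauss (a / 4) Y * Real.exp (σ / 8) = gauss (a / 8) X * gauss (a / 8) Y := by
    rw [gauss, gauss, gauss, gauss, ← Real.exp_add, ← Real.exp_add, ← Real.exp_add]
    congr 1
    rw [hσ, hN]; ring
  rw [hm, show a / (2 * Real.pi) * (gauss (a / 4) X * gauss (a / 4) Y) * (D⁻¹ * Real.exp E) -
    a / (2 * Real.pi) * (gauss (a / 4) X * gauss (a / 4) Y * (1 + a * k * I)) =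
    a / (2 * Real.pi) * (gauss (a / 4) X * gauss (a / 4) Y) * (D⁻¹ * Real.exp E - (1 + a * k * I)) by ring,
    abs_mul, abs_of_pos (by have := gauss_pos (a / 4) X; have := gauss_pos (a / 4) Y; positivity), ← hg]
  have := gauss_pos (a / 4) X
  have := gauss_pos (a / 4) Y
  calc _ ≤ a / (2 * Real.pi) * (gauss (a / 4) X * gauss (a / 4) Y) * (k ^ 2 * (1000 * Real.exp (σ / 8))) := by
        gcongr
    _ = _ := by ring

/-- Orthogonality to the first two levels of the harmonic oscillator. -/
structure OrthLow (a : ℝ) (f : ℝ × ℝ → ℝ) : Prop where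
  zero : ∫ X, gauss (a / 4) X * f X = 0
  fst : ∫ X : ℝ × ℝ, X.1 * gauss (a / 4) X * f X = 0
  snd : ∫ X : ℝ × ℝ, X.2 * gauss (a / 4) X * f X = 0

/-- Orthogonality kills the first-order expansion of the kernel, so only the `O(k²)` remainder acts
on `f`. The constant `4000` is immaterial: it disappears when `2^j`-th roots are taken. -/
theorem integral_mehlerOp_mul_self_le_of_small {a k : ℝ} (ha : 0 < a) (hk : 0 ≤ k) (hk1 : k ≤ 1 / 16)
    {f : ℝ × ℝ → ℝ} (hf : MemLp f 2) (ho : OrthLow a f) :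
    ∫ X, mehlerOp a k f X * f X ≤ 4000 * k ^ 2 * ∫ X, f X ^ 2 := by
  have hpi := Real.pi_pos
  have ha8 : 0 < a / 8 := by positivity
  have hgf := integrable_gauss_mul (β := a / 4) (by positivity) hf
  have hgf1 : Integrable fun X : ℝ × ℝ => X.1 * gauss (a / 4) X * f X :=
    (memLp_fst_mul_gauss (by positivity)).integrable_mul hf
  have hgf2 : Integrable fun X : ℝ × ℝ => X.2 * gauss (a / 4) X * f X :=
    (memLp_snd_mul_gauss (by positivity)).integrable_mul hf
  have hg8 := integrable_gauss_mul ha8 hf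
  set I8 := ∫ Y, ‖gauss (a / 8) Y * f Y‖ with hI8
  have hpt : ∀ X, |mehlerOp a k f X| ≤ (1000 * (a / (2 * Real.pi))) * k ^ 2 * gauss (a / 8) X * I8 := by
    intro X
    have e : mehlerOp a k f X = ∫ Y, (mehler a k X Y - a / (2 * Real.pi) * (gauss (a / 4) X *
        gauss (a / 4) Y * (1 + a * k * (X.1 * Y.1 + X.2 * Y.2)))) * f Y := by
      have e1 : ∀ Y, (mehler a k X Y - a / (2 * Real.pi) * (gauss (a / 4) X *
        gauss (a / 4) Y * (1 + a * k * (X.1 * Y.1 + X.2 * Y.2)))) * f Y = mehler a k X Y * f Y -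
        a / (2 * Real.pi) * gauss (a / 4) X * ((gauss (a / 4) Y * f Y) +
          a * k * X.1 * (Y.1 * gauss (a / 4) Y * f Y) + a * k * X.2 * (Y.2 * gauss (a / 4) Y * f Y)) := by
        intro Y; ring
      simp only [e1]
      rw [integral_sub (integrable_mehler_mul ha hk (by linarith) hf X)
        (((hgf.fun_add (hgf1.const_mul _)).fun_add (hgf2.const_mul _)).const_mul _), integral_const_mul,
        integral_add (hgf.fun_add (hgf1.const_mul _)) (hgf2.const_mul _),
        integral_add hgf (hgf1.const_mul _), integral_const_mul, integral_const_mul,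
        ho.zero, ho.fst, ho.snd, mehlerOp]
      ring
    rw [e, ← Real.norm_eq_abs, hI8, ← integral_const_mul]
    refine norm_integral_le_of_norm_le (hg8.norm.const_mul _) (Filter.Eventually.of_forall fun Y => ?_)
    rw [norm_mul, norm_mul, Real.norm_eq_abs, Real.norm_of_nonneg (gauss_pos _ Y).le]
    calc _ ≤ (1000 * (a / (2 * Real.pi))) * k ^ 2 * (gauss (a / 8) X * gauss (a / 8) Y) * ‖f Y‖ := by
          gcongr; exact mehler_expansion ha hk hk1 X Y
      _ = _ := by ring
  have h1 : ∫ X, mehlerOp a k f X * f X ≤ (1000 * (a / (2 * Real.pi))) * k ^ 2 * I8 * I8 := by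
    calc ∫ X, mehlerOp a k f X * f X ≤ ∫ X, (1000 * (a / (2 * Real.pi))) * k ^ 2 * I8 *
          ‖gauss (a / 8) X * f X‖ := by
          apply integral_mono ((memLp_mehlerOp ha hk (by linarith) hf).integrable_mul hf)
            (hg8.norm.const_mul _)
          intro X
          refine (le_abs_self _).trans ?_
          simp only [Pi.mul_apply]
          rw [abs_mul, norm_mul, Real.norm_of_nonneg (gauss_pos _ X).le, Real.norm_eq_abs]
          calc _ ≤ (1000 * (a / (2 * Real.pi))) * k ^ 2 * gauss (a / 8) X * I8 * |f X| := by
                gcongr; exact hpt X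
            _ = _ := by ring
      _ = _ := by rw [integral_const_mul]
  have h2 : I8 ^ 2 ≤ 4 * Real.pi / a * ∫ X, f X ^ 2 := by
    have := sq_integral_mul_le (memLp_gauss ha8) hf.norm
    have e : ∫ X, gauss (a / 8) X ^ 2 = 4 * Real.pi / a := by
      simp only [gauss_sq]
      rw [integral_gauss (by positivity)]
      field_simp; norm_num
    rw [e] at this
    simp only [Real.norm_eq_abs, sq_abs] at this
    convert this using 2
    rw [hI8]
    congr 1; ext X
    rw [norm_mul, Real.norm_of_nonneg (gauss_pos _ X).le, Real.norm_eq_abs]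
  calc _ ≤ (1000 * (a / (2 * Real.pi))) * k ^ 2 * I8 ^ 2 := by rw [sq I8, ← mul_assoc]; exact h1
    _ ≤ (1000 * (a / (2 * Real.pi))) * k ^ 2 * (4 * Real.pi / a * ∫ X, f X ^ 2) := by gcongr
    _ = 2000 * k ^ 2 * ∫ X, f X ^ 2 := by field_simp; ring
    _ ≤ _ := by
      have : 0 ≤ ∫ X, f X ^ 2 := integral_nonneg fun X => sq_nonneg _
      gcongr; norm_num

/-- A power trick in place of a Hermite expansion. With `T(k) = ⟨S_k f, f⟩` and `n = ‖f‖²`,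
iterating `T(k)² ≤ n T(k²)` and inserting the crude bound at the small parameter `k^{2^j}` gives
`T(k)^{2^j} ≤ 4000 (k² n)^{2^j}` for all large `j`. This is impossible if `T(k) > k² n`. -/
theorem integral_mehlerOp_mul_self_le_of_orthLow {a k : ℝ} (ha : 0 < a) (hk : 0 < k) (hk1 : k < 1)
    {f : ℝ × ℝ → ℝ} (hf : MemLp f 2) (ho : OrthLow a f) :
    ∫ X, mehlerOp a k f X * f X ≤ k ^ 2 * ∫ X, f X ^ 2 := by
  set T : ℝ → ℝ := fun k => ∫ X, mehlerOp a k f X * f X with hT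
  set n := ∫ X, f X ^ 2 with hn
  have hn0 : 0 ≤ n := integral_nonneg fun X => sq_nonneg _
  change T k ≤ k ^ 2 * n
  by_contra! hcon
  have hT0 : 0 < T k := lt_of_le_of_lt (by positivity) hcon
  have hstep : ∀ j : ℕ, T k ^ (2 ^ j) ≤ n ^ (2 ^ j - 1) * T (k ^ (2 ^ j)) := by
    intro j
    induction j with
    | zero => simp
    | succ j ih =>
      have h1 := sq_integral_mehlerOp_mul_self_le ha (pow_nonneg hk.le (2 ^ j))
        (pow_lt_one₀ hk.le hk1 (by positivity)) hf
      rw [← pow_mul, ← pow_succ] at h1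
      have h2 : (T k ^ (2 ^ j)) ^ 2 ≤ (n ^ (2 ^ j - 1) * T (k ^ (2 ^ j))) ^ 2 :=
        pow_le_pow_left₀ (by positivity) ih 2
      have e : 2 ^ (j + 1) - 1 = (2 ^ j - 1) * 2 + 1 := by
        have : 1 ≤ 2 ^ j := Nat.one_le_two_pow
        rw [pow_succ]; omega
      rw [e]
      calc T k ^ 2 ^ (j + 1) = (T k ^ (2 ^ j)) ^ 2 := by rw [← pow_mul, ← pow_succ]
        _ ≤ (n ^ (2 ^ j - 1) * T (k ^ (2 ^ j))) ^ 2 := h2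
        _ = n ^ ((2 ^ j - 1) * 2) * T (k ^ (2 ^ j)) ^ 2 := by rw [mul_pow, ← pow_mul]
        _ ≤ n ^ ((2 ^ j - 1) * 2) * (n * T (k ^ 2 ^ (j + 1))) := by gcongr
        _ = _ := by rw [pow_succ]; ring
  have hn1 : 0 < n := by
    by_contra! h
    have hn' : n = 0 := le_antisymm h hn0
    have := hstep 1
    rw [hn'] at this
    norm_num at this
    nlinarith
  have hq : 1 < T k / (k ^ 2 * n) := by
    rw [one_lt_div (by positivity)]; exact hcon
  have hsmall : ∀ᶠ j : ℕ in Filter.atTop, k ^ (2 ^ j) ≤ 1 / 16 := by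
    have := (tendsto_pow_atTop_nhds_zero_of_lt_one hk.le hk1).comp
      (tendsto_pow_atTop_atTop_of_one_lt (one_lt_two (α := ℕ)))
    filter_upwards [this.eventually (gt_mem_nhds (show (0 : ℝ) < 1 / 16 by norm_num))] with j hj
    exact le_of_lt hj
  have hbig : ∀ᶠ j : ℕ in Filter.atTop, 4000 < (T k / (k ^ 2 * n)) ^ (2 ^ j) := by
    have := (tendsto_pow_atTop_atTop_of_one_lt hq).comp
      (tendsto_pow_atTop_atTop_of_one_lt (one_lt_two (α := ℕ)))
    exact this.eventually_gt_atTop 4000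
  obtain ⟨j, h1, h2⟩ := (hsmall.and hbig).exists
  have h3 := integral_mehlerOp_mul_self_le_of_small ha (pow_nonneg hk.le (2 ^ j)) h1 hf ho
  have h4 := hstep j
  have h5 : n ^ (2 ^ j - 1) * n = n ^ (2 ^ j) := by
    rw [← pow_succ]; congr 1
    have : 1 ≤ 2 ^ j := Nat.one_le_two_pow
    omega
  have h6 : T k ^ (2 ^ j) ≤ 4000 * (k ^ 2 * n) ^ (2 ^ j) := by
    calc T k ^ (2 ^ j) ≤ n ^ (2 ^ j - 1) * T (k ^ (2 ^ j)) := h4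
      _ ≤ n ^ (2 ^ j - 1) * (4000 * (k ^ 2 ^ j) ^ 2 * n) := by gcongr
      _ = 4000 * (k ^ 2 ^ j) ^ 2 * (n ^ (2 ^ j - 1) * n) := by ring
      _ = _ := by rw [h5, mul_pow, ← pow_mul, ← pow_mul, mul_comm 2]; ring
  rw [div_pow, lt_div_iff₀ (by positivity)] at h2
  linarith

theorem integrable_fun_sub {α : Type*} [MeasurableSpace α] {μ : Measure α} {f g : α → ℝ}
    (hf : Integrable f μ) (hg : Integrable g μ) : Integrable (fun x => f x - g x) μ := hf.sub hg

section
variable {a k : ℝ}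

theorem mehlerOp_sub_const_mul (ha : 0 < a) (hk : 0 ≤ k) (hk1 : k < 1) {f e : ℝ × ℝ → ℝ}
    (hf : MemLp f 2) (he : MemLp e 2) (α : ℝ) (X : ℝ × ℝ) :
    mehlerOp a k (fun Z => f Z - α * e Z) X = mehlerOp a k f X - α * mehlerOp a k e X := by
  rw [mehlerOp, mehlerOp, mehlerOp, ← integral_const_mul,
    ← integral_sub (integrable_mehler_mul ha hk hk1 hf X)
      ((integrable_mehler_mul ha hk hk1 he X).const_mul _)]
  congr 1; ext Y; ring

/-- Subtracting the projection onto an eigenfunction splits both quadratic forms, because the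
operator is symmetric. The last clause says that pairings with functions orthogonal to `e` are
unaffected, so successive deflations do not interfere. -/
theorem mehlerOp_deflate (ha : 0 < a) (hk : 0 ≤ k) (hk1 : k < 1) {f e : ℝ × ℝ → ℝ} {l n : ℝ}
    (hf : MemLp f 2) (he : MemLp e 2) (hn : 0 < n) (hee : ∫ X, e X ^ 2 = n)
    (hS : ∀ X, mehlerOp a k e X = l * e X) :
    ∃ f' : ℝ × ℝ → ℝ, MemLp f' 2 ∧
      (∫ X, mehlerOp a k f X * f X = (∫ X, mehlerOp a k f' X * f' X) + l * ((∫ X, e X * f X) ^ 2 / n)) ∧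
      (∫ X, f X ^ 2 = (∫ X, f' X ^ 2) + (∫ X, e X * f X) ^ 2 / n) ∧
      ∫ X, e X * f' X = 0 ∧
      ∀ e' : ℝ × ℝ → ℝ, MemLp e' 2 → ∫ X, e X * e' X = 0 → ∫ X, e' X * f' X = ∫ X, e' X * f X := by
  set c := ∫ X, e X * f X with hc
  set α := c / n with hα
  have hef : Integrable fun X => e X * f X := he.integrable_mul hf
  have hees : Integrable fun X => e X ^ 2 := he.integrable_sq
  have hffs : Integrable fun X => f X ^ 2 := hf.integrable_sq
  have hαn : α * n = c := by rw [hα]; field_simp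
  have hsum : ∀ e' : ℝ × ℝ → ℝ, MemLp e' 2 →
      ∫ X, e' X * (f X - α * e X) = (∫ X, e' X * f X) - α * ∫ X, e X * e' X := by
    intro e' he'
    have h1 : Integrable fun X => e' X * f X := he'.integrable_mul hf
    have h2 : Integrable fun X => e X * e' X := he.integrable_mul he'
    rw [← integral_const_mul, ← integral_sub h1 (h2.const_mul _)]
    congr 1; ext X; ring
  refine ⟨fun X => f X - α * e X, hf.sub (he.const_mul α), ?_, ?_, ?_, ?_⟩
  · have hSf := memLp_mehlerOp ha hk hk1 hf
    have h1 : Integrable fun X => mehlerOp a k f X * f X := hSf.integrable_mul hf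
    have h2 : Integrable fun X => mehlerOp a k f X * e X := hSf.integrable_mul he
    have h3 : ∫ X, mehlerOp a k f X * e X = l * c := by
      rw [integral_mehlerOp_mul_comm ha hk hk1 hf he, hc, ← integral_const_mul]
      congr 1; ext X; rw [hS]; ring
    have e1 : ∀ X, mehlerOp a k (fun Z => f Z - α * e Z) X * (f X - α * e X) =
        mehlerOp a k f X * f X - α * (mehlerOp a k f X * e X) -
          (α * l) * (e X * f X) + (α ^ 2 * l) * e X ^ 2 := by
      intro X
      rw [mehlerOp_sub_const_mul ha hk hk1 hf he, hS]; ring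
    simp only [e1]
    rw [integral_add (integrable_fun_sub (integrable_fun_sub h1 (h2.const_mul _)) (hef.const_mul _)) (hees.const_mul _),
      integral_sub (integrable_fun_sub h1 (h2.const_mul _)) (hef.const_mul _), integral_sub h1 (h2.const_mul _),
      integral_const_mul, integral_const_mul, integral_const_mul, h3, hee, ← hc, hα]
    field_simp
    ring
  · have e1 : ∀ X, (f X - α * e X) ^ 2 = f X ^ 2 - (2 * α) * (e X * f X) + α ^ 2 * e X ^ 2 := by
      intro X; ring
    simp only [e1]
    rw [integral_add (integrable_fun_sub hffs (hef.const_mul _)) (hees.const_mul _),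
      integral_sub hffs (hef.const_mul _), integral_const_mul, integral_const_mul, hee, ← hc, hα]
    field_simp
    ring
  · rw [hsum e he]
    simp only [← sq]
    rw [hee, hαn, ← hc, sub_self]
  · intro e' he' h0
    rw [hsum e' he', h0, mul_zero, sub_zero]

/-- Deflate by the ground state (eigenvalue `1`, squared norm `2π/a`) and the two first-level states
(eigenvalue `k`, squared norm `2π/a²`), then use the gap `k²`. The coefficients `1 - k²` and `k -
k²` are the excesses of the low eigenvalues over the gap. -/
theorem integral_mehlerOp_mul_self_le (ha : 0 < a) (hk : 0 < k) (hk1 : k < 1) {f : ℝ × ℝ → ℝ}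
    (hf : MemLp f 2) : ∫ X, mehlerOp a k f X * f X ≤ k ^ 2 * (∫ X, f X ^ 2) +
      (1 - k ^ 2) * (a / (2 * Real.pi)) * (∫ X, gauss (a / 4) X * f X) ^ 2 +
      (k - k ^ 2) * (a ^ 2 / (2 * Real.pi)) * ((∫ X : ℝ × ℝ, X.1 * gauss (a / 4) X * f X) ^ 2 +
        (∫ X : ℝ × ℝ, X.2 * gauss (a / 4) X * f X) ^ 2) := by
  have hpi := Real.pi_pos
  have ha4 : 0 < a / 4 := by positivity
  have ha2 : 0 < 2 * (a / 4) := by positivity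
  have m0 := memLp_gauss ha4
  have m1 := memLp_fst_mul_gauss ha4
  have m2 := memLp_snd_mul_gauss ha4
  obtain ⟨f0, hf0, hS0, hn0, ho0, hk0⟩ := mehlerOp_deflate (l := 1) (n := 2 * Real.pi / a) ha hk.le hk1 hf m0
    (by positivity) (by simp only [gauss_sq]; rw [integral_gauss ha2]; field_simp; norm_num)
    (fun X => by rw [mehlerOp, integral_mehler_mul_gauss ha hk.le hk1, one_mul])
  obtain ⟨f1, hf1, hS1, hn1, ho1, hk1'⟩ := mehlerOp_deflate (l := k) (n := 2 * Real.pi / a ^ 2) ha hk.le hk1 hf0 m1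
    (by positivity) (by
      simp only [mul_pow, gauss_sq]; rw [integral_fst_sq_mul_gauss ha2]; field_simp; norm_num)
    (fun X => by rw [mehlerOp, integral_mehler_mul_fst_mul_gauss ha hk.le hk1])
  obtain ⟨f2, hf2, hS2, hn2, ho2, hk2⟩ := mehlerOp_deflate (l := k) (n := 2 * Real.pi / a ^ 2) ha hk.le hk1 hf1 m2
    (by positivity) (by
      simp only [mul_pow, gauss_sq]; rw [integral_snd_sq_mul_gauss ha2]; field_simp; norm_num)
    (fun X => by rw [mehlerOp, integral_mehler_mul_snd_mul_gauss ha hk.le hk1])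
  have z01 : ∫ X : ℝ × ℝ, gauss (a / 4) X * (X.1 * gauss (a / 4) X) = 0 := by
    simp only [mul_left_comm, gauss_mul_gauss]
    exact integral_fst_mul_gauss (by positivity)
  have z02 : ∫ X : ℝ × ℝ, gauss (a / 4) X * (X.2 * gauss (a / 4) X) = 0 := by
    simp only [mul_left_comm, gauss_mul_gauss]
    exact integral_snd_mul_gauss (by positivity)
  have z12 : ∫ X : ℝ × ℝ, X.1 * gauss (a / 4) X * (X.2 * gauss (a / 4) X) = 0 := by
    simp only [show ∀ u v w : ℝ, u * w * (v * w) = u * v * (w * w) by intros; ring, gauss_mul_gauss]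
    exact integral_fst_mul_snd_mul_gauss _
  have z10 : ∫ X : ℝ × ℝ, X.1 * gauss (a / 4) X * gauss (a / 4) X = 0 := by
    simpa only [mul_comm] using z01
  have z20 : ∫ X : ℝ × ℝ, X.2 * gauss (a / 4) X * gauss (a / 4) X = 0 := by
    simpa only [mul_comm] using z02
  have z21 : ∫ X : ℝ × ℝ, X.2 * gauss (a / 4) X * (X.1 * gauss (a / 4) X) = 0 := by
    simpa only [mul_comm] using z12
  have ho : OrthLow a f2 := by
    refine ⟨?_, ?_, ho2⟩
    · rw [hk2 _ m0 z20, hk1' _ m0 z10, ho0]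
    · rw [hk2 _ m1 z21, ho1]
  have c1 : ∫ X : ℝ × ℝ, X.1 * gauss (a / 4) X * f0 X = ∫ X : ℝ × ℝ, X.1 * gauss (a / 4) X * f X :=
    hk0 _ m1 z01
  have c2 : ∫ X : ℝ × ℝ, X.2 * gauss (a / 4) X * f1 X = ∫ X : ℝ × ℝ, X.2 * gauss (a / 4) X * f X := by
    rw [hk1' _ m2 z12, hk0 _ m2 z02]
  have hfin := integral_mehlerOp_mul_self_le_of_orthLow ha hk hk1 hf2 ho
  rw [c1] at hS1 hn1
  rw [c2] at hS2 hn2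
  rw [hS0, hS1, hS2, hn0, hn1, hn2]
  have d0 : ∀ t : ℝ, t / (2 * Real.pi / a) = a / (2 * Real.pi) * t := by intro t; field_simp
  have d1 : ∀ t : ℝ, t / (2 * Real.pi / a ^ 2) = a ^ 2 / (2 * Real.pi) * t := by intro t; field_simp
  simp only [d0, d1]
  nlinarith

end

/-! ### Heat kernels as conjugated Mehler kernels. -/

/-- The heat kernel at time `(1 - r) / r`. -/
noncomputable def heatKernel (r : ℝ) (X Y : ℝ × ℝ) : ℝ :=
  r / (4 * Real.pi * (1 - r)) * Real.exp (-(r / (4 * (1 - r))) * sqDist X Y)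

/-- With `k = r`, matching the cross terms `X·Y` forces `a = (1+r)/2`. The leftover Gaussian
`exp((1-r)ρ²/8)` on each side squares to the weight `exp((1-r)ρ²/4)`, whose integral over `r` is
`A`. -/
theorem heatKernel_eq_mehler {r : ℝ} (hr : 0 < r) (hr1 : r < 1) (X Y : ℝ × ℝ) :
    heatKernel r X Y = r * (mehler ((1 + r) / 2) r X Y *
      (gauss (-((1 - r) / 8)) X * gauss (-((1 - r) / 8)) Y)) := by
  have hpi := Real.pi_pos
  have h1 : 0 < 1 - r := by linarith
  have h2 : 1 - r ^ 2 = (1 - r) * (1 + r) := by ring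
  rw [heatKernel, mehler, gauss, gauss, sqDist, h2, mul_assoc ((1 + r) / 2 / _), ← Real.exp_add, ← Real.exp_add,
    ← mul_assoc]
  congr 1
  · field_simp
    norm_num
  · congr 1
    field_simp
    ring

theorem integral_heatKernel_le {r : ℝ} (hr : 0 < r) (hr1 : r < 1) {η : ℝ × ℝ → ℝ}
    (hη : MemLp (fun X => gauss (-((1 - r) / 8)) X * η X) 2) :
    ∫ p : (ℝ × ℝ) × (ℝ × ℝ), heatKernel r p.1 p.2 * (η p.1 * η p.2) ∂(volume.prod volume) ≤
      r * (r ^ 2 * (∫ X, gauss (-((1 - r) / 4)) X * η X ^ 2) +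
      (1 - r ^ 2) * ((1 + r) / (4 * Real.pi)) * (∫ X, gauss (r / 4) X * η X) ^ 2 +
      (r - r ^ 2) * ((1 + r) ^ 2 / (8 * Real.pi)) * ((∫ X : ℝ × ℝ, X.1 * gauss (r / 4) X * η X) ^ 2 +
        (∫ X : ℝ × ℝ, X.2 * gauss (r / 4) X * η X) ^ 2)) := by
  have ha : 0 < (1 + r) / 2 := by positivity
  set f : ℝ × ℝ → ℝ := fun X => gauss (-((1 - r) / 8)) X * η X with hf
  have h := integral_mehlerOp_mul_self_le ha hr hr1 hη
  have hg : ∀ X, gauss ((1 + r) / 2 / 4) X * gauss (-((1 - r) / 8)) X = gauss (r / 4) X := by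
    intro X; rw [gauss_mul_gauss]; congr 1; ring
  have e0 : ∫ X, gauss ((1 + r) / 2 / 4) X * f X = ∫ X, gauss (r / 4) X * η X := by
    simp only [hf, ← mul_assoc, hg]
  have e1 : ∫ X : ℝ × ℝ, X.1 * gauss ((1 + r) / 2 / 4) X * f X = ∫ X : ℝ × ℝ, X.1 * gauss (r / 4) X * η X := by
    congr 1; ext X; rw [← hg]; ring
  have e2 : ∫ X : ℝ × ℝ, X.2 * gauss ((1 + r) / 2 / 4) X * f X = ∫ X : ℝ × ℝ, X.2 * gauss (r / 4) X * η X := by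
    congr 1; ext X; rw [← hg]; ring
  have e3 : ∫ X, f X ^ 2 = ∫ X, gauss (-((1 - r) / 4)) X * η X ^ 2 := by
    congr 1; ext X; rw [hf]; simp only [mul_pow, gauss_sq]; congr 2; ring
  have e4 : ∫ p : (ℝ × ℝ) × (ℝ × ℝ), heatKernel r p.1 p.2 * (η p.1 * η p.2) ∂(volume.prod volume) =
      r * ∫ X, mehlerOp ((1 + r) / 2) r f X * f X := by
    calc _ = ∫ p : (ℝ × ℝ) × (ℝ × ℝ), r * (mehler ((1 + r) / 2) r p.1 p.2 * (f p.1 * f p.2))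
          ∂(volume.prod volume) := by
          congr 1; ext p; rw [heatKernel_eq_mehler hr hr1, hf]; ring
      _ = r * ∫ X, ∫ Y, mehler ((1 + r) / 2) r X Y * (f X * f Y) := by
          rw [integral_const_mul, integral_prod _ (integrable_mehler_mul_prod ha hr.le hr1 hη hη)]
      _ = _ := by
          congr 2; ext X
          rw [mehlerOp, ← integral_mul_const]
          congr 1; ext Y; ring
  rw [e4]
  rw [e0, e1, e2, e3] at h
  refine mul_le_mul_of_nonneg_left (h.trans (le_of_eq ?_)) hr.le
  have hpi := Real.pi_pos
  field_simp
  ring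

/-! ### Functions with bounded support, for which growing Gaussian weights are integrable, and their
parity decomposition. -/

/-- Square-integrable functions on the plane with bounded support. -/
structure BddSuppL2 (η : ℝ × ℝ → ℝ) : Prop where
  memLp : MemLp η 2
  supp : ∃ R : ℝ, ∀ X : ℝ × ℝ, R < ‖X‖ → η X = 0

namespace BddSuppL2
variable {η : ℝ × ℝ → ℝ}

theorem mul (h : BddSuppL2 η) {φ : ℝ × ℝ → ℝ} (hφ : Continuous φ) : BddSuppL2 fun X => φ X * η X := by
  obtain ⟨R, hR⟩ := h.supp
  refine ⟨?_, R, fun X hX => by rw [hR X hX, mul_zero]⟩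
  obtain ⟨C, hC⟩ := (isCompact_closedBall (0 : ℝ × ℝ) R).exists_bound_of_continuousOn hφ.continuousOn
  refine (h.memLp.norm.const_mul C).mono' (hφ.aestronglyMeasurable.mul h.memLp.1)
    (Filter.Eventually.of_forall fun X => ?_)
  by_cases hX : R < ‖X‖
  · simp [hR X hX]
  · rw [norm_mul]
    exact mul_le_mul_of_nonneg_right (hC X (by simpa using hX)) (norm_nonneg _)

theorem integrable (h : BddSuppL2 η) : Integrable η := by
  obtain ⟨R, hR⟩ := h.supp
  have h1 : MemLp ((Metric.closedBall (0 : ℝ × ℝ) R).indicator fun _ => (1 : ℝ)) 2 :=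
    memLp_indicator_const 2 measurableSet_closedBall 1
      (Or.inr (isCompact_closedBall (0 : ℝ × ℝ) R).measure_lt_top.ne)
  refine (h1.integrable_mul h.memLp).congr (Filter.Eventually.of_forall fun X => ?_)
  by_cases hX : R < ‖X‖
  · simp [hR X hX]
  · have : X ∈ Metric.closedBall (0 : ℝ × ℝ) R := by simpa using hX
    simp [Set.indicator_of_mem this]

theorem integrable_mul (h : BddSuppL2 η) {φ : ℝ × ℝ → ℝ} (hφ : Continuous φ) :
    Integrable fun X => φ X * η X := (h.mul hφ).integrable

theorem integrable_mul_sq (h : BddSuppL2 η) {φ : ℝ × ℝ → ℝ} (hφ : Continuous φ) :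
    Integrable fun X => φ X * η X ^ 2 := by
  refine ((h.mul hφ).memLp.integrable_mul h.memLp).congr (Filter.Eventually.of_forall fun X => ?_)
  simp only [Pi.mul_apply]; ring

theorem comp_neg (h : BddSuppL2 η) : BddSuppL2 fun X => η (-X) := by
  obtain ⟨R, hR⟩ := h.supp
  refine ⟨h.memLp.comp_measurePreserving (Measure.measurePreserving_neg volume), R, fun X hX => ?_⟩
  exact hR _ (by rwa [norm_neg])

theorem half_add (h : BddSuppL2 η) : BddSuppL2 fun X => (η X + η (-X)) / 2 := by
  obtain ⟨R, hR⟩ := h.supp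
  refine ⟨?_, R, fun X hX => by rw [hR X hX, hR (-X) (by rwa [norm_neg])]; simp⟩
  have := (h.memLp.add h.comp_neg.memLp).const_mul (2⁻¹)
  refine this.ae_eq (Filter.Eventually.of_forall fun X => ?_)
  simp only [Pi.add_apply]; ring

theorem half_sub (h : BddSuppL2 η) : BddSuppL2 fun X => (η X - η (-X)) / 2 := by
  obtain ⟨R, hR⟩ := h.supp
  refine ⟨?_, R, fun X hX => by rw [hR X hX, hR (-X) (by rwa [norm_neg])]; simp⟩
  have := (h.memLp.sub h.comp_neg.memLp).const_mul (2⁻¹)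
  refine this.ae_eq (Filter.Eventually.of_forall fun X => ?_)
  simp only [Pi.sub_apply]; ring

end BddSuppL2

/-- The even part of a function. -/
noncomputable def evenPart (η : ℝ × ℝ → ℝ) (X : ℝ × ℝ) : ℝ := (η X + η (-X)) / 2

/-- The odd part of a function. -/
noncomputable def oddPart (η : ℝ × ℝ → ℝ) (X : ℝ × ℝ) : ℝ := (η X - η (-X)) / 2

section parity
variable {η φ : ℝ × ℝ → ℝ}

theorem integral_mul_evenPart (h : BddSuppL2 η) (hφ : Continuous φ) (he : ∀ X, φ (-X) = φ X) :
    ∫ X, φ X * evenPart η X = ∫ X, φ X * η X := by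
  have h1 : ∫ X, φ X * η (-X) = ∫ X, φ X * η X := by
    rw [← integral_neg_eq_self]
    simp only [he, neg_neg]
  have e : ∀ X, φ X * evenPart η X = 1 / 2 * (φ X * η X + φ X * η (-X)) := by
    intro X; rw [evenPart]; ring
  simp only [e]
  rw [integral_const_mul, integral_add (h.integrable_mul hφ) (h.comp_neg.integrable_mul hφ), h1]
  ring

theorem integral_mul_oddPart (h : BddSuppL2 η) (hφ : Continuous φ) (ho : ∀ X, φ (-X) = -φ X) :
    ∫ X, φ X * oddPart η X = ∫ X, φ X * η X := by
  have h1 : ∫ X, φ X * η (-X) = -∫ X, φ X * η X := by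
    rw [← integral_neg_eq_self, ← integral_neg]
    simp only [ho, neg_neg, neg_mul]
  have e : ∀ X, φ X * oddPart η X = 1 / 2 * (φ X * η X - φ X * η (-X)) := by
    intro X; rw [oddPart]; ring
  simp only [e]
  rw [integral_const_mul, integral_sub (h.integrable_mul hφ) (h.comp_neg.integrable_mul hφ), h1]
  ring

theorem integral_mul_sq_parity (h : BddSuppL2 η) (hφ : Continuous φ) (he : ∀ X, φ (-X) = φ X) :
    ∫ X, φ X * η X ^ 2 = (∫ X, φ X * evenPart η X ^ 2) + ∫ X, φ X * oddPart η X ^ 2 := by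
  have h1 : ∫ X, φ X * η (-X) ^ 2 = ∫ X, φ X * η X ^ 2 := by
    rw [← integral_neg_eq_self]
    simp only [he, neg_neg]
  have i1 : Integrable fun X => φ X * evenPart η X ^ 2 := h.half_add.integrable_mul_sq hφ
  have i2 : Integrable fun X => φ X * oddPart η X ^ 2 := h.half_sub.integrable_mul_sq hφ
  rw [← integral_add i1 i2]
  have e : ∀ X, φ X * evenPart η X ^ 2 + φ X * oddPart η X ^ 2 =
      1 / 2 * (φ X * η X ^ 2 + φ X * η (-X) ^ 2) := by
    intro X; rw [evenPart, oddPart]; ring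
  simp only [e]
  rw [integral_const_mul, integral_add (h.integrable_mul_sq hφ) (h.comp_neg.integrable_mul_sq hφ), h1]
  ring

end parity

theorem gauss_neg_arg (β : ℝ) (X : ℝ × ℝ) : gauss β (-X) = gauss β X := by simp [gauss]

theorem gauss_zero (X : ℝ × ℝ) : gauss 0 X = 1 := by simp [gauss]

/-! ### Gaussian-damped moments compared with true moments. -/

/-- The factor `(2/3)/(r + 2/3)` is the coefficient of the projection of `exp(-rρ²/4)` onto
constants in `L²(exp(-ρ²/6))`. The constant on the right is the squared norm of the residual; its
factor `r²` offsets the `1/r` multiplying the mass term later. -/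
theorem sq_laplace_sub_mass_le {η : ℝ × ℝ → ℝ} (h : BddSuppL2 η) {r : ℝ} (hr : 0 < r) :
    ((∫ X, gauss (r / 4) X * η X) - (2 / 3) / (r + 2 / 3) * ∫ X, η X) ^ 2 ≤
      4 * Real.pi * r ^ 2 / ((2 * r + 2 / 3) * (r + 2 / 3) ^ 2) * ∫ X, gauss (-(1 / 6)) X * η X ^ 2 := by
  set c := (2 / 3) / (r + 2 / 3) with hc
  have hpi := Real.pi_pos
  set u : ℝ × ℝ → ℝ := fun X => (gauss (r / 4) X - c) * gauss (1 / 12) X with hu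
  have hu' : ∀ X, u X = gauss (r / 4 + 1 / 12) X - c * gauss (1 / 12) X := by
    intro X; rw [hu]; simp only [sub_mul, gauss_mul_gauss]
  have mu : MemLp u 2 := by
    have := (memLp_gauss (β := r / 4 + 1 / 12) (by positivity)).sub
      ((memLp_gauss (β := 1 / 12) (by norm_num)).const_mul c)
    exact this.ae_eq (Filter.Eventually.of_forall fun X => (hu' X).symm)
  have hf := h.mul (continuous_gauss (-(1 / 12)))
  have key := sq_integral_mul_le mu hf.memLp
  have e1 : ∫ X, u X * (gauss (-(1 / 12)) X * η X) = (∫ X, gauss (r / 4) X * η X) - c * ∫ X, η X := by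
    rw [← integral_const_mul, ← integral_sub (h.integrable_mul (by fun_prop)) (h.integrable.const_mul _)]
    congr 1; ext X
    have : gauss (1 / 12) X * gauss (-(1 / 12)) X = 1 := by
      rw [gauss_mul_gauss, add_neg_cancel, gauss_zero]
    rw [hu]
    linear_combination ((gauss (r / 4) X - c) * η X) * this
  have e2 : ∫ X, (gauss (-(1 / 12)) X * η X) ^ 2 = ∫ X, gauss (-(1 / 6)) X * η X ^ 2 := by
    congr 1; ext X; rw [mul_pow, gauss_sq]; congr 2; norm_num
  have e3 : ∫ X, u X ^ 2 = 4 * Real.pi * r ^ 2 / ((2 * r + 2 / 3) * (r + 2 / 3) ^ 2) := by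
    have e4 : ∀ X, u X ^ 2 = gauss (r / 2 + 1 / 6) X - (2 * c) * gauss (r / 4 + 1 / 6) X +
        c ^ 2 * gauss (1 / 6) X := by
      intro X
      have s1 : gauss (r / 2 + 1 / 6) X = gauss (r / 4 + 1 / 12) X ^ 2 := by
        rw [gauss_sq]; congr 1; ring
      have s2 : gauss (r / 4 + 1 / 6) X = gauss (r / 4 + 1 / 12) X * gauss (1 / 12) X := by
        rw [gauss_mul_gauss]; congr 1; ring
      have s3 : gauss (1 / 6) X = gauss (1 / 12) X ^ 2 := by
        rw [gauss_sq]; congr 1; norm_num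
      rw [hu', s1, s2, s3]; ring
    have i1 := integrable_gauss (β := r / 2 + 1 / 6) (by positivity)
    have i2 := integrable_gauss (β := r / 4 + 1 / 6) (by positivity)
    have i3 := integrable_gauss (β := 1 / 6) (by positivity)
    simp only [e4]
    rw [integral_add (integrable_fun_sub i1 (i2.const_mul _)) (i3.const_mul _), integral_sub i1 (i2.const_mul _),
      integral_const_mul, integral_const_mul, integral_gauss (by positivity),
      integral_gauss (by positivity), integral_gauss (by positivity), hc]
    field_simp
    ring
  rw [e1, e2, e3] at key
  exact key

/-- Bessel's inequality for two orthogonal functions of equal norm, by Cauchy-Schwarz against the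
combination `s u + t v` of the two coefficients. It bounds both components of the first moment at
the cost of one. -/
theorem sq_add_sq_integral_mul_le {α : Type*} [MeasurableSpace α] {μ : Measure α} {f u v : α → ℝ}
    (hf : MemLp f 2 μ) (hu : MemLp u 2 μ) (hv : MemLp v 2 μ) {V : ℝ}
    (huu : ∫ x, u x ^ 2 ∂μ = V) (hvv : ∫ x, v x ^ 2 ∂μ = V) (huv : ∫ x, u x * v x ∂μ = 0) :
    (∫ x, u x * f x ∂μ) ^ 2 + (∫ x, v x * f x ∂μ) ^ 2 ≤ V * ∫ x, f x ^ 2 ∂μ := by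
  set s := ∫ x, u x * f x ∂μ with hs
  set t := ∫ x, v x * f x ∂μ with ht
  have hw : MemLp (fun x => s * u x + t * v x) 2 μ := (hu.const_mul s).add (hv.const_mul t)
  have key := sq_integral_mul_le hw hf
  have iuf : Integrable (fun x => u x * f x) μ := hu.integrable_mul hf
  have ivf : Integrable (fun x => v x * f x) μ := hv.integrable_mul hf
  have iuv : Integrable (fun x => u x * v x) μ := hu.integrable_mul hv
  have e1 : ∫ x, (s * u x + t * v x) * f x ∂μ = s ^ 2 + t ^ 2 := by
    simp only [add_mul, mul_assoc]
    rw [integral_add (iuf.const_mul _) (ivf.const_mul _), integral_const_mul, integral_const_mul]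
    rw [← hs, ← ht]; ring
  have e2 : ∫ x, (s * u x + t * v x) ^ 2 ∂μ = (s ^ 2 + t ^ 2) * V := by
    have e3 : ∀ x, (s * u x + t * v x) ^ 2 = s ^ 2 * u x ^ 2 + t ^ 2 * v x ^ 2 + (2 * s * t) * (u x * v x) := by
      intro x; ring
    simp only [e3]
    rw [integral_add ((hu.integrable_sq.const_mul _).fun_add (hv.integrable_sq.const_mul _)) (iuv.const_mul _),
      integral_add (hu.integrable_sq.const_mul _) (hv.integrable_sq.const_mul _), integral_const_mul,
      integral_const_mul, integral_const_mul, huu, hvv, huv]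
    ring
  rw [e1, e2] at key
  have h0 : 0 ≤ s ^ 2 + t ^ 2 := by positivity
  rcases h0.eq_or_lt with h | h
  · rw [← h]
    apply mul_nonneg
    · rw [← huu]; exact integral_nonneg fun x => sq_nonneg _
    · exact integral_nonneg fun x => sq_nonneg _
  · nlinarith

/-- The factor `(1-r)²` projects `X_i exp(-rρ²/4)` onto `X_i` in `L²(exp(-(1-r)ρ²/4))`. The right
side carries the squared norm of the residual. -/
theorem sq_laplace_sub_moment_le {η : ℝ × ℝ → ℝ} (h : BddSuppL2 η) {r : ℝ} (hr : 0 < r) (hr1 : r < 1) :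
    ((∫ X : ℝ × ℝ, X.1 * gauss (r / 4) X * η X) - (1 - r) ^ 2 * ∫ X : ℝ × ℝ, X.1 * η X) ^ 2 +
    ((∫ X : ℝ × ℝ, X.2 * gauss (r / 4) X * η X) - (1 - r) ^ 2 * ∫ X : ℝ × ℝ, X.2 * η X) ^ 2 ≤
      8 * Real.pi * (1 / (1 + r) ^ 2 - (1 - r) ^ 2) * ∫ X, gauss (-((1 - r) / 4)) X * η X ^ 2 := by
  have h1r : 0 < 1 - r := by linarith
  set c := (1 - r) ^ 2 with hc
  have hpi := Real.pi_pos
  set w : ℝ × ℝ → ℝ := fun X => (gauss (r / 4) X - c) * gauss ((1 - r) / 8) X with hw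
  have hw' : ∀ X, w X = gauss (r / 4 + (1 - r) / 8) X - c * gauss ((1 - r) / 8) X := by
    intro X; rw [hw]; simp only [sub_mul, gauss_mul_gauss]
  have hw2 : ∀ X, w X ^ 2 = gauss ((1 + r) / 4) X - (2 * c) * gauss (1 / 4) X +
      c ^ 2 * gauss ((1 - r) / 4) X := by
    intro X
    have s1 : gauss ((1 + r) / 4) X = gauss (r / 4 + (1 - r) / 8) X ^ 2 := by
      rw [gauss_sq]; congr 1; ring
    have s2 : gauss (1 / 4) X = gauss (r / 4 + (1 - r) / 8) X * gauss ((1 - r) / 8) X := by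
      rw [gauss_mul_gauss]; congr 1; ring
    have s3 : gauss ((1 - r) / 4) X = gauss ((1 - r) / 8) X ^ 2 := by
      rw [gauss_sq]; congr 1; ring
    rw [hw', s1, s2, s3]; ring
  have hb : 0 < r / 4 + (1 - r) / 8 := by positivity
  have hb' : 0 < (1 - r) / 8 := by positivity
  have mu : MemLp (fun X : ℝ × ℝ => X.1 * w X) 2 := by
    have := (memLp_fst_mul_gauss hb).sub ((memLp_fst_mul_gauss hb').const_mul c)
    exact this.ae_eq (Filter.Eventually.of_forall fun X => by
      simp only [hw', Pi.sub_apply]; ring)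
  have mv : MemLp (fun X : ℝ × ℝ => X.2 * w X) 2 := by
    have := (memLp_snd_mul_gauss hb).sub ((memLp_snd_mul_gauss hb').const_mul c)
    exact this.ae_eq (Filter.Eventually.of_forall fun X => by
      simp only [hw', Pi.sub_apply]; ring)
  have hf := h.mul (continuous_gauss (-((1 - r) / 8)))
  have hq : ∀ (q : ℝ × ℝ → ℝ), Continuous q → (∀ Z, |q Z| ≤ Z.1 ^ 2 + Z.2 ^ 2) →
      ∫ X, q X * w X ^ 2 = (∫ X, q X * gauss ((1 + r) / 4) X) - (2 * c) * (∫ X, q X * gauss (1 / 4) X) +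
      c ^ 2 * ∫ X, q X * gauss ((1 - r) / 4) X := by
    intro q hqc hqb
    have i1 := integrable_quadratic_mul_gauss (β := (1 + r) / 4) (by positivity) hqc hqb
    have i2 := integrable_quadratic_mul_gauss (β := 1 / 4) (by positivity) hqc hqb
    have i3 := integrable_quadratic_mul_gauss (β := (1 - r) / 4) (by positivity) hqc hqb
    simp only [hw2, mul_add, mul_sub, mul_left_comm (q _)]
    rw [integral_add (integrable_fun_sub i1 (i2.const_mul _)) (i3.const_mul _), integral_sub i1 (i2.const_mul _),
      integral_const_mul, integral_const_mul]
  have hV : Real.pi / (2 * ((1 + r) / 4) ^ 2) - (2 * c) * (Real.pi / (2 * (1 / 4) ^ 2)) +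
      c ^ 2 * (Real.pi / (2 * ((1 - r) / 4) ^ 2)) = 8 * Real.pi * (1 / (1 + r) ^ 2 - (1 - r) ^ 2) := by
    rw [hc]; field_simp; ring
  have key := sq_add_sq_integral_mul_le hf.memLp mu mv
    (V := 8 * Real.pi * (1 / (1 + r) ^ 2 - (1 - r) ^ 2)) (by
      simp only [mul_pow]
      rw [hq _ (by fun_prop) (fun Z => by rw [abs_of_nonneg (sq_nonneg _)]; nlinarith [sq_nonneg Z.2]),
        integral_fst_sq_mul_gauss (by positivity), integral_fst_sq_mul_gauss (by positivity),
        integral_fst_sq_mul_gauss (by positivity), hV]) (by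
      simp only [mul_pow]
      rw [hq _ (by fun_prop) (fun Z => by rw [abs_of_nonneg (sq_nonneg _)]; nlinarith [sq_nonneg Z.1]),
        integral_snd_sq_mul_gauss (by positivity), integral_snd_sq_mul_gauss (by positivity),
        integral_snd_sq_mul_gauss (by positivity), hV]) (by
      simp only [show ∀ u v w : ℝ, u * w * (v * w) = u * v * w ^ 2 by intros; ring]
      rw [hq _ (by fun_prop) (fun Z => by
        rw [abs_le]; constructor <;> nlinarith [sq_nonneg (Z.1 + Z.2), sq_nonneg (Z.1 - Z.2)]),
        integral_fst_mul_snd_mul_gauss, integral_fst_mul_snd_mul_gauss, integral_fst_mul_snd_mul_gauss]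
      ring)
  have hcancel : ∀ X, gauss ((1 - r) / 8) X * gauss (-((1 - r) / 8)) X = 1 := by
    intro X; rw [gauss_mul_gauss, add_neg_cancel, gauss_zero]
  have e1 : ∫ X : ℝ × ℝ, X.1 * w X * (gauss (-((1 - r) / 8)) X * η X) =
      (∫ X : ℝ × ℝ, X.1 * gauss (r / 4) X * η X) - c * ∫ X : ℝ × ℝ, X.1 * η X := by
    rw [← integral_const_mul, ← integral_sub (h.integrable_mul (by fun_prop))
      ((h.integrable_mul (by fun_prop)).const_mul _)]
    congr 1; ext X
    rw [hw]
    linear_combination (X.1 * (gauss (r / 4) X - c) * η X) * hcancel X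
  have e2 : ∫ X : ℝ × ℝ, X.2 * w X * (gauss (-((1 - r) / 8)) X * η X) =
      (∫ X : ℝ × ℝ, X.2 * gauss (r / 4) X * η X) - c * ∫ X : ℝ × ℝ, X.2 * η X := by
    rw [← integral_const_mul, ← integral_sub (h.integrable_mul (by fun_prop))
      ((h.integrable_mul (by fun_prop)).const_mul _)]
    congr 1; ext X
    rw [hw]
    linear_combination (X.2 * (gauss (r / 4) X - c) * η X) * hcancel X
  have e3 : ∫ X, (gauss (-((1 - r) / 8)) X * η X) ^ 2 = ∫ X, gauss (-((1 - r) / 4)) X * η X ^ 2 := by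
    congr 1; ext X; rw [mul_pow, gauss_sq]; congr 2; ring
  rw [e1, e2, e3] at key
  exact key

/-! ### The logarithmic kernel as a superposition of heat kernels -/

theorem integrableOn_frullani_exp {d b : ℝ} (hd : 0 < d) (hb : 0 < b) :
    IntegrableOn (fun u : ℝ => u⁻¹ * (Real.exp (-(d * u)) - Real.exp (-((d + b) * u)))) (Set.Ioi 0) := by
  have h1 := (integrableOn_exp_mul_Ioi (neg_lt_zero.2 hd) 0).const_mul b
  refine h1.mono' (Measurable.aestronglyMeasurable (by fun_prop)) ?_
  rw [ae_restrict_iff' measurableSet_Ioi]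
  refine Filter.Eventually.of_forall fun u hu => ?_
  have hu : 0 < u := hu
  have e : Real.exp (-((d + b) * u)) = Real.exp (-d * u) * Real.exp (-(b * u)) := by
    rw [← Real.exp_add]; congr 1; ring
  have h2 := Real.add_one_le_exp (-(b * u))
  have h3 : Real.exp (-(b * u)) ≤ 1 := Real.exp_le_one_iff.2 (by nlinarith [mul_pos hb hu])
  have h4 := Real.exp_pos (-d * u)
  rw [e, ← neg_mul d u, Real.norm_of_nonneg (mul_nonneg (by positivity) (by nlinarith)), inv_mul_le_iff₀ hu]
  nlinarith

/-- Frullani's integral; the substitution `u = r/(4(1-r)) = 1/(4t)` then turns it into a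
superposition of heat kernels. -/
theorem integral_frullani_exp {d b : ℝ} (hd : 0 < d) (hb : 0 < b) :
    ∫ u in Set.Ioi (0 : ℝ), u⁻¹ * (Real.exp (-(d * u)) - Real.exp (-((d + b) * u))) =
      Real.log (1 + b / d) := by
  have hc : Continuous fun x : ℝ => Real.exp (-x) := by fun_prop
  have h := Frullani.integral_Ioi_eq (f := fun x : ℝ => Real.exp (-x)) (a := d) (b := d + b) (L := 1) (R := 0)
    (hc.locallyIntegrable.locallyIntegrableOn _) hd (by positivity) (by
      have := hc.tendsto 0
      simp only [neg_zero, Real.exp_zero] at this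
      exact this.mono_left nhdsWithin_le_nhds)
    (Real.tendsto_exp_neg_atTop_nhds_zero) (by
      simpa only [smul_eq_mul] using integrableOn_frullani_exp hd hb)
  simp only [smul_eq_mul, sub_zero, mul_one] at h
  rw [h]
  congr 1
  field_simp

theorem hasDerivAt_div_one_sub {r : ℝ} (hr1 : r < 1) :
    HasDerivAt (fun r : ℝ => r / (4 * (1 - r))) (1 / (4 * (1 - r) ^ 2)) r := by
  have h1 : 0 < 1 - r := by linarith
  have h := (hasDerivAt_id' r).div (((hasDerivAt_id' r).const_sub 1).const_mul 4) (by positivity)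
  refine h.congr_deriv ?_
  field_simp
  ring

theorem injOn_div_one_sub : Set.InjOn (fun r : ℝ => r / (4 * (1 - r))) (Set.Ioo 0 1) := by
  intro r hr s hs h
  have h1 : 0 < 1 - r := by linarith [hr.2]
  have h2 : 0 < 1 - s := by linarith [hs.2]
  simp only at h
  rw [div_eq_div_iff (by positivity) (by positivity)] at h
  linarith

theorem image_div_one_sub : (fun r : ℝ => r / (4 * (1 - r))) '' Set.Ioo 0 1 = Set.Ioi 0 := by
  ext u
  constructor
  · rintro ⟨r, hr, rfl⟩
    have h1 : 0 < 1 - r := by linarith [hr.2]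
    have h2 := hr.1
    exact div_pos h2 (by positivity)
  · intro hu
    have hu : 0 < u := hu
    refine ⟨4 * u / (1 + 4 * u), ⟨by positivity, (div_lt_one (by positivity)).2 (by linarith)⟩, ?_⟩
    have : 1 - 4 * u / (1 + 4 * u) = 1 / (1 + 4 * u) := by field_simp; ring
    simp only [this]
    field_simp

/-- The heat kernel at time `t = (1 - r) / r`, weighted by `(1 - exp (-b / 4t)) |dt/dr|`. -/
noncomputable def mixKernel (b r : ℝ) (X Y : ℝ × ℝ) : ℝ :=
  (1 - Real.exp (-(b * (r / (4 * (1 - r)))))) / r ^ 2 * heatKernel r X Y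

theorem mixKernel_eq {b r : ℝ} (hr : 0 < r) (hr1 : r < 1) (X Y : ℝ × ℝ) :
    mixKernel b r X Y = |1 / (4 * (1 - r) ^ 2)| • (1 / (4 * Real.pi) * ((r / (4 * (1 - r)))⁻¹ *
      (Real.exp (-(sqDist X Y * (r / (4 * (1 - r))))) -
        Real.exp (-((sqDist X Y + b) * (r / (4 * (1 - r)))))))) := by
  have h1 : 0 < 1 - r := by linarith
  have hpi := Real.pi_pos
  rw [mixKernel, heatKernel, abs_of_pos (by positivity), smul_eq_mul, add_mul, neg_add, Real.exp_add,
    neg_mul, mul_comm (r / (4 * (1 - r))) (sqDist X Y)]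
  field_simp

theorem mixKernel_nonneg {b r : ℝ} (hb : 0 ≤ b) (hr : 0 < r) (hr1 : r < 1) (X Y : ℝ × ℝ) :
    0 ≤ mixKernel b r X Y := by
  have h1 : 0 < 1 - r := by linarith
  have hpi := Real.pi_pos
  have h2 : Real.exp (-(b * (r / (4 * (1 - r))))) ≤ 1 :=
    Real.exp_le_one_iff.2 (neg_nonpos.2 (by positivity))
  rw [mixKernel, heatKernel]
  have : 0 ≤ 1 - Real.exp (-(b * (r / (4 * (1 - r))))) := by linarith
  positivity

theorem integrableOn_mixKernel {b : ℝ} (hb : 0 < b) {X Y : ℝ × ℝ} (hXY : X ≠ Y) :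
    IntegrableOn (fun r => mixKernel b r X Y) (Set.Ioo 0 1) := by
  have h := (integrableOn_image_iff_integrableOn_abs_deriv_smul (s := Set.Ioo (0 : ℝ) 1)
    (f := fun r : ℝ => r / (4 * (1 - r))) (f' := fun r => 1 / (4 * (1 - r) ^ 2)) measurableSet_Ioo
    (fun x hx => (hasDerivAt_div_one_sub hx.2).hasDerivWithinAt) injOn_div_one_sub
    (fun u => 1 / (4 * Real.pi) * (u⁻¹ *
      (Real.exp (-(sqDist X Y * u)) - Real.exp (-((sqDist X Y + b) * u)))))).1 (by
      rw [image_div_one_sub]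
      exact (integrableOn_frullani_exp (sqDist_pos hXY) hb).const_mul _)
  exact h.congr_fun (fun r hr => (mixKernel_eq hr.1 hr.2 X Y).symm) measurableSet_Ioo

theorem integral_mixKernel {b : ℝ} (hb : 0 < b) {X Y : ℝ × ℝ} (hXY : X ≠ Y) :
    ∫ r in Set.Ioo (0 : ℝ) 1, mixKernel b r X Y = logKernel b X Y := by
  have h := integral_image_eq_integral_abs_deriv_smul (s := Set.Ioo (0 : ℝ) 1)
    (f := fun r : ℝ => r / (4 * (1 - r))) (f' := fun r => 1 / (4 * (1 - r) ^ 2)) measurableSet_Ioo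
    (fun x hx => (hasDerivAt_div_one_sub hx.2).hasDerivWithinAt) injOn_div_one_sub
    (fun u => 1 / (4 * Real.pi) * (u⁻¹ *
      (Real.exp (-(sqDist X Y * u)) - Real.exp (-((sqDist X Y + b) * u)))))
  rw [image_div_one_sub, integral_const_mul, integral_frullani_exp (sqDist_pos hXY) hb] at h
  rw [logKernel, h]
  exact setIntegral_congr_fun measurableSet_Ioo fun r hr => mixKernel_eq hr.1 hr.2 X Y

theorem ae_prod_ne : ∀ᵐ p : (ℝ × ℝ) × (ℝ × ℝ) ∂(volume.prod volume), p.1 ≠ p.2 := by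
  have hm : MeasurableSet {p : (ℝ × ℝ) × (ℝ × ℝ) | p.1 ≠ p.2} :=
    (measurableSet_eq_fun measurable_fst measurable_snd).compl
  have := (Measure.ae_prod_mem_iff_ae_ae_mem (μ := (volume : Measure (ℝ × ℝ)))
    (ν := (volume : Measure (ℝ × ℝ))) hm).2 (Filter.Eventually.of_forall fun X => by
      have h0 : (volume : Measure (ℝ × ℝ)) {X} = 0 := measure_singleton X
      rw [Filter.eventually_iff, mem_ae_iff]
      refine measure_mono_null (fun Y hY => ?_) h0
      simp only [Set.mem_compl_iff, Set.mem_ofPred_eq, not_not] at hY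
      exact hY.symm)
  exact this

/-- Fubini. Since `mixKernel` is nonnegative, integrating absolute values over `r` returns the
assumed integrable function. The diagonal, where the representation fails, is a null set. -/
theorem integral_logKernel_eq {b : ℝ} (hb : 0 < b) {η : ℝ × ℝ → ℝ} (hη : AEStronglyMeasurable η volume)
    (hi : Integrable (fun p : (ℝ × ℝ) × (ℝ × ℝ) => logKernel b p.1 p.2 * (η p.1 * η p.2))
      (volume.prod volume)) :
    IntegrableOn (fun r => ∫ p : (ℝ × ℝ) × (ℝ × ℝ), mixKernel b r p.1 p.2 * (η p.1 * η p.2)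
      ∂(volume.prod volume)) (Set.Ioo 0 1) ∧
    ∫ p : (ℝ × ℝ) × (ℝ × ℝ), logKernel b p.1 p.2 * (η p.1 * η p.2) ∂(volume.prod volume) =
      ∫ r in Set.Ioo (0 : ℝ) 1, ∫ p : (ℝ × ℝ) × (ℝ × ℝ), mixKernel b r p.1 p.2 * (η p.1 * η p.2)
        ∂(volume.prod volume) := by
  set ν := (volume : Measure ℝ).restrict (Set.Ioo 0 1) with hν
  set G : ((ℝ × ℝ) × (ℝ × ℝ)) × ℝ → ℝ :=
    fun q => mixKernel b q.2 q.1.1 q.1.2 * (η q.1.1 * η q.1.2) with hG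
  have hGm : AEStronglyMeasurable G ((volume.prod volume).prod ν) := by
    refine AEStronglyMeasurable.mul (Measurable.aestronglyMeasurable ?_) ?_
    · unfold mixKernel heatKernel sqDist; fun_prop
    · exact (hη.comp_fst.mul hη.comp_snd).comp_fst
  have hnorm : ∀ p : (ℝ × ℝ) × (ℝ × ℝ), p.1 ≠ p.2 →
      ∫ r, ‖G (p, r)‖ ∂ν = ‖logKernel b p.1 p.2 * (η p.1 * η p.2)‖ := by
    intro p hp
    have h1 : ∀ r ∈ Set.Ioo (0 : ℝ) 1, ‖G (p, r)‖ = mixKernel b r p.1 p.2 * ‖η p.1 * η p.2‖ := by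
      intro r hr
      rw [hG, norm_mul, Real.norm_of_nonneg (mixKernel_nonneg hb.le hr.1 hr.2 _ _)]
    have h2 : 0 ≤ ∫ r in Set.Ioo (0 : ℝ) 1, mixKernel b r p.1 p.2 :=
      setIntegral_nonneg measurableSet_Ioo fun r hr => mixKernel_nonneg hb.le hr.1 hr.2 _ _
    rw [setIntegral_congr_fun measurableSet_Ioo h1, integral_mul_const, norm_mul (logKernel b p.1 p.2),
      ← integral_mixKernel hb hp, Real.norm_of_nonneg h2]
  have hGi : Integrable G ((volume.prod volume).prod ν) := by
    rw [integrable_prod_iff hGm]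
    constructor
    · filter_upwards [ae_prod_ne] with p hp
      exact (integrableOn_mixKernel hb hp).mul_const (η p.1 * η p.2)
    · refine hi.norm.congr ?_
      filter_upwards [ae_prod_ne] with p hp
      exact (hnorm p hp).symm
  refine ⟨hGi.integral_prod_right, ?_⟩
  have h1 := integral_prod G hGi
  have h2 := integral_prod_symm G hGi
  rw [← h2, h1]
  apply integral_congr_ae
  filter_upwards [ae_prod_ne] with p hp
  rw [← integral_mixKernel hb hp]
  simp only [hG]
  rw [integral_mul_const]

/-! ### The weight `A` as a superposition of Gaussians -/

/-- Here `Ψ(s)` is the tail integral of `φ` over `[s, 1]`. Integration by parts gives `∫ φ e^{sy} =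
Ψ(0) + y ∫ Ψ e^{sy}`, so nonnegative tails suffice even where `φ` changes sign. -/
theorem integral_exp_weighted_nonneg {y : ℝ} (hy : 0 ≤ y) {φ Ψ : ℝ → ℝ} (hφ : Continuous φ)
    (hΨ : ∀ s, HasDerivAt Ψ (-φ s) s) (h1 : Ψ 1 = 0) (h0 : ∀ s ∈ Set.Icc (0 : ℝ) 1, 0 ≤ Ψ s) :
    0 ≤ ∫ s in (0 : ℝ)..1, φ s * Real.exp (s * y) := by
  have hc : Continuous Ψ := continuous_iff_continuousAt.2 fun s => (hΨ s).continuousAt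
  have hd : ∀ s ∈ Set.uIcc (0 : ℝ) 1, HasDerivAt (fun s => -(Ψ s * Real.exp (s * y)))
      (φ s * Real.exp (s * y) - y * (Ψ s * Real.exp (s * y))) s := by
    intro s _
    refine ((hΨ s).mul (((hasDerivAt_id' s).mul_const y).exp)).neg.congr_deriv ?_
    ring
  have i1 : IntervalIntegrable (fun s => φ s * Real.exp (s * y)) volume 0 1 :=
    Continuous.intervalIntegrable (by fun_prop) _ _
  have i2 : IntervalIntegrable (fun s => y * (Ψ s * Real.exp (s * y))) volume 0 1 :=
    Continuous.intervalIntegrable (by fun_prop) _ _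
  have h := intervalIntegral.integral_eq_sub_of_hasDerivAt hd (i1.sub i2)
  rw [intervalIntegral.integral_sub i1 i2, h1] at h
  have h2 : 0 ≤ ∫ s in (0 : ℝ)..1, y * (Ψ s * Real.exp (s * y)) := by
    apply intervalIntegral.integral_nonneg (by norm_num)
    intro s hs
    have := h0 s hs
    positivity
  have h3 := h0 0 (by simp)
  simp only [zero_mul, Real.exp_zero, mul_one, neg_zero, zero_sub, neg_neg] at h
  linarith

/-- Tilting by `e^{sy}` moves mass to larger `s`, so the average of an increasing function is at
least its average at `y = 0`; the cubic case is the same. -/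
theorem integral_id_mul_exp_ge {y : ℝ} (hy : 0 ≤ y) :
    1 / 2 * ∫ s in (0 : ℝ)..1, Real.exp (s * y) ≤ ∫ s in (0 : ℝ)..1, s * Real.exp (s * y) := by
  have h := integral_exp_weighted_nonneg hy (φ := fun s => s - 1 / 2) (Ψ := fun s => s * (1 - s) / 2)
    (by fun_prop) (fun s => by
      refine (((hasDerivAt_id' s).mul ((hasDerivAt_id' s).const_sub 1)).div_const 2).congr_deriv ?_
      ring) (by norm_num) (fun s hs => by
        have := hs.1; have := sub_nonneg.2 hs.2; positivity)
  simp only [sub_mul] at h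
  rw [intervalIntegral.integral_sub (Continuous.intervalIntegrable (by fun_prop) _ _)
    (Continuous.intervalIntegrable (by fun_prop) _ _), intervalIntegral.integral_const_mul] at h
  linarith

theorem integral_cube_mul_exp_ge {y : ℝ} (hy : 0 ≤ y) :
    1 / 8 * ∫ s in (0 : ℝ)..1, Real.exp (s * y) ≤ ∫ s in (0 : ℝ)..1, s ^ 3 / 2 * Real.exp (s * y) := by
  have h := integral_exp_weighted_nonneg hy (φ := fun s => s ^ 3 / 2 - 1 / 8) (Ψ := fun s => (s - s ^ 4) / 8)
    (by fun_prop) (fun s => by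
      refine (((hasDerivAt_id' s).sub (hasDerivAt_pow 4 s)).div_const 8).congr_deriv ?_
      push_cast
      ring) (by norm_num) (fun s hs => by
        have : s ^ 4 ≤ s := pow_le_of_le_one hs.1 hs.2 (by norm_num)
        linarith)
  simp only [sub_mul] at h
  rw [intervalIntegral.integral_sub (Continuous.intervalIntegrable (by fun_prop) _ _)
    (Continuous.intervalIntegrable (by fun_prop) _ _), intervalIntegral.integral_const_mul] at h
  linarith

/-- Jensen's inequality for the probability measure `2s ds` on `[0,1]`, whose mean is `2/3`; the
proof integrates the tangent line there. -/
theorem exp_two_thirds_le (y : ℝ) :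
    1 / 2 * Real.exp (2 / 3 * y) ≤ ∫ s in (0 : ℝ)..1, s * Real.exp (s * y) := by
  have h1 : ∫ s in (0 : ℝ)..1, (s * (1 - 2 / 3 * y) + s ^ 2 * y) * Real.exp (2 / 3 * y) =
      1 / 2 * Real.exp (2 / 3 * y) := by
    rw [intervalIntegral.integral_mul_const, intervalIntegral.integral_add
      (Continuous.intervalIntegrable (by fun_prop) _ _) (Continuous.intervalIntegrable (by fun_prop) _ _),
      intervalIntegral.integral_mul_const, intervalIntegral.integral_mul_const, integral_id, integral_pow]
    norm_num
    ring
  rw [← h1]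
  apply intervalIntegral.integral_mono_on (by norm_num) (Continuous.intervalIntegrable (by fun_prop) _ _)
    (Continuous.intervalIntegrable (by fun_prop) _ _)
  intro s hs
  have h2 : Real.exp (s * y) = Real.exp (2 / 3 * y) * Real.exp (s * y - 2 / 3 * y) := by
    rw [← Real.exp_add]; congr 1; ring
  have h3 := Real.add_one_le_exp (s * y - 2 / 3 * y)
  rw [h2]
  calc _ = s * (Real.exp (2 / 3 * y) * (s * y - 2 / 3 * y + 1)) := by ring
    _ ≤ _ := by
      have := hs.1
      gcongr

theorem A_rad_eq (X : ℝ × ℝ) :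
    A (rad X) = ∫ s in (0 : ℝ)..1, Real.exp (s * ((X.1 ^ 2 + X.2 ^ 2) / 4)) := by
  rw [A, rad_sq]
  by_cases h : rad X = 0
  · have : X.1 ^ 2 + X.2 ^ 2 = 0 := by rw [← rad_sq, h]; norm_num
    simp [h, this]
  · have h2 : X.1 ^ 2 + X.2 ^ 2 ≠ 0 := by rw [← rad_sq]; positivity
    rw [if_neg h]
    have : (X.1 ^ 2 + X.2 ^ 2) / 4 ≠ 0 := by positivity
    rw [intervalIntegral.integral_comp_mul_right _ this, integral_exp]
    simp

theorem setIntegral_Ioo_one_sub (f : ℝ → ℝ) :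
    ∫ r in Set.Ioo (0 : ℝ) 1, f (1 - r) = ∫ s in (0 : ℝ)..1, f s := by
  rw [← integral_Ioc_eq_integral_Ioo, ← intervalIntegral.integral_of_le (by norm_num),
    intervalIntegral.integral_comp_sub_left]
  norm_num

theorem gauss_neg_eq_exp (s : ℝ) (X : ℝ × ℝ) :
    gauss (-(s / 4)) X = Real.exp (s * ((X.1 ^ 2 + X.2 ^ 2) / 4)) := by
  rw [gauss]; congr 1; ring

/-- With `I_j = ∫₀¹ s^j e^{sy} ds`, `y = ρ²/4`, the left side is at most `I₀ - I₁ + (7/10) I₁`. As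
`I₁ ≥ I₀/2`, this is at most `(17/20) I₀`. -/
theorem integral_evenWeight_le (X : ℝ × ℝ) :
    ∫ r in Set.Ioo (0 : ℝ) 1, (r * gauss (-((1 - r) / 4)) X + 7 / 20 * gauss (-(1 / 6)) X) ≤
      7 / 8 * A (rad X) := by
  set y := (X.1 ^ 2 + X.2 ^ 2) / 4 with hy
  have hy0 : 0 ≤ y := by positivity
  have e6 : gauss (-(1 / 6)) X = Real.exp (2 / 3 * y) := by rw [gauss, hy]; congr 1; ring
  have h := setIntegral_Ioo_one_sub fun s => (1 - s) * Real.exp (s * y) + 7 / 20 * Real.exp (2 / 3 * y)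
  simp only [gauss_neg_eq_exp, e6, A_rad_eq, ← hy]
  simp only [sub_sub_cancel] at h
  rw [h]
  simp only [sub_mul, one_mul]
  rw [intervalIntegral.integral_add (Continuous.intervalIntegrable (by fun_prop) _ _)
    (Continuous.intervalIntegrable (by fun_prop) _ _), intervalIntegral.integral_sub
    (Continuous.intervalIntegrable (by fun_prop) _ _) (Continuous.intervalIntegrable (by fun_prop) _ _)]
  have h1 := integral_id_mul_exp_ge hy0
  have h2 := exp_two_thirds_le y
  have h3 : 0 ≤ ∫ s in (0 : ℝ)..1, Real.exp (s * y) :=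
    intervalIntegral.integral_nonneg (by norm_num) fun s _ => (Real.exp_pos _).le
  simp only [intervalIntegral.integral_const, sub_zero, smul_eq_mul, one_mul]
  linarith

theorem integral_oddWeight_le (X : ℝ × ℝ) :
    ∫ r in Set.Ioo (0 : ℝ) 1, (1 - (1 - r) ^ 3 / 2) * gauss (-((1 - r) / 4)) X ≤
      7 / 8 * A (rad X) := by
  set y := (X.1 ^ 2 + X.2 ^ 2) / 4 with hy
  have hy0 : 0 ≤ y := by positivity
  have h := setIntegral_Ioo_one_sub fun s => (1 - s ^ 3 / 2) * Real.exp (s * y)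
  simp only [gauss_neg_eq_exp, A_rad_eq, ← hy]
  rw [h]
  simp only [sub_mul, one_mul]
  rw [intervalIntegral.integral_sub
    (Continuous.intervalIntegrable (by fun_prop) _ _) (Continuous.intervalIntegrable (by fun_prop) _ _)]
  have h1 := integral_cube_mul_exp_ge hy0
  linarith

theorem integral_superposition {η : ℝ × ℝ → ℝ} (h : BddSuppL2 η) {ω : ℝ → ℝ × ℝ → ℝ}
    (hω : Continuous fun q : ℝ × (ℝ × ℝ) => ω q.1 q.2)
    (hb : ∀ r ∈ Set.Ioo (0 : ℝ) 1, ∀ X, |ω r X| ≤ 2 * gauss (-(1 / 4)) X) :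
    IntegrableOn (fun r => ∫ X, ω r X * η X ^ 2) (Set.Ioo 0 1) ∧
    Integrable (fun X => (∫ r in Set.Ioo (0 : ℝ) 1, ω r X) * η X ^ 2) ∧
    ∫ r in Set.Ioo (0 : ℝ) 1, ∫ X, ω r X * η X ^ 2 = ∫ X, (∫ r in Set.Ioo (0 : ℝ) 1, ω r X) * η X ^ 2 := by
  set ν := (volume : Measure ℝ).restrict (Set.Ioo 0 1) with hν
  have i1 : Integrable (fun q : ℝ × (ℝ × ℝ) => ω q.1 q.2 * η q.2 ^ 2) (ν.prod volume) := by
    have i2 : Integrable (fun q : ℝ × (ℝ × ℝ) => (2 : ℝ) * (gauss (-(1 / 4)) q.2 * η q.2 ^ 2))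
        (ν.prod volume) :=
      (integrable_const (2 : ℝ)).mul_prod (h.integrable_mul_sq (continuous_gauss (-(1 / 4))))
    refine i2.mono' (hω.aestronglyMeasurable.mul ((h.memLp.1.comp_snd).pow 2)) ?_
    have h1 : ∀ᵐ q : ℝ × (ℝ × ℝ) ∂(ν.prod volume), q.1 ∈ Set.Ioo (0 : ℝ) 1 :=
      Measure.quasiMeasurePreserving_fst.ae (ae_restrict_mem measurableSet_Ioo)
    filter_upwards [h1] with q hq
    rw [norm_mul, Real.norm_of_nonneg (sq_nonneg _), ← mul_assoc]
    exact mul_le_mul_of_nonneg_right (hb _ hq _) (sq_nonneg _)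
  refine ⟨i1.integral_prod_left, ?_, ?_⟩
  · have := i1.integral_prod_right
    simpa only [integral_mul_const] using this
  · rw [integral_integral_swap i1]
    simp only [integral_mul_const]

/-! ### Scalar inequalities at a fixed value of `r`. -/

/-- The quotient of the two polynomials peaks near `r = 7/25`, slightly above `3/5`; the squares
supplied are centred there. -/
theorem radial_poly_bound {r : ℝ} (hr : 0 < r) :
    r * (1 - r) * (1 + r) ^ 2 ≤ 31 / 50 * ((r + 1 / 3) * (r + 2 / 3) ^ 2) := by
  have h1 : 0 ≤ (r - 7 / 25) ^ 2 * (r + 14 / 25) := by positivity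
  have h2 : 0 ≤ (r ^ 2 - 49 / 625) ^ 2 := sq_nonneg _
  have h3 := sq_nonneg (r - 7 / 25)
  nlinarith

theorem even_sector_bound {r h m N : ℝ} (hr : 0 < r) (hr1 : r < 1) (hN : 0 ≤ N)
    (hE : (h - (2 / 3) / (r + 2 / 3) * m) ^ 2 ≤
      4 * Real.pi * r ^ 2 / ((2 * r + 2 / 3) * (r + 2 / 3) ^ 2) * N) :
    (1 - r ^ 2) * (1 + r) / (4 * Real.pi * r) * h ^ 2 ≤
      7 / 20 * N + 9 * ((1 - r) / (Real.pi * r)) * m ^ 2 := by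
  have hpi := Real.pi_pos
  have h1r : 0 < 1 - r := by linarith
  have h1r2 : 0 < 1 - r ^ 2 := by nlinarith
  set c := (2 / 3) / (r + 2 / 3) with hc
  have hc0 : 0 ≤ c := by positivity
  have hc1 : c ≤ 1 := by rw [hc, div_le_one (by positivity)]; linarith
  set K := (1 - r ^ 2) * (1 + r) / (4 * Real.pi * r) with hK
  have hK0 : 0 < K := by positivity
  -- Young's inequality with parameter `1/8`; the large factor `9` falls on the mass, where it is
  -- harmless.
  have s1 : h ^ 2 ≤ 9 / 8 * (h - c * m) ^ 2 + 9 * m ^ 2 := by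
    have : (c * m) ^ 2 ≤ m ^ 2 := by
      rw [mul_pow]
      have : c ^ 2 ≤ 1 := by nlinarith
      nlinarith [sq_nonneg m]
    nlinarith [sq_nonneg (h - c * m - 8 * (c * m))]
  -- The constants fit because `(9/16)(31/50) = 279/800 < 7/20`.
  have s2 : K * (9 / 8 * (4 * Real.pi * r ^ 2 / ((2 * r + 2 / 3) * (r + 2 / 3) ^ 2))) ≤ 7 / 20 := by
    have e : K * (9 / 8 * (4 * Real.pi * r ^ 2 / ((2 * r + 2 / 3) * (r + 2 / 3) ^ 2))) =
        9 / 16 * (r * (1 - r) * (1 + r) ^ 2) / ((r + 1 / 3) * (r + 2 / 3) ^ 2) := by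
      rw [hK, show 2 * r + 2 / 3 = 2 * (r + 1 / 3) by ring]
      field_simp
      ring
    rw [e, div_le_iff₀ (by positivity)]
    have := radial_poly_bound hr
    have : 0 < (r + 1 / 3) * (r + 2 / 3) ^ 2 := by positivity
    linarith
  have s3 : K ≤ (1 - r) / (Real.pi * r) := by
    rw [hK, div_le_div_iff₀ (by positivity) (by positivity)]
    have : (1 - r ^ 2) * (1 + r) ≤ 4 * (1 - r) := by nlinarith
    nlinarith [mul_pos hpi hr]
  calc K * h ^ 2 ≤ K * (9 / 8 * (h - c * m) ^ 2 + 9 * m ^ 2) := by gcongr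
    _ ≤ K * (9 / 8 * (4 * Real.pi * r ^ 2 / ((2 * r + 2 / 3) * (r + 2 / 3) ^ 2) * N) + 9 * m ^ 2) := by
        gcongr
    _ = K * (9 / 8 * (4 * Real.pi * r ^ 2 / ((2 * r + 2 / 3) * (r + 2 / 3) ^ 2))) * N +
        9 * K * m ^ 2 := by ring
    _ ≤ _ := by gcongr

theorem odd_sector_bound {r g₁ g₂ m₁ m₂ N : ℝ} (hr : 0 < r) (hr1 : r < 1) (hN : 0 ≤ N)
    (hO : (g₁ - (1 - r) ^ 2 * m₁) ^ 2 + (g₂ - (1 - r) ^ 2 * m₂) ^ 2 ≤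
      8 * Real.pi * (1 / (1 + r) ^ 2 - (1 - r) ^ 2) * N) :
    (1 - r) * (1 + r) ^ 2 / (8 * Real.pi) * (g₁ ^ 2 + g₂ ^ 2) ≤
      (1 - r) * (1 - (1 - r) ^ 2 / 2) * N + (m₁ ^ 2 + m₂ ^ 2) := by
  have hpi := Real.pi_gt_three
  have h1r : 0 < 1 - r := by linarith
  set x := ((1 - r) * (1 + r)) ^ 2 with hx
  have hx0 : 0 < x := by positivity
  have hx1 : x ≤ 1 := by
    have h1 : (1 - r) * (1 + r) ≤ 1 := by nlinarith
    have h2 : 0 ≤ (1 - r) * (1 + r) := by positivity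
    nlinarith
  have hxs : (1 - r) ^ 2 ≤ x := by
    rw [hx, mul_pow]
    have : 1 ≤ (1 + r) ^ 2 := by nlinarith
    nlinarith [sq_nonneg (1 - r)]
  -- Young's inequality with parameter `x/2`. The residual has relative size `1 - x`, and `(1 +
  -- x/2)(1 - x) ≤ 1 - x/2` keeps a definite gain. The factor `2/x` on the moment part is
  -- compensated by `c² = (1-r)⁴` and the prefactor `L`.
  have young : ∀ p q : ℝ, x * (p + q) ^ 2 ≤ x * ((1 + x / 2) * p ^ 2) + (x + 2) * q ^ 2 := by
    intro p q
    nlinarith [sq_nonneg (x * p - 2 * q)]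
  set c := (1 - r) ^ 2 with hc
  set L := (1 - r) * (1 + r) ^ 2 / (8 * Real.pi) with hL
  have hL0 : 0 < L := by positivity
  set S := (g₁ - c * m₁) ^ 2 + (g₂ - c * m₂) ^ 2 with hS
  have s1 : g₁ ^ 2 + g₂ ^ 2 ≤ (1 + x / 2) * S + (x + 2) / x * c ^ 2 * (m₁ ^ 2 + m₂ ^ 2) := by
    have y1 := young (g₁ - c * m₁) (c * m₁)
    have y2 := young (g₂ - c * m₂) (c * m₂)
    rw [sub_add_cancel] at y1 y2
    have e : x * ((1 + x / 2) * S + (x + 2) / x * c ^ 2 * (m₁ ^ 2 + m₂ ^ 2)) =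
        x * ((1 + x / 2) * S) + (x + 2) * (c ^ 2 * (m₁ ^ 2 + m₂ ^ 2)) := by
      field_simp
    have : x * (g₁ ^ 2 + g₂ ^ 2) ≤ x * ((1 + x / 2) * S + (x + 2) / x * c ^ 2 * (m₁ ^ 2 + m₂ ^ 2)) := by
      rw [e, hS]; linarith
    exact le_of_mul_le_mul_left this hx0
  have s2 : L * ((1 + x / 2) * (8 * Real.pi * (1 / (1 + r) ^ 2 - c))) ≤ (1 - r) * (1 - c / 2) := by
    have e : L * ((1 + x / 2) * (8 * Real.pi * (1 / (1 + r) ^ 2 - c))) = (1 - r) * ((1 + x / 2) * (1 - x)) := by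
      rw [hL, hx, hc]; field_simp
    rw [e]
    gcongr
    nlinarith
  have s3 : L * ((x + 2) / x * c ^ 2) ≤ 1 := by
    have e : L * ((x + 2) / x * c ^ 2) = (1 - r) * (c * (x + 2)) / (8 * Real.pi) := by
      rw [hL, hc, hx]; field_simp
    have hc1 : c ≤ 1 := hxs.trans hx1
    have hc0 : 0 ≤ c := by rw [hc]; positivity
    rw [e, div_le_one (by positivity)]
    have : c * (x + 2) ≤ 1 * 3 := by gcongr; linarith
    nlinarith
  calc L * (g₁ ^ 2 + g₂ ^ 2) ≤ L * ((1 + x / 2) * S + (x + 2) / x * c ^ 2 * (m₁ ^ 2 + m₂ ^ 2)) := by gcongr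
    _ ≤ L * ((1 + x / 2) * (8 * Real.pi * (1 / (1 + r) ^ 2 - c) * N) +
        (x + 2) / x * c ^ 2 * (m₁ ^ 2 + m₂ ^ 2)) := by gcongr
    _ = L * ((1 + x / 2) * (8 * Real.pi * (1 / (1 + r) ^ 2 - c))) * N +
        L * ((x + 2) / x * c ^ 2) * (m₁ ^ 2 + m₂ ^ 2) := by ring
    _ ≤ (1 - r) * (1 - c / 2) * N + 1 * (m₁ ^ 2 + m₂ ^ 2) := by gcongr
    _ = _ := by rw [one_mul]

/-- The factor `1 - exp(-b/4t)` is bounded by `1` and by `b/4t`, so the `1/r` singularity of the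
mass coefficient saturates at height `b`. -/
theorem cutoff_weight_le {b r : ℝ} (hb : 0 < b) (hr : 0 < r) (hr1 : r < 1) :
    (1 - Real.exp (-(b * (r / (4 * (1 - r)))))) * (9 * ((1 - r) / (Real.pi * r))) ≤ 18 * (r + b⁻¹)⁻¹ := by
  have hpi := Real.pi_gt_three
  have h1r : 0 < 1 - r := by linarith
  set ν := 1 - Real.exp (-(b * (r / (4 * (1 - r))))) with hν
  have hν1 : ν ≤ 1 := by have := Real.exp_pos (-(b * (r / (4 * (1 - r))))); linarith
  have hνb : ν ≤ b * (r / (4 * (1 - r))) := by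
    have := Real.add_one_le_exp (-(b * (r / (4 * (1 - r))))); linarith
  have e : (1 - r) / (Real.pi * r) = (1 - r) * r⁻¹ * Real.pi⁻¹ := by field_simp
  have hpi1 : Real.pi⁻¹ ≤ 1 := inv_le_one_of_one_le₀ (by linarith)
  have k1 : ν * ((1 - r) / (Real.pi * r)) * r ≤ 1 := by
    have : ν * ((1 - r) / (Real.pi * r)) * r = ν * (1 - r) * Real.pi⁻¹ := by rw [e]; field_simp
    rw [this]
    have : ν * (1 - r) ≤ 1 := by nlinarith
    have h0 : 0 < Real.pi⁻¹ := by positivity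
    nlinarith
  have k2 : ν * ((1 - r) / (Real.pi * r)) * b⁻¹ ≤ 1 := by
    have h2 : ν * ((1 - r) / (Real.pi * r)) * b⁻¹ ≤
        b * (r / (4 * (1 - r))) * ((1 - r) / (Real.pi * r)) * b⁻¹ := by gcongr
    have h3 : b * (r / (4 * (1 - r))) * ((1 - r) / (Real.pi * r)) * b⁻¹ = 1 / 4 * Real.pi⁻¹ := by
      field_simp
    linarith
  rw [← div_eq_mul_inv, le_div_iff₀ (by positivity)]
  linarith

/-! ### The bound for the logarithmic form. -/

/-- The spectral bound for all of `η`, with the mass charged to the even part and the first moments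
to the odd part. The odd weight is `r + (1-r)(1 - (1-r)²/2) = 1 - (1-r)³/2`. -/
theorem integral_mixKernel_form_le {b r : ℝ} (hb : 0 < b) (hr : 0 < r) (hr1 : r < 1) {η : ℝ × ℝ → ℝ}
    (hη : BddSuppL2 η) :
    ∫ p : (ℝ × ℝ) × (ℝ × ℝ), mixKernel b r p.1 p.2 * (η p.1 * η p.2) ∂(volume.prod volume) ≤
      (∫ X, (r * gauss (-((1 - r) / 4)) X + 7 / 20 * gauss (-(1 / 6)) X) * evenPart η X ^ 2) +
      (∫ X, ((1 - (1 - r) ^ 3 / 2) * gauss (-((1 - r) / 4)) X) * oddPart η X ^ 2) +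
      18 * (r + b⁻¹)⁻¹ * (∫ X, η X) ^ 2 +
      ((∫ X : ℝ × ℝ, X.1 * η X) ^ 2 + (∫ X : ℝ × ℝ, X.2 * η X) ^ 2) := by
  have hpi := Real.pi_pos
  have h1r : 0 < 1 - r := by linarith
  have heven : BddSuppL2 (evenPart η) := hη.half_add
  have hodd : BddSuppL2 (oddPart η) := hη.half_sub
  have hheat := integral_heatKernel_le hr hr1 (hη.mul (continuous_gauss (-((1 - r) / 8)))).memLp
  have hE := sq_laplace_sub_mass_le heven hr
  have hO := sq_laplace_sub_moment_le hodd hr hr1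
  have cE0 : ∫ X, evenPart η X = ∫ X, η X := by
    have := integral_mul_evenPart hη (φ := fun _ => (1 : ℝ)) continuous_const (fun _ => rfl)
    simpa only [one_mul] using this
  rw [integral_mul_evenPart hη (by fun_prop) (gauss_neg_arg _), cE0] at hE
  rw [integral_mul_oddPart hη (φ := fun X => X.1 * gauss (r / 4) X) (by fun_prop)
      (fun X => by rw [gauss_neg_arg]; simp),
    integral_mul_oddPart hη (φ := fun X => X.2 * gauss (r / 4) X) (by fun_prop)
      (fun X => by rw [gauss_neg_arg]; simp),
    integral_mul_oddPart hη (φ := fun X => X.1) (by fun_prop) (fun X => by simp),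
    integral_mul_oddPart hη (φ := fun X => X.2) (by fun_prop) (fun X => by simp)] at hO
  rw [integral_mul_sq_parity hη (by fun_prop) (gauss_neg_arg _)] at hheat
  have eE : ∫ X, (r * gauss (-((1 - r) / 4)) X + 7 / 20 * gauss (-(1 / 6)) X) * evenPart η X ^ 2 =
      r * (∫ X, gauss (-((1 - r) / 4)) X * evenPart η X ^ 2) +
        7 / 20 * ∫ X, gauss (-(1 / 6)) X * evenPart η X ^ 2 := by
    rw [← integral_const_mul, ← integral_const_mul, ← integral_add
      ((heven.integrable_mul_sq (by fun_prop)).const_mul _)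
      ((heven.integrable_mul_sq (by fun_prop)).const_mul _)]
    congr 1; ext X; ring
  have eO : ∫ X, ((1 - (1 - r) ^ 3 / 2) * gauss (-((1 - r) / 4)) X) * oddPart η X ^ 2 =
      (1 - (1 - r) ^ 3 / 2) * ∫ X, gauss (-((1 - r) / 4)) X * oddPart η X ^ 2 := by
    rw [← integral_const_mul]
    congr 1; ext X; ring
  have eL : ∫ p : (ℝ × ℝ) × (ℝ × ℝ), mixKernel b r p.1 p.2 * (η p.1 * η p.2) ∂(volume.prod volume) =
      (1 - Real.exp (-(b * (r / (4 * (1 - r)))))) / r ^ 2 *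
      ∫ p : (ℝ × ℝ) × (ℝ × ℝ), heatKernel r p.1 p.2 * (η p.1 * η p.2) ∂(volume.prod volume) := by
    rw [← integral_const_mul]
    congr 1; ext p; rw [mixKernel]; ring
  rw [eE, eO, eL]
  have nE : 0 ≤ ∫ X, gauss (-((1 - r) / 4)) X * evenPart η X ^ 2 :=
    integral_nonneg fun X => mul_nonneg (gauss_pos _ X).le (sq_nonneg _)
  have nO : 0 ≤ ∫ X, gauss (-((1 - r) / 4)) X * oddPart η X ^ 2 :=
    integral_nonneg fun X => mul_nonneg (gauss_pos _ X).le (sq_nonneg _)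
  have n6 : 0 ≤ ∫ X, gauss (-(1 / 6)) X * evenPart η X ^ 2 :=
    integral_nonneg fun X => mul_nonneg (gauss_pos _ X).le (sq_nonneg _)
  generalize (∫ X, gauss (-((1 - r) / 4)) X * evenPart η X ^ 2) = NE at *
  generalize (∫ X, gauss (-((1 - r) / 4)) X * oddPart η X ^ 2) = NO at *
  generalize (∫ X, gauss (-(1 / 6)) X * evenPart η X ^ 2) = N6 at *
  generalize (∫ X, gauss (r / 4) X * η X) = h at *
  generalize (∫ X, η X) = m at *
  generalize (∫ X : ℝ × ℝ, X.1 * gauss (r / 4) X * η X) = g₁ at *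
  generalize (∫ X : ℝ × ℝ, X.2 * gauss (r / 4) X * η X) = g₂ at *
  generalize (∫ X : ℝ × ℝ, X.1 * η X) = m₁ at *
  generalize (∫ X : ℝ × ℝ, X.2 * η X) = m₂ at *
  generalize (∫ p : (ℝ × ℝ) × (ℝ × ℝ), heatKernel r p.1 p.2 * (η p.1 * η p.2) ∂(volume.prod volume)) = H at *
  have bE := even_sector_bound hr hr1 n6 hE
  have bO := odd_sector_bound hr hr1 nO hO
  have bc := cutoff_weight_le hb hr hr1
  have hφ : 0 < b * (r / (4 * (1 - r))) := by positivity
  have hν0 : 0 ≤ 1 - Real.exp (-(b * (r / (4 * (1 - r))))) := by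
    have := Real.exp_le_one_iff.2 (neg_nonpos.2 hφ.le); linarith
  have hν1 : 1 - Real.exp (-(b * (r / (4 * (1 - r))))) ≤ 1 := by
    have := Real.exp_pos (-(b * (r / (4 * (1 - r))))); linarith
  generalize (1 - Real.exp (-(b * (r / (4 * (1 - r)))))) = ν at *
  have e1 : ν / r ^ 2 * (r * (r ^ 2 * (NE + NO) + (1 - r ^ 2) * ((1 + r) / (4 * Real.pi)) * h ^ 2 +
      (r - r ^ 2) * ((1 + r) ^ 2 / (8 * Real.pi)) * (g₁ ^ 2 + g₂ ^ 2))) =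
      ν * (r * (NE + NO) + (1 - r ^ 2) * (1 + r) / (4 * Real.pi * r) * h ^ 2 +
      (1 - r) * (1 + r) ^ 2 / (8 * Real.pi) * (g₁ ^ 2 + g₂ ^ 2)) := by
    field_simp
  have hs : 0 ≤ (1 - r) * (1 - (1 - r) ^ 2 / 2) * NO := by
    have : 0 ≤ 1 - (1 - r) ^ 2 / 2 := by nlinarith
    positivity
  calc ν / r ^ 2 * H ≤ _ := mul_le_mul_of_nonneg_left hheat (by positivity)
    _ = _ := e1
    _ ≤ ν * (r * (NE + NO) + (7 / 20 * N6 + 9 * ((1 - r) / (Real.pi * r)) * m ^ 2) +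
        ((1 - r) * (1 - (1 - r) ^ 2 / 2) * NO + (m₁ ^ 2 + m₂ ^ 2))) := by gcongr
    _ = ν * (r * (NE + NO) + 7 / 20 * N6 + (1 - r) * (1 - (1 - r) ^ 2 / 2) * NO + (m₁ ^ 2 + m₂ ^ 2)) +
        ν * (9 * ((1 - r) / (Real.pi * r))) * m ^ 2 := by ring
    _ ≤ 1 * (r * (NE + NO) + 7 / 20 * N6 + (1 - r) * (1 - (1 - r) ^ 2 / 2) * NO + (m₁ ^ 2 + m₂ ^ 2)) +
        18 * (r + b⁻¹)⁻¹ * m ^ 2 := by gcongr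
    _ = _ := by ring

theorem integral_inv_add_const {b : ℝ} (hb : 0 < b) :
    IntegrableOn (fun r : ℝ => (r + b⁻¹)⁻¹) (Set.Ioo 0 1) ∧
      ∫ r in Set.Ioo (0 : ℝ) 1, (r + b⁻¹)⁻¹ = Real.log (1 + b) := by
  have hpos : ∀ r ∈ Set.uIcc (0 : ℝ) 1, 0 < r + b⁻¹ := by
    intro r hr
    rw [Set.uIcc_of_le (by norm_num)] at hr
    have := hr.1
    positivity
  have hc : IntervalIntegrable (fun r : ℝ => (r + b⁻¹)⁻¹) volume 0 1 :=
    ContinuousOn.intervalIntegrable (ContinuousOn.inv₀ (by fun_prop) fun r hr => (hpos r hr).ne')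
  constructor
  · exact ((intervalIntegrable_iff_integrableOn_Ioc_of_le (by norm_num)).1 hc).mono_set Set.Ioo_subset_Ioc_self
  · rw [← integral_Ioc_eq_integral_Ioo, ← intervalIntegral.integral_of_le (by norm_num),
      intervalIntegral.integral_comp_add_right (fun r => r⁻¹), integral_inv_of_pos (by positivity) (by positivity)]
    congr 1
    field_simp
    ring

theorem A_rad_nonneg (X : ℝ × ℝ) : 0 ≤ A (rad X) := by
  rw [A_rad_eq]
  exact intervalIntegral.integral_nonneg (by norm_num) fun s _ => (Real.exp_pos _).le

theorem integrable_A_mul_sq {η : ℝ × ℝ → ℝ} (hη : BddSuppL2 η) :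
    Integrable fun X => A (rad X) * η X ^ 2 := by
  have h := (integral_superposition hη (ω := fun r X => gauss (-((1 - r) / 4)) X)
    (by unfold gauss; fun_prop) (fun r hr X => by
      have h1 : gauss (-((1 - r) / 4)) X ≤ gauss (-(1 / 4)) X := by
        have h2 : 0 ≤ X.1 ^ 2 + X.2 ^ 2 := by positivity
        apply Real.exp_le_exp.2
        nlinarith [hr.1]
      have h0 := gauss_pos (-((1 - r) / 4)) X
      rw [abs_of_pos h0]
      linarith)).2.1
  refine h.congr (Filter.Eventually.of_forall fun X => ?_)
  simp only [gauss_neg_eq_exp, A_rad_eq]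
  rw [setIntegral_Ioo_one_sub fun s => Real.exp (s * ((X.1 ^ 2 + X.2 ^ 2) / 4))]

/-- Integration over `r` turns both families of weights into at most `(7/8) A`, and `∫₀¹ (r + b⁻¹)⁻¹
dr = log (1 + b)`. The even and odd parts recombine because `A` is even. -/
theorem logKernel_form_le {b : ℝ} (hb : 0 < b) {η : ℝ × ℝ → ℝ} (hη : BddSuppL2 η)
    (hi : Integrable (fun p : (ℝ × ℝ) × (ℝ × ℝ) => logKernel b p.1 p.2 * (η p.1 * η p.2))
      (volume.prod volume)) :
    ∫ p : (ℝ × ℝ) × (ℝ × ℝ), logKernel b p.1 p.2 * (η p.1 * η p.2) ∂(volume.prod volume) ≤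
      7 / 8 * (∫ X, A (rad X) * η X ^ 2) + 18 * Real.log (1 + b) * (∫ X, η X) ^ 2 +
      ((∫ X : ℝ × ℝ, X.1 * η X) ^ 2 + (∫ X : ℝ × ℝ, X.2 * η X) ^ 2) := by
  have heven : BddSuppL2 (evenPart η) := hη.half_add
  have hodd : BddSuppL2 (oddPart η) := hη.half_sub
  have hg : ∀ c ≤ (1 : ℝ) / 4, ∀ X, gauss (-c) X ≤ gauss (-(1 / 4)) X := by
    intro c hc X
    have h2 : 0 ≤ X.1 ^ 2 + X.2 ^ 2 := by positivity
    apply Real.exp_le_exp.2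
    nlinarith
  obtain ⟨hL1, hL2⟩ := integral_logKernel_eq hb hη.memLp.1 hi
  obtain ⟨a1, a2, a3⟩ := integral_superposition heven
    (ω := fun r X => r * gauss (-((1 - r) / 4)) X + 7 / 20 * gauss (-(1 / 6)) X)
    (by unfold gauss; fun_prop) (fun r hr X => by
      have h0 := gauss_pos (-((1 - r) / 4)) X
      have h1 := hg ((1 - r) / 4) (by linarith [hr.1]) X
      have h2 := hg (1 / 6) (by norm_num) X
      have h3 := gauss_pos (-(1 / 6)) X
      have h4 := hr.1
      have h5 := hr.2
      rw [abs_of_pos (by positivity)]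
      nlinarith)
  obtain ⟨b1, b2, b3⟩ := integral_superposition hodd
    (ω := fun r X => (1 - (1 - r) ^ 3 / 2) * gauss (-((1 - r) / 4)) X)
    (by unfold gauss; fun_prop) (fun r hr X => by
      have h0 := gauss_pos (-((1 - r) / 4)) X
      have h1 := hg ((1 - r) / 4) (by linarith [hr.1]) X
      have h4 : 0 ≤ 1 - r := by linarith [hr.2]
      have h5 : (1 - r) ^ 3 ≤ 1 := pow_le_one₀ h4 (by linarith [hr.1])
      have h6 : 0 ≤ (1 - r) ^ 3 := by positivity
      rw [abs_of_nonneg (mul_nonneg (by linarith) h0.le)]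
      nlinarith)
  obtain ⟨c1, c2⟩ := integral_inv_add_const hb
  have hconst : IntegrableOn (fun _ : ℝ => (∫ X : ℝ × ℝ, X.1 * η X) ^ 2 + (∫ X : ℝ × ℝ, X.2 * η X) ^ 2)
      (Set.Ioo (0 : ℝ) 1) := integrableOn_const (by simp) (by simp)
  have c1' := (c1.const_mul 18).mul_const ((∫ X, η X) ^ 2)
  have hmono := setIntegral_mono_on hL1 (((a1.fun_add b1).fun_add c1').fun_add hconst) measurableSet_Ioo
    (fun r hr => integral_mixKernel_form_le hb hr.1 hr.2 hη)
  rw [integral_add ((a1.fun_add b1).fun_add c1') hconst, integral_add (a1.fun_add b1) c1', integral_add a1 b1,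
    a3, b3, integral_mul_const, integral_const_mul, c2] at hmono
  have d1 : ∫ X, (∫ r in Set.Ioo (0 : ℝ) 1, (r * gauss (-((1 - r) / 4)) X + 7 / 20 * gauss (-(1 / 6)) X)) *
      evenPart η X ^ 2 ≤ ∫ X, 7 / 8 * (A (rad X) * evenPart η X ^ 2) := by
    apply integral_mono a2 ((integrable_A_mul_sq heven).const_mul _)
    intro X
    simp only [← mul_assoc]
    exact mul_le_mul_of_nonneg_right (integral_evenWeight_le X) (sq_nonneg _)
  have d2 : ∫ X, (∫ r in Set.Ioo (0 : ℝ) 1, (1 - (1 - r) ^ 3 / 2) * gauss (-((1 - r) / 4)) X) *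
      oddPart η X ^ 2 ≤ ∫ X, 7 / 8 * (A (rad X) * oddPart η X ^ 2) := by
    apply integral_mono b2 ((integrable_A_mul_sq hodd).const_mul _)
    intro X
    simp only [← mul_assoc]
    exact mul_le_mul_of_nonneg_right (integral_oddWeight_le X) (sq_nonneg _)
  rw [integral_const_mul] at d1 d2
  have hA : Continuous fun X => A (rad X) := by
    simp only [A_rad_eq]
    apply intervalIntegral.continuous_parametric_intervalIntegral_of_continuous' (by fun_prop)
  have hpar := integral_mul_sq_parity hη hA (fun X => by simp [rad])
  rw [hL2, hpar]
  simp only [setIntegral_const, smul_eq_mul] at hmono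
  norm_num at hmono
  linarith

/-! ### Measurability and weakly singular integral bounds. -/

theorem norm_le_rad (X : ℝ × ℝ) : ‖X‖ ≤ rad X := by
  rw [Prod.norm_def, Real.norm_eq_abs, Real.norm_eq_abs]
  exact max_le (abs_fst_le_rad X) (abs_snd_le_rad X)

theorem measurable_rad : Measurable rad := by unfold rad; fun_prop

theorem measurableSet_Om (ε : ℝ) : MeasurableSet (Om ε) :=
  measurableSet_lt measurable_const (by fun_prop)

theorem measurable_sqDist : Measurable fun p : (ℝ × ℝ) × (ℝ × ℝ) => sqDist p.1 p.2 := by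
  unfold sqDist; fun_prop

theorem measurable_singKernel : Measurable fun p : (ℝ × ℝ) × (ℝ × ℝ) => singKernel p.1 p.2 := by
  unfold singKernel
  have := measurable_sqDist
  fun_prop

theorem measurable_logKernel (b : ℝ) :
    Measurable fun p : (ℝ × ℝ) × (ℝ × ℝ) => logKernel b p.1 p.2 := by
  unfold logKernel
  have := measurable_sqDist
  fun_prop

theorem measurable_F : Measurable F := by
  unfold F
  simp only [intervalIntegral.integral_of_le (show (0 : ℝ) ≤ Real.pi / 2 by positivity)]
  refine (StronglyMeasurable.integral_prod_right (f := fun s ψ =>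
    (1 - 2 * Real.sin ψ ^ 2) / Real.sqrt (Real.sin ψ ^ 2 + s / 4)) ?_).measurable
  apply Measurable.stronglyMeasurable
  simp only [Function.uncurry_def]
  fun_prop

theorem measurable_kernel (ε : ℝ) :
    Measurable fun p : (ℝ × ℝ) × (ℝ × ℝ) => kernel ε p.1 p.2 := by
  unfold kernel
  have := measurable_F
  fun_prop

/-- The truncated singular power `|Z|^{-2p}` near the origin. -/
noncomputable def sing (p : ℝ) : ℝ × ℝ → ℝ :=
  (Metric.ball (0 : ℝ × ℝ) 1).indicator fun Z => (Z.1 ^ 2 + Z.2 ^ 2) ^ (-p)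

theorem sing_nonneg (p : ℝ) (Z : ℝ × ℝ) : 0 ≤ sing p Z :=
  Set.indicator_nonneg (fun _ _ => by positivity) _

theorem sing_neg (p : ℝ) (Z : ℝ × ℝ) : sing p (-Z) = sing p Z := by
  simp [sing, Set.indicator]

theorem norm_sq_le (Z : ℝ × ℝ) : ‖Z‖ ^ 2 ≤ Z.1 ^ 2 + Z.2 ^ 2 := by
  rw [← rad_sq]
  gcongr
  exact norm_le_rad Z

theorem integrable_sing {p : ℝ} (hp : 0 ≤ p) (hp2 : p ≤ 1 / 2) : Integrable (sing p) := by
  rw [sing, integrable_indicator_iff Metric.isOpen_ball.measurableSet]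
  have h : IntegrableOn (fun Z : ℝ × ℝ => (‖Z‖ ^ 2) ^ (-p)) (Metric.ball 0 1) := by
    rw [integrableOn_fun_norm_addHaar volume (f := fun t : ℝ => (t ^ 2) ^ (-p))]
    have hc : IntegrableOn (fun _ : ℝ => (1 : ℝ)) (Set.Ioo 0 1) := by simp
    refine Integrable.mono' hc (Measurable.aestronglyMeasurable (by fun_prop)) ?_
    refine (ae_restrict_iff' measurableSet_Ioo).2 (.of_forall fun y hy => ?_)
    have e : Module.finrank ℝ (ℝ × ℝ) - 1 = 1 := by simp
    rw [e, pow_one, smul_eq_mul, Real.norm_of_nonneg (mul_nonneg hy.1.le (by positivity))]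
    calc y * (y ^ 2) ^ (-p) ≤ y * (y ^ 2) ^ (-(1 / 2) : ℝ) := by
          refine mul_le_mul_of_nonneg_left ?_ hy.1.le
          exact Real.rpow_le_rpow_of_exponent_ge (pow_pos hy.1 2)
            (pow_le_one₀ hy.1.le hy.2.le) (by linarith)
      _ = 1 := by
          rw [← Real.rpow_natCast, ← Real.rpow_mul hy.1.le]
          norm_num
          rw [Real.rpow_neg_one]
          exact mul_inv_cancel₀ hy.1.ne'
  refine Integrable.mono' h (Measurable.aestronglyMeasurable (by fun_prop))
    (.of_forall fun Z => ?_)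
  rw [Real.norm_of_nonneg (by positivity)]
  rcases eq_or_ne Z 0 with rfl | hZ
  · simp
  · exact Real.rpow_le_rpow_of_nonpos (pow_pos (norm_pos_iff.2 hZ) 2) (norm_sq_le Z) (by linarith)

theorem sqDist_rpow_le {p : ℝ} (hp : 0 ≤ p) (X Y : ℝ × ℝ) :
    sqDist X Y ^ (-p) ≤ 1 + sing p (X - Y) := by
  by_cases h : X - Y ∈ Metric.ball (0 : ℝ × ℝ) 1
  · rw [sing, Set.indicator_of_mem h]
    exact le_add_of_nonneg_left zero_le_one
  · have h1 : 1 ≤ ‖X - Y‖ := by simpa using h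
    have h2 : 1 ≤ sqDist X Y := (one_le_pow₀ h1).trans (norm_sq_le (X - Y))
    exact (Real.rpow_le_one_of_one_le_of_nonpos h2 (by linarith)).trans
      (le_add_of_nonneg_right (sing_nonneg _ _))

theorem integrable_one_add_rad_pow_inv : Integrable fun X : ℝ × ℝ => ((1 + rad X) ^ 4)⁻¹ := by
  have h := integrable_one_add_norm (E := ℝ × ℝ) (μ := volume) (r := 4) (by norm_num)
  have := measurable_rad
  refine h.mono' (by fun_prop) (.of_forall fun X => ?_)
  have h0 := rad_nonneg X
  rw [Real.norm_of_nonneg (by positivity), Real.rpow_neg (by positivity),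
    show (4 : ℝ) = (4 : ℕ) by norm_num, Real.rpow_natCast]
  gcongr
  exact norm_le_rad X

theorem singKernel_le (X Y : ℝ × ℝ) : singKernel X Y ≤ 2 + sing (1 / 8) (X - Y) := by
  have := sqDist_rpow_le (p := 1 / 8) (by norm_num) X Y
  rw [singKernel]; linarith

theorem singKernel_sq_le (X Y : ℝ × ℝ) :
    singKernel X Y ^ 2 ≤ 4 + 2 * sing (1 / 4) (X - Y) := by
  have h := sqDist_rpow_le (p := 1 / 4) (by norm_num) X Y
  have e : (sqDist X Y ^ (-(1 / 8) : ℝ)) ^ 2 = sqDist X Y ^ (-(1 / 4) : ℝ) := by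
    rw [← Real.rpow_natCast, ← Real.rpow_mul (sqDist_nonneg X Y)]; norm_num
  rw [singKernel]
  nlinarith [sq_nonneg (1 - sqDist X Y ^ (-(1 / 8) : ℝ))]

/-- A Schur-type bound: the kernel is split into a bounded part and an integrable convolution part.
The four extra powers of the weight pay for integrating `(1+ρ)⁻⁴` over the plane, so the constant is
independent of `N`. -/
theorem exists_singular_form_le : ∃ C : ℝ, 0 ≤ C ∧ ∀ (N : ℕ) (u : ℝ × ℝ → ℝ),
    AEStronglyMeasurable u volume →
    Integrable (fun X => (1 + rad X) ^ (2 * N + 4) * u X ^ 2) →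
    Integrable (fun p : (ℝ × ℝ) × (ℝ × ℝ) =>
      ((1 + rad p.1) ^ N * (1 + rad p.2) ^ N * singKernel p.1 p.2) * (|u p.1| * |u p.2|))
      (volume.prod volume) ∧
    ∫ p : (ℝ × ℝ) × (ℝ × ℝ),
      ((1 + rad p.1) ^ N * (1 + rad p.2) ^ N * singKernel p.1 p.2) * (|u p.1| * |u p.2|)
      ∂(volume.prod volume) ≤ C * ∫ X, (1 + rad X) ^ (2 * N + 4) * u X ^ 2 := by
  set s := sing (1 / 8) with hs
  set Q : ℝ × ℝ → ℝ := fun X => ((1 + rad X) ^ 4)⁻¹ with hQ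
  have hsi : Integrable s := integrable_sing (by norm_num) (by norm_num)
  have hQi : Integrable Q := integrable_one_add_rad_pow_inv
  have hs0 : ∀ Z, 0 ≤ s Z := sing_nonneg _
  have hQ0 : ∀ X, 0 ≤ Q X := fun X => by have := rad_nonneg X; positivity
  refine ⟨2 * (∫ X, Q X) + ∫ Z, s Z,
    add_nonneg (mul_nonneg zero_le_two (integral_nonneg hQ0)) (integral_nonneg hs0), ?_⟩
  intro N u hu hV
  set V : ℝ × ℝ → ℝ := fun X => (1 + rad X) ^ (2 * N + 4) * u X ^ 2 with hVdef
  have i1 : Integrable (fun p : (ℝ × ℝ) × (ℝ × ℝ) => V p.1 * Q p.2) (volume.prod volume) :=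
    hV.mul_prod hQi
  have i2 : Integrable (fun p : (ℝ × ℝ) × (ℝ × ℝ) => Q p.1 * V p.2) (volume.prod volume) :=
    hQi.mul_prod hV
  have i3 : Integrable (fun p : (ℝ × ℝ) × (ℝ × ℝ) => V p.2 * s (p.1 - p.2))
      (volume.prod volume) := hV.convolution_integrand (ContinuousLinearMap.mul ℝ ℝ) hsi
  have i4 : Integrable (fun p : (ℝ × ℝ) × (ℝ × ℝ) => V p.1 * s (p.1 - p.2))
      (volume.prod volume) := by
    refine i3.swap.congr (.of_forall fun p => ?_)
    simp only [Function.comp, Prod.fst_swap, Prod.snd_swap]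
    rw [← neg_sub, hs, sing_neg]
  have v1 : ∫ p : (ℝ × ℝ) × (ℝ × ℝ), V p.1 * Q p.2 ∂(volume.prod volume) =
      (∫ X, V X) * ∫ X, Q X := integral_prod_mul V Q
  have v2 : ∫ p : (ℝ × ℝ) × (ℝ × ℝ), Q p.1 * V p.2 ∂(volume.prod volume) =
      (∫ X, Q X) * ∫ X, V X := integral_prod_mul Q V
  have v3 : ∫ p : (ℝ × ℝ) × (ℝ × ℝ), V p.2 * s (p.1 - p.2) ∂(volume.prod volume) =
      (∫ X, V X) * ∫ Z, s Z := by
    rw [integral_prod_symm _ i3, ← integral_mul_const]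
    congr 1; ext Y
    change ∫ X, V Y * s (X - Y) = _
    rw [integral_const_mul, integral_sub_right_eq_self s Y]
  have v4 : ∫ p : (ℝ × ℝ) × (ℝ × ℝ), V p.1 * s (p.1 - p.2) ∂(volume.prod volume) =
      (∫ X, V X) * ∫ Z, s Z := by
    rw [integral_prod _ i4, ← integral_mul_const]
    congr 1; ext X
    change ∫ Y, V X * s (X - Y) = _
    rw [integral_const_mul, integral_sub_left_eq_self s volume X]
  have i12 : Integrable (fun p : (ℝ × ℝ) × (ℝ × ℝ) => V p.1 * Q p.2 + Q p.1 * V p.2)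
      (volume.prod volume) := i1.fun_add i2
  have i34 : Integrable (fun p : (ℝ × ℝ) × (ℝ × ℝ) =>
      V p.2 * s (p.1 - p.2) + V p.1 * s (p.1 - p.2)) (volume.prod volume) := i3.fun_add i4
  have iG : Integrable (fun p : (ℝ × ℝ) × (ℝ × ℝ) => (V p.1 * Q p.2 + Q p.1 * V p.2) +
      1 / 2 * (V p.2 * s (p.1 - p.2) + V p.1 * s (p.1 - p.2))) (volume.prod volume) :=
    i12.fun_add (i34.const_mul _)
  have hle : ∀ p : (ℝ × ℝ) × (ℝ × ℝ),
      ((1 + rad p.1) ^ N * (1 + rad p.2) ^ N * singKernel p.1 p.2) * (|u p.1| * |u p.2|) ≤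
      (V p.1 * Q p.2 + Q p.1 * V p.2) +
        1 / 2 * (V p.2 * s (p.1 - p.2) + V p.1 * s (p.1 - p.2)) := by
    intro p
    have hk := singKernel_le p.1 p.2
    have hk1 := one_le_singKernel p.1 p.2
    have h1 : 1 ≤ 1 + rad p.1 := by have := rad_nonneg p.1; linarith
    have h2 : 1 ≤ 1 + rad p.2 := by have := rad_nonneg p.2; linarith
    have e1 : V p.1 = ((1 + rad p.1) ^ (N + 2) * |u p.1|) ^ 2 := by
      simp only [hVdef]; rw [mul_pow, sq_abs]; ring
    have e2 : V p.2 = ((1 + rad p.2) ^ (N + 2) * |u p.2|) ^ 2 := by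
      simp only [hVdef]; rw [mul_pow, sq_abs]; ring
    have q1 : Q p.1 = (((1 + rad p.1) ^ 2)⁻¹) ^ 2 := by simp only [hQ]; rw [inv_pow]; ring
    have q2 : Q p.2 = (((1 + rad p.2) ^ 2)⁻¹) ^ 2 := by simp only [hQ]; rw [inv_pow]; ring
    have q1' : Q p.1 ≤ 1 := inv_le_one_of_one_le₀ (one_le_pow₀ h1)
    have q2' : Q p.2 ≤ 1 := inv_le_one_of_one_le₀ (one_le_pow₀ h2)
    have V1 : 0 ≤ V p.1 := by rw [e1]; positivity
    have V2 : 0 ≤ V p.2 := by rw [e2]; positivity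
    -- Each factor `(1+ρ)²` attached to one variable is balanced by its inverse in that same
    -- variable before the arithmetic-geometric mean inequality.
    have key : (1 + rad p.1) ^ N * (1 + rad p.2) ^ N * (|u p.1| * |u p.2|) ≤
        1 / 2 * (V p.1 * Q p.2 + Q p.1 * V p.2) := by
      have := two_mul_le_add_sq (((1 + rad p.1) ^ (N + 2) * |u p.1|) * ((1 + rad p.2) ^ 2)⁻¹)
        (((1 + rad p.2) ^ (N + 2) * |u p.2|) * ((1 + rad p.1) ^ 2)⁻¹)
      rw [mul_pow, mul_pow _ (((1 + rad p.1) ^ 2)⁻¹), ← e1, ← e2, ← q1, ← q2] at this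
      have e : ((1 + rad p.1) ^ (N + 2) * |u p.1|) * ((1 + rad p.2) ^ 2)⁻¹ *
        (((1 + rad p.2) ^ (N + 2) * |u p.2|) * ((1 + rad p.1) ^ 2)⁻¹) =
        (1 + rad p.1) ^ N * (1 + rad p.2) ^ N * (|u p.1| * |u p.2|) := by
        field_simp
        ring
      linarith [e]
    calc _ = ((1 + rad p.1) ^ N * (1 + rad p.2) ^ N * (|u p.1| * |u p.2|)) *
          singKernel p.1 p.2 := by ring
      _ ≤ (1 / 2 * (V p.1 * Q p.2 + Q p.1 * V p.2)) * (2 + s (p.1 - p.2)) :=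
          mul_le_mul key hk (by linarith) (by
            have := hQ0 p.1; have := hQ0 p.2; positivity)
      _ ≤ _ := by
          have a1 := mul_nonneg (mul_nonneg V1 (hs0 (p.1 - p.2))) (sub_nonneg.2 q2')
          have a2 := mul_nonneg (mul_nonneg V2 (hs0 (p.1 - p.2))) (sub_nonneg.2 q1')
          nlinarith
  have hi : Integrable (fun p : (ℝ × ℝ) × (ℝ × ℝ) =>
      ((1 + rad p.1) ^ N * (1 + rad p.2) ^ N * singKernel p.1 p.2) * (|u p.1| * |u p.2|))
      (volume.prod volume) := by
    refine iG.mono' ?_ (.of_forall fun p => ?_)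
    · have m1 := measurable_rad
      have m2 := measurable_singKernel
      have m3 : AEStronglyMeasurable (fun p : (ℝ × ℝ) × (ℝ × ℝ) => |u p.1| * |u p.2|)
          (volume.prod volume) := (hu.norm.comp_fst).mul (hu.norm.comp_snd)
      exact (Measurable.aestronglyMeasurable (by fun_prop)).mul m3
    · have := one_le_singKernel p.1 p.2
      have := rad_nonneg p.1
      have := rad_nonneg p.2
      rw [Real.norm_of_nonneg (by positivity)]
      exact hle p
  refine ⟨hi, (integral_mono hi iG hle).trans (le_of_eq ?_)⟩
  rw [integral_add i12 (i34.const_mul _), integral_const_mul, integral_add i1 i2,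
    integral_add i3 i4, v1, v2, v3, v4]
  ring

theorem exists_moment_le : ∃ C : ℝ, 0 ≤ C ∧ ∀ (N : ℕ) (u : ℝ × ℝ → ℝ),
    AEStronglyMeasurable u volume →
    Integrable (fun X => (1 + rad X) ^ (2 * N + 4) * u X ^ 2) →
    Integrable (fun X => (1 + rad X) ^ N * |u X|) ∧
    (∫ X, (1 + rad X) ^ N * |u X|) ^ 2 ≤ C * ∫ X, (1 + rad X) ^ (2 * N + 4) * u X ^ 2 := by
  have m1 := measurable_rad
  have h0 : ∀ X, 0 < 1 + rad X := fun X => by have := rad_nonneg X; positivity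
  refine ⟨∫ X, ((1 + rad X) ^ 4)⁻¹, integral_nonneg fun X => by have := h0 X; positivity, ?_⟩
  intro N u hu hV
  have eq1 : ∀ X, ((1 + rad X) ^ (N + 2) * |u X|) ^ 2 = (1 + rad X) ^ (2 * N + 4) * u X ^ 2 := by
    intro X; rw [mul_pow, sq_abs]; ring
  have eq2 : ∀ X, (((1 + rad X) ^ 2)⁻¹) ^ 2 = ((1 + rad X) ^ 4)⁻¹ := by
    intro X; rw [inv_pow]; ring
  have eq3 : ∀ X, ((1 + rad X) ^ (N + 2) * |u X|) * ((1 + rad X) ^ 2)⁻¹ =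
      (1 + rad X) ^ N * |u X| := by
    intro X; have := h0 X; field_simp; ring
  have hf : MemLp (fun X => (1 + rad X) ^ (N + 2) * |u X|) 2 := by
    have hm : AEStronglyMeasurable (fun X => (1 + rad X) ^ (N + 2) * |u X|) volume :=
      (Measurable.aestronglyMeasurable (by fun_prop)).mul hu.norm
    rw [memLp_two_iff_integrable_sq hm]
    simpa only [eq1] using hV
  have hh : MemLp (fun X => ((1 + rad X) ^ 2)⁻¹) 2 := by
    rw [memLp_two_iff_integrable_sq (Measurable.aestronglyMeasurable (by fun_prop))]
    simpa only [eq2] using integrable_one_add_rad_pow_inv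
  constructor
  · have := hf.integrable_mul hh
    exact this.congr (.of_forall eq3)
  · have := sq_integral_mul_le hf hh
    simp only [eq1, eq2, eq3] at this
    rwa [mul_comm] at this

/-- Used for the convergence of the stream function at every point. It requires square integrability
of the singularity, hence the exponent `1/4` in `sing`. -/
theorem integrable_singKernel_mul (N : ℕ) {u : ℝ × ℝ → ℝ} (hu : AEStronglyMeasurable u volume)
    (hV : Integrable (fun X => (1 + rad X) ^ (2 * N + 4) * u X ^ 2)) (X : ℝ × ℝ) :
    Integrable fun Y => (1 + rad Y) ^ N * singKernel X Y * |u Y| := by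
  have hs0 : Integrable (sing (1 / 4)) := integrable_sing (by norm_num) (by norm_num)
  have hs : Integrable fun Y => sing (1 / 4) (X - Y) := hs0.comp_sub_left X
  have hG : Integrable fun Y => ((1 + rad Y) ^ (2 * N + 4) * u Y ^ 2 +
      4 * ((1 + rad Y) ^ 4)⁻¹) + 2 * sing (1 / 4) (X - Y) := by
    have h1 := integrable_one_add_rad_pow_inv.const_mul (4 : ℝ)
    have h2 := hs.const_mul (2 : ℝ)
    have h3 := hV.fun_add h1
    exact h3.fun_add h2
  have m1 := measurable_rad
  have m2 : Measurable fun Y => singKernel X Y := by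
    unfold singKernel sqDist; fun_prop
  have hm : AEStronglyMeasurable (fun Y => (1 + rad Y) ^ N * singKernel X Y * |u Y|) volume :=
    (Measurable.aestronglyMeasurable (by fun_prop)).mul hu.norm
  refine hG.mono' hm (.of_forall fun Y => ?_)
  have h1 := one_le_singKernel X Y
  have h2 := singKernel_sq_le X Y
  have h3 : 1 ≤ 1 + rad Y := by have := rad_nonneg Y; linarith
  have h4 : ((1 + rad Y) ^ 4)⁻¹ ≤ 1 := inv_le_one_of_one_le₀ (one_le_pow₀ h3)
  have h5 : (0 : ℝ) ≤ ((1 + rad Y) ^ 4)⁻¹ := by positivity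
  rw [Real.norm_of_nonneg (by positivity)]
  have key := two_mul_le_add_sq ((1 + rad Y) ^ (N + 2) * |u Y|)
    (((1 + rad Y) ^ 2)⁻¹ * singKernel X Y)
  have e1 : ((1 + rad Y) ^ (N + 2) * |u Y|) ^ 2 = (1 + rad Y) ^ (2 * N + 4) * u Y ^ 2 := by
    rw [mul_pow, sq_abs]; ring
  have e2 : (((1 + rad Y) ^ 2)⁻¹ * singKernel X Y) ^ 2 =
      ((1 + rad Y) ^ 4)⁻¹ * singKernel X Y ^ 2 := by
    rw [mul_pow, inv_pow]; ring
  have e3 : 2 * ((1 + rad Y) ^ (N + 2) * |u Y|) * (((1 + rad Y) ^ 2)⁻¹ * singKernel X Y) =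
      2 * ((1 + rad Y) ^ N * singKernel X Y * |u Y|) := by
    field_simp
    ring
  have h6 : (0 : ℝ) ≤ (1 + rad Y) ^ N * singKernel X Y * |u Y| := by positivity
  have h7 := sing_nonneg (1 / 4) (X - Y)
  rw [e1, e2, e3] at key
  have h8 : ((1 + rad Y) ^ 4)⁻¹ * singKernel X Y ^ 2 ≤
      4 * ((1 + rad Y) ^ 4)⁻¹ + 2 * sing (1 / 4) (X - Y) := by
    nlinarith [mul_le_mul_of_nonneg_left h2 h5, mul_le_mul_of_nonneg_right h4 h7]
  linarith

theorem logKernel_nonneg {b : ℝ} (hb : 0 < b) (X Y : ℝ × ℝ) : 0 ≤ logKernel b X Y := by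
  have h : 0 ≤ b / sqDist X Y := div_nonneg hb.le (sqDist_nonneg X Y)
  exact mul_nonneg (by positivity) (Real.log_nonneg (by linarith))

theorem logKernel_le_singKernel {ε : ℝ} (hε : 0 < ε) (hε1 : ε ≤ 1) {X Y : ℝ × ℝ} (h : X ≠ Y) :
    logKernel (ε ^ (-2 : ℤ)) X Y ≤ 8 * ε ^ (-(1 / 4) : ℝ) * singKernel X Y := by
  have hd := sqDist_pos h
  have h1 := log_one_add_inv_le hε hε1 hd
  have e : ε ^ (-2 : ℤ) / sqDist X Y = 1 / (ε ^ 2 * sqDist X Y) := by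
    rw [zpow_neg, zpow_ofNat]; field_simp
  have h2 : 0 ≤ Real.log (1 + 1 / (ε ^ 2 * sqDist X Y)) := by
    have : 0 < 1 / (ε ^ 2 * sqDist X Y) := by positivity
    exact Real.log_nonneg (by linarith)
  have h3 : 1 / (4 * Real.pi) ≤ 1 := by
    rw [div_le_one (by positivity)]; linarith [Real.pi_gt_three]
  rw [logKernel, e, singKernel]
  exact (mul_le_of_le_one_left h2 h3).trans h1

theorem log_one_add_zpow_le {ε : ℝ} (hε : 0 < ε) (hε2 : ε ≤ 1 / 2) :
    Real.log (1 + ε ^ (-2 : ℤ)) ≤ 3 * Real.log (1 / ε) := by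
  have e : 3 * Real.log (1 / ε) = Real.log ((1 / ε) ^ 3) := by rw [Real.log_pow]; norm_num
  rw [e]
  apply Real.log_le_log (by positivity)
  rw [zpow_neg, zpow_ofNat, one_div, inv_pow]
  have : 1 + (ε ^ 2)⁻¹ = (ε ^ 3 + ε) * (ε ^ 3)⁻¹ := by field_simp
  rw [this]
  refine mul_le_of_le_one_left (by positivity) ?_
  nlinarith [mul_pos hε hε]

theorem sq_mul_log_le {ε : ℝ} (hε : 0 < ε) (hε1 : ε ≤ 1) : ε ^ 2 * Real.log (1 / ε) ≤ √ε := by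
  have h1 : Real.log (1 / ε) ≤ 1 / ε := (Real.log_le_sub_one_of_pos (by positivity)).trans (by linarith)
  have h2 : ε ≤ √ε := Real.le_sqrt_of_sq_le (by nlinarith)
  calc ε ^ 2 * Real.log (1 / ε) ≤ ε ^ 2 * (1 / ε) := by gcongr
    _ = ε := by field_simp
    _ ≤ _ := h2

theorem sq_le_of_abs_sub_le {a b d : ℝ} (h : |a - b| ≤ d) : a ^ 2 ≤ 2 * b ^ 2 + 2 * d ^ 2 := by
  have h1 : (a - b) ^ 2 ≤ d ^ 2 := sq_le_sq.2 (h.trans (le_abs_self d))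
  nlinarith [sq_nonneg (a - 2 * b)]

/-! ### Truncation to a disc and the kinetic form. -/

/-- The disc `(1 + ρ)^n ≤ ε⁻¹`. -/
def disc (n : ℕ) (ε : ℝ) : Set (ℝ × ℝ) := {X | (1 + rad X) ^ n ≤ 1 / ε}

theorem measurableSet_disc (n : ℕ) (ε : ℝ) : MeasurableSet (disc n ε) := by
  have := measurable_rad
  exact measurableSet_le (by fun_prop) measurable_const

theorem one_le_of_notMem_disc {n : ℕ} {ε : ℝ} (hε : 0 < ε) {X : ℝ × ℝ} (h : X ∉ disc n ε) :
    1 ≤ ε * (1 + rad X) ^ n := by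
  have h1 : 1 / ε < (1 + rad X) ^ n := not_le.1 h
  rw [div_lt_iff₀ hε] at h1
  linarith

theorem bddSuppL2_indicator_disc {n : ℕ} (hn : n ≠ 0) {ε : ℝ} {u : ℝ × ℝ → ℝ}
    (hu : MemLp u 2) : BddSuppL2 ((disc n ε).indicator u) where
  memLp := hu.indicator (measurableSet_disc n ε)
  supp := by
    refine ⟨1 / ε, fun X hX => Set.indicator_of_notMem (fun h => ?_) u⟩
    have h1 : (1 + rad X) ^ n ≤ 1 / ε := h
    have h0 := rad_nonneg X
    have h2 : 1 + rad X ≤ (1 + rad X) ^ n := le_self_pow₀ (by linarith) hn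
    have := norm_le_rad X
    linarith

/-- The part of the kinetic form that is not carried by the logarithmic kernel on the disc. -/
theorem exists_remainder_bound (n : ℕ) : ∃ c₀ C : ℝ, 0 ≤ C ∧ ∀ ε : ℝ, 0 < ε → ε ≤ 1 →
    ∀ u : ℝ × ℝ → ℝ, (∀ X ∉ Om ε, u X = 0) → ∀ X Y : ℝ × ℝ, X ≠ Y →
    |1 / (2 * Real.pi) * kernel ε X Y * (u X * u Y) -
      logKernel (ε ^ (-2 : ℤ)) X Y * ((disc n ε).indicator u X * (disc n ε).indicator u Y) -
      c₀ * (u X * u Y)| ≤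
    C * √ε * (((1 + rad X) ^ (n + 2) * (1 + rad Y) ^ (n + 2) * singKernel X Y) *
      (|u X| * |u Y|)) := by
  obtain ⟨c₀, C, hC, H⟩ := exists_kernel_asymptotic
  -- `C` is the error of the kernel expansion; `8` comes from discarding the logarithmic kernel off
  -- the disc.
  refine ⟨c₀, C + 8, by positivity, fun ε hε hε1 u hsupp X Y hXY => ?_⟩
  have hx : 1 ≤ 1 + rad X := by linarith [rad_nonneg X]
  have hy : 1 ≤ 1 + rad Y := by linarith [rad_nonneg Y]
  have hk := one_le_singKernel X Y
  by_cases hX : X ∈ Om ε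
  swap
  · simp only [Set.indicator, hsupp X hX]
    simp
  by_cases hY : Y ∈ Om ε
  swap
  · simp only [Set.indicator, hsupp Y hY]
    simp
  have h1 := H ε hε hε1 X hX Y hY hXY
  have hs : 0 ≤ √ε := Real.sqrt_nonneg ε
  have h2 : (1 + rad X) ^ 2 * (1 + rad Y) ^ 2 * singKernel X Y ≤
      (1 + rad X) ^ (n + 2) * (1 + rad Y) ^ (n + 2) * singKernel X Y := by
    gcongr <;> first | assumption | omega
  set K := (1 + rad X) ^ (n + 2) * (1 + rad Y) ^ (n + 2) * singKernel X Y with hK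
  set l := logKernel (ε ^ (-2 : ℤ)) X Y with hl
  have hl0 : 0 ≤ l := logKernel_nonneg (by positivity) X Y
  have h3 : |l * (u X * u Y) -
      l * ((disc n ε).indicator u X * (disc n ε).indicator u Y)| ≤
      8 * √ε * (K * (|u X| * |u Y|)) := by
    by_cases hB : X ∈ disc n ε ∧ Y ∈ disc n ε
    · rw [Set.indicator_of_mem hB.1, Set.indicator_of_mem hB.2, sub_self, abs_zero]
      positivity
    · have e0 : (disc n ε).indicator u X * (disc n ε).indicator u Y = 0 := by
        rcases not_and_or.1 hB with h | h
        · rw [Set.indicator_of_notMem h, zero_mul]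
        · rw [Set.indicator_of_notMem h, mul_zero]
      -- If either point is outside the disc, a factor `ε` can be bought with the weight `(1+ρ)^n`;
      -- it outweighs the `ε^{-1/4}` in the bound for the logarithm.
      have hbig : 1 ≤ ε * ((1 + rad X) ^ n * (1 + rad Y) ^ n) := by
        have ax := one_le_pow₀ (n := n) hx
        have ay := one_le_pow₀ (n := n) hy
        rcases not_and_or.1 hB with h | h
        · have := one_le_of_notMem_disc hε h
          calc 1 ≤ ε * (1 + rad X) ^ n := this
            _ ≤ ε * ((1 + rad X) ^ n * (1 + rad Y) ^ n) := by
              gcongr; exact le_mul_of_one_le_right (by positivity) ay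
        · have := one_le_of_notMem_disc hε h
          calc 1 ≤ ε * (1 + rad Y) ^ n := this
            _ ≤ ε * ((1 + rad X) ^ n * (1 + rad Y) ^ n) := by
              gcongr; exact le_mul_of_one_le_left (by positivity) ax
      have hpow : ε ^ (-(1 / 4) : ℝ) * ε ≤ √ε := by
        rw [Real.sqrt_eq_rpow]
        nth_rewrite 2 [← Real.rpow_one ε]
        rw [← Real.rpow_add hε]
        exact Real.rpow_le_rpow_of_exponent_ge hε hε1 (by norm_num)
      have hlk : l ≤ 8 * √ε * K := by
        calc l ≤ 8 * ε ^ (-(1 / 4) : ℝ) * singKernel X Y := logKernel_le_singKernel hε hε1 hXY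
          _ ≤ 8 * ε ^ (-(1 / 4) : ℝ) * singKernel X Y *
              (ε * ((1 + rad X) ^ n * (1 + rad Y) ^ n)) :=
            le_mul_of_one_le_right (by positivity) hbig
          _ = 8 * (ε ^ (-(1 / 4) : ℝ) * ε) *
              ((1 + rad X) ^ n * (1 + rad Y) ^ n * singKernel X Y) := by ring
          _ ≤ 8 * √ε * K := by
            rw [hK]
            gcongr <;> first | assumption | omega
      rw [e0, mul_zero, sub_zero, abs_mul, abs_mul, abs_of_nonneg hl0, ← mul_assoc (8 * √ε)]
      exact mul_le_mul_of_nonneg_right hlk (by positivity)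
  have h4 : |(1 / (2 * Real.pi) * kernel ε X Y - (l + c₀)) * (u X * u Y)| ≤
      C * √ε * (K * (|u X| * |u Y|)) := by
    rw [abs_mul, abs_mul (u X), ← mul_assoc (C * √ε)]
    refine mul_le_mul_of_nonneg_right (h1.trans ?_) (by positivity)
    gcongr
  calc _ = |(1 / (2 * Real.pi) * kernel ε X Y - (l + c₀)) * (u X * u Y) + (l * (u X * u Y) -
      l * ((disc n ε).indicator u X * (disc n ε).indicator u Y))| := by congr 1; ring
    _ ≤ _ := (abs_add_le _ _).trans (by linarith)

theorem abs_integral_sub_indicator_disc_le {n N : ℕ} {ε : ℝ} (hε : 0 < ε) {u f : ℝ × ℝ → ℝ}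
    (hf : Measurable f) (hfN : ∀ X, |f X| * (1 + rad X) ^ n ≤ (1 + rad X) ^ N)
    (hu : AEStronglyMeasurable u volume)
    (hi : Integrable fun X => (1 + rad X) ^ N * |u X|) :
    |(∫ X, f X * (disc n ε).indicator u X) - ∫ X, f X * u X| ≤
      ε * ∫ X, (1 + rad X) ^ N * |u X| := by
  have hm : ∀ X, |f X| ≤ (1 + rad X) ^ N := fun X => by
    have : 1 ≤ (1 + rad X) ^ n := one_le_pow₀ (by linarith [rad_nonneg X])
    exact (le_mul_of_one_le_right (abs_nonneg _) this).trans (hfN X)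
  have i1 : Integrable fun X => f X * u X := by
    refine hi.mono' (hf.aestronglyMeasurable.mul hu) (.of_forall fun X => ?_)
    rw [norm_mul]
    exact mul_le_mul_of_nonneg_right (hm X) (abs_nonneg _)
  have i2 : Integrable fun X => f X * (disc n ε).indicator u X := by
    have := i1.indicator (measurableSet_disc n ε)
    refine this.congr (.of_forall fun X => ?_)
    simp only [Set.indicator]; split_ifs <;> simp
  rw [← integral_sub i2 i1, ← integral_const_mul]
  rw [← Real.norm_eq_abs]
  refine norm_integral_le_of_norm_le (hi.const_mul ε) (.of_forall fun X => ?_)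
  rw [Real.norm_eq_abs, ← mul_sub, abs_mul]
  have h0 := rad_nonneg X
  by_cases hX : X ∈ disc n ε
  · rw [Set.indicator_of_mem hX, sub_self, abs_zero, mul_zero]
    positivity
  · rw [Set.indicator_of_notMem hX, zero_sub, abs_neg, ← mul_assoc]
    refine mul_le_mul_of_nonneg_right ?_ (abs_nonneg _)
    calc |f X| ≤ |f X| * (ε * (1 + rad X) ^ n) :=
          le_mul_of_one_le_right (abs_nonneg _) (one_le_of_notMem_disc hε hX)
      _ = ε * (|f X| * (1 + rad X) ^ n) := by ring
      _ ≤ _ := by gcongr; exact hfN X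

/-- The disc part obeys `logKernel_form_le`, the constant `c₀` contributes a multiple of the squared
mass, and the rest is a weakly singular form of size `√ε`. In the weight exponent, `n` pays for
leaving the disc, `2` for the kernel expansion and `4` for integrability. -/
theorem exists_kinetic_form_le {n : ℕ} (hn : n ≠ 0) : ∃ C : ℝ, 0 ≤ C ∧ ∀ ε : ℝ, 0 < ε → ε ≤ 1 / 2 →
    ∀ u : ℝ × ℝ → ℝ, (∀ X ∉ Om ε, u X = 0) → MemLp u 2 →
    Integrable (fun X => (1 + rad X) ^ (2 * (n + 2) + 4) * u X ^ 2) →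
    Integrable (fun p : (ℝ × ℝ) × (ℝ × ℝ) =>
      1 / (2 * Real.pi) * kernel ε p.1 p.2 * (u p.1 * u p.2)) (volume.prod volume) ∧
    ∫ p : (ℝ × ℝ) × (ℝ × ℝ), 1 / (2 * Real.pi) * kernel ε p.1 p.2 * (u p.1 * u p.2)
        ∂(volume.prod volume) ≤
      7 / 8 * (∫ X, A (rad X) * (disc n ε).indicator u X ^ 2) +
      C * (Real.log (1 / ε) * (∫ X, u X) ^ 2 + (∫ X, X.1 * u X) ^ 2 + (∫ X, X.2 * u X) ^ 2) +
      C * √ε * ∫ X, (1 + rad X) ^ (2 * (n + 2) + 4) * u X ^ 2 := by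
  obtain ⟨c₀, C, hC, hrem⟩ := exists_remainder_bound n
  obtain ⟨C0, hC0, hform⟩ := exists_singular_form_le
  obtain ⟨C1, hC1, hmom⟩ := exists_moment_le
  -- `108 = 18·3·2`, from `log (1 + ε⁻²) ≤ 3 log (1/ε)` and from replacing the truncated mass by the
  -- full one; `116 = 108 + 4 + 4` adds the truncation errors of the first moments.
  refine ⟨108 + 2 * |c₀| + 116 * C1 + C * C0, by positivity, fun ε hε hε2 u hsupp hu hD => ?_⟩
  have hε1 : ε ≤ 1 := by linarith
  have hum := hu.aestronglyMeasurable
  obtain ⟨iK, hK⟩ := hform (n + 2) u hum hD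
  obtain ⟨iM, hM⟩ := hmom (n + 2) u hum hD
  set D := ∫ X, (1 + rad X) ^ (2 * (n + 2) + 4) * u X ^ 2 with hDdef
  have hD0 : 0 ≤ D := integral_nonneg fun X => by have := rad_nonneg X; positivity
  set M := ∫ X, (1 + rad X) ^ (n + 2) * |u X| with hMdef
  set v := (disc n ε).indicator u with hv
  set b := ε ^ (-2 : ℤ) with hb
  have hb0 : 0 < b := by positivity
  have hvm : AEStronglyMeasurable v volume := hum.indicator (measurableSet_disc n ε)
  have hvu : ∀ X, |v X| ≤ |u X| := fun X => by
    rw [hv, Set.indicator]; split_ifs <;> simp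
  set L : (ℝ × ℝ) × (ℝ × ℝ) → ℝ := fun p => logKernel b p.1 p.2 * (v p.1 * v p.2) with hL
  set T : (ℝ × ℝ) × (ℝ × ℝ) → ℝ := fun p =>
    1 / (2 * Real.pi) * kernel ε p.1 p.2 * (u p.1 * u p.2) with hT
  set K : (ℝ × ℝ) × (ℝ × ℝ) → ℝ := fun p =>
    ((1 + rad p.1) ^ (n + 2) * (1 + rad p.2) ^ (n + 2) * singKernel p.1 p.2) *
      (|u p.1| * |u p.2|) with hKdef
  have mT : AEStronglyMeasurable T (volume.prod volume) := by
    have := measurable_kernel ε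
    have h1 : AEStronglyMeasurable (fun p : (ℝ × ℝ) × (ℝ × ℝ) => u p.1 * u p.2)
      (volume.prod volume) := hum.comp_fst.mul hum.comp_snd
    exact (Measurable.aestronglyMeasurable (by fun_prop)).mul h1
  have mL : AEStronglyMeasurable L (volume.prod volume) := by
    have h1 : AEStronglyMeasurable (fun p : (ℝ × ℝ) × (ℝ × ℝ) => v p.1 * v p.2)
      (volume.prod volume) := hvm.comp_fst.mul hvm.comp_snd
    exact (measurable_logKernel b).aestronglyMeasurable.mul h1
  have i1 : Integrable u := by
    refine iM.mono' hum (.of_forall fun X => ?_)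
    exact le_mul_of_one_le_left (abs_nonneg _) (one_le_pow₀ (by linarith [rad_nonneg X]))
  have iu : Integrable (fun p : (ℝ × ℝ) × (ℝ × ℝ) => u p.1 * u p.2) (volume.prod volume) :=
    i1.mul_prod i1
  have iL : Integrable L (volume.prod volume) := by
    refine (iK.const_mul (8 * ε ^ (-(1 / 4) : ℝ))).mono' mL ?_
    filter_upwards [ae_prod_ne] with p hp
    have h1 := logKernel_le_singKernel hε hε1 hp
    have h2 := logKernel_nonneg hb0 p.1 p.2
    have hx : 1 ≤ (1 + rad p.1) ^ (n + 2) := one_le_pow₀ (by linarith [rad_nonneg p.1])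
    have hy : 1 ≤ (1 + rad p.2) ^ (n + 2) := one_le_pow₀ (by linarith [rad_nonneg p.2])
    have hk := one_le_singKernel p.1 p.2
    rw [Real.norm_eq_abs, hL, abs_mul, abs_of_nonneg h2, abs_mul]
    calc logKernel b p.1 p.2 * (|v p.1| * |v p.2|)
        ≤ (8 * ε ^ (-(1 / 4) : ℝ) * singKernel p.1 p.2) * (|u p.1| * |u p.2|) := by
          refine mul_le_mul h1 ?_ (by positivity) (by positivity)
          exact mul_le_mul (hvu _) (hvu _) (abs_nonneg _) (abs_nonneg _)
      _ ≤ (8 * ε ^ (-(1 / 4) : ℝ) * (((1 + rad p.1) ^ (n + 2) * (1 + rad p.2) ^ (n + 2)) *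
            singKernel p.1 p.2)) * (|u p.1| * |u p.2|) := by
          gcongr
          exact le_mul_of_one_le_left (by positivity) (one_le_mul_of_one_le_of_one_le hx hy)
      _ = _ := by simp only [hKdef]; ring
  have hR : ∀ᵐ p : (ℝ × ℝ) × (ℝ × ℝ) ∂(volume.prod volume),
      ‖T p - L p - c₀ * (u p.1 * u p.2)‖ ≤ C * √ε * K p := by
    filter_upwards [ae_prod_ne] with p hp
    exact hrem ε hε hε1 u hsupp p.1 p.2 hp
  have iR : Integrable (fun p => T p - L p - c₀ * (u p.1 * u p.2)) (volume.prod volume) :=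
    (iK.const_mul (C * √ε)).mono' ((mT.sub mL).sub (iu.const_mul c₀).aestronglyMeasurable) hR
  have iLc : Integrable (fun p => L p + c₀ * (u p.1 * u p.2)) (volume.prod volume) :=
    iL.fun_add (iu.const_mul c₀)
  have eT : ∀ p, T p = (L p + c₀ * (u p.1 * u p.2)) + (T p - L p - c₀ * (u p.1 * u p.2)) :=
    fun p => by ring
  have iT : Integrable T (volume.prod volume) :=
    (iLc.fun_add iR).congr (.of_forall fun p => (eT p).symm)
  refine ⟨iT, ?_⟩
  have vT : ∫ p, T p ∂(volume.prod volume) = (∫ p, L p ∂(volume.prod volume)) +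
      c₀ * (∫ X, u X) ^ 2 +
      ∫ p, (T p - L p - c₀ * (u p.1 * u p.2)) ∂(volume.prod volume) := by
    have vu : ∫ p : (ℝ × ℝ) × (ℝ × ℝ), u p.1 * u p.2 ∂(volume.prod volume) =
      (∫ X, u X) * ∫ X, u X := integral_prod_mul u u
    rw [integral_congr_ae (.of_forall eT), integral_add iLc iR,
      integral_add iL (iu.const_mul c₀), integral_const_mul, vu]
    ring
  have bR : ∫ p, (T p - L p - c₀ * (u p.1 * u p.2)) ∂(volume.prod volume) ≤
      C * √ε * (C0 * D) := by
    refine (le_abs_self _).trans ?_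
    rw [← Real.norm_eq_abs]
    refine (norm_integral_le_of_norm_le (iK.const_mul (C * √ε)) hR).trans ?_
    rw [integral_const_mul]
    exact mul_le_mul_of_nonneg_left hK (by positivity)
  have bL := logKernel_form_le hb0 (bddSuppL2_indicator_disc hn (ε := ε) hu) iL
  rw [← hv] at bL
  have h1 : ∀ X : ℝ × ℝ, 1 ≤ 1 + rad X := fun X => by linarith [rad_nonneg X]
  have m0 := abs_integral_sub_indicator_disc_le (n := n) (N := n + 2) (f := fun _ => 1) hε
    measurable_const (fun X => by
      rw [abs_one, one_mul]; exact pow_le_pow_right₀ (h1 X) (by omega)) hum iM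
  have hlin : ∀ (t : ℝ) (X : ℝ × ℝ), |t| ≤ rad X →
      |t| * (1 + rad X) ^ n ≤ (1 + rad X) ^ (n + 2) := fun t X ht => by
    have hX := h1 X
    calc |t| * (1 + rad X) ^ n ≤ (1 + rad X) * (1 + rad X) ^ n := by gcongr; linarith
      _ = (1 + rad X) ^ (n + 1) := by ring
      _ ≤ _ := pow_le_pow_right₀ hX (by omega)
  have m1 := abs_integral_sub_indicator_disc_le (n := n) (N := n + 2) (f := fun X => X.1) hε
    measurable_fst (fun X => hlin _ X (abs_fst_le_rad X)) hum iM
  have m2 := abs_integral_sub_indicator_disc_le (n := n) (N := n + 2) (f := fun X => X.2) hε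
    measurable_snd (fun X => hlin _ X (abs_snd_le_rad X)) hum iM
  simp only [one_mul] at m0
  rw [← hv, ← hMdef] at m0 m1 m2
  replace m0 := sq_le_of_abs_sub_le m0
  replace m1 := sq_le_of_abs_sub_le m1
  replace m2 := sq_le_of_abs_sub_le m2
  set l := Real.log (1 / ε) with hl
  -- A lower bound on `log (1/ε)` lets the logarithmic term absorb `c₀ μ0²`.
  have hl2 : 1 / 2 ≤ l := by
    have h2 : Real.log 2 ≤ l := Real.log_le_log (by norm_num) (by
      rw [le_div_iff₀ hε]; linarith)
    linarith [Real.log_two_gt_d9]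
  have hlb : Real.log (1 + b) ≤ 3 * l := log_one_add_zpow_le hε hε2
  have hs : ε ^ 2 * l ≤ √ε := sq_mul_log_le hε hε1
  have hs0 : 0 ≤ √ε := Real.sqrt_nonneg ε
  have hs2 : ε ^ 2 ≤ 2 * √ε := by nlinarith [sq_nonneg ε]
  set μ0 := ∫ X, u X
  set μ1 := ∫ X, X.1 * u X
  set μ2 := ∫ X, X.2 * u X
  have q0 : (ε * M) ^ 2 ≤ ε ^ 2 * (C1 * D) := by rw [mul_pow]; gcongr
  have hCD : 0 ≤ C1 * D := by positivity
  have b0 : 18 * Real.log (1 + b) * (∫ X, v X) ^ 2 ≤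
      108 * (l * μ0 ^ 2) + 108 * √ε * (C1 * D) := by
    calc 18 * Real.log (1 + b) * (∫ X, v X) ^ 2
        ≤ 18 * (3 * l) * (2 * μ0 ^ 2 + 2 * (ε ^ 2 * (C1 * D))) := by
          gcongr; linarith
      _ = 108 * (l * μ0 ^ 2) + 108 * (ε ^ 2 * l) * (C1 * D) := by ring
      _ ≤ _ := by gcongr
  have b1 : ε ^ 2 * (C1 * D) ≤ 2 * √ε * (C1 * D) := by gcongr
  have bc : c₀ * μ0 ^ 2 ≤ 2 * |c₀| * (l * μ0 ^ 2) := by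
    calc c₀ * μ0 ^ 2 ≤ |c₀| * μ0 ^ 2 := by gcongr; exact le_abs_self _
      _ ≤ |c₀| * ((2 * l) * μ0 ^ 2) := by
        gcongr; exact le_mul_of_one_le_left (sq_nonneg _) (by linarith)
      _ = _ := by ring
  have hlμ : 0 ≤ l * μ0 ^ 2 := mul_nonneg (by linarith) (sq_nonneg _)
  have hCC : 0 ≤ C * C0 := by positivity
  have hcab := abs_nonneg c₀
  have p0 : (108 + 2 * |c₀|) * (l * μ0 ^ 2) ≤
      (108 + 2 * |c₀| + 116 * C1 + C * C0) * (l * μ0 ^ 2) :=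
    mul_le_mul_of_nonneg_right (by linarith) hlμ
  have p1 : 2 * (μ1 ^ 2 + μ2 ^ 2) ≤
      (108 + 2 * |c₀| + 116 * C1 + C * C0) * (μ1 ^ 2 + μ2 ^ 2) :=
    mul_le_mul_of_nonneg_right (by linarith) (by positivity)
  have p2 : (116 * C1 + C * C0) * (√ε * D) ≤
      (108 + 2 * |c₀| + 116 * C1 + C * C0) * (√ε * D) :=
    mul_le_mul_of_nonneg_right (by linarith) (by positivity)
  rw [vT]
  linarith

theorem exists_kernel_bound {ε : ℝ} (hε : 0 < ε) (hε1 : ε ≤ 1) : ∃ C : ℝ, 0 ≤ C ∧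
    ∀ X ∈ Om ε, ∀ Y ∈ Om ε, X ≠ Y →
      |1 / (2 * Real.pi) * kernel ε X Y| ≤
        C * ((1 + rad X) ^ 2 * (1 + rad Y) ^ 2 * singKernel X Y) := by
  obtain ⟨c₀, C, hC, H⟩ := exists_kernel_asymptotic
  refine ⟨8 * ε ^ (-(1 / 4) : ℝ) + |c₀| + C * √ε, by positivity, fun X hX Y hY hXY => ?_⟩
  have h1 := H ε hε hε1 X hX Y hY hXY
  have hx : 1 ≤ (1 + rad X) ^ 2 := one_le_pow₀ (by linarith [rad_nonneg X])
  have hy : 1 ≤ (1 + rad Y) ^ 2 := one_le_pow₀ (by linarith [rad_nonneg Y])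
  have hk := one_le_singKernel X Y
  set l := logKernel (ε ^ (-2 : ℤ)) X Y
  have hl0 : |l| ≤ 8 * ε ^ (-(1 / 4) : ℝ) * singKernel X Y := by
    rw [abs_of_nonneg (logKernel_nonneg (by positivity) X Y)]
    exact logKernel_le_singKernel hε hε1 hXY
  have hw := one_le_mul_of_one_le_of_one_le hx hy
  set w := (1 + rad X) ^ 2 * (1 + rad Y) ^ 2
  have h2 : singKernel X Y ≤ w * singKernel X Y := le_mul_of_one_le_left (by linarith) hw
  have h3 : 1 ≤ w * singKernel X Y := one_le_mul_of_one_le_of_one_le hw hk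
  have h4 : 8 * ε ^ (-(1 / 4) : ℝ) * singKernel X Y ≤
      8 * ε ^ (-(1 / 4) : ℝ) * (w * singKernel X Y) := by gcongr
  have h5 : |c₀| ≤ |c₀| * (w * singKernel X Y) := le_mul_of_one_le_right (abs_nonneg _) h3
  have h6 := abs_add_le (1 / (2 * Real.pi) * kernel ε X Y - (l + c₀)) (l + c₀)
  rw [sub_add_cancel] at h6
  have h7 := abs_add_le l c₀
  linarith

/-! ### The kinetic energy against the norm of the weighted space. -/

/-- Extend `η` by zero to the plane and apply the previous form bound: `15/16 = (7/8)(15/14)` on the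
disc, while the polynomially weighted norm is at most `normSq / c`. -/
theorem exists_kinetic_energy_le {n : ℕ} (hn : n ≠ 0) : ∃ C : ℝ, 0 ≤ C ∧
    ∀ ε : ℝ, 0 < ε → ε ≤ 1 / 2 → ∀ (W η : ℝ × ℝ → ℝ) (c : ℝ), 0 < c → MemX ε W η →
    (∀ X ∈ Om ε, c * (1 + rad X) ^ (2 * (n + 2) + 4) ≤ W X) →
    (∀ X ∈ Om ε, X ∈ disc n ε → A (rad X) ≤ 15 / 14 * W X) →
    IntegralsConverge ε η ∧
    2 * Ekin ε η ≤ (15 / 16 + C * √ε / c) * normSq ε W η +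
      C * (Real.log (1 / ε) * mu0 ε η ^ 2 + mu1 ε η ^ 2 + mu2 ε η ^ 2) := by
  obtain ⟨C, hC, H⟩ := exists_kinetic_form_le hn
  obtain ⟨C1, -, hmom⟩ := exists_moment_le
  refine ⟨C, hC, fun ε hε hε2 W η c hc hη hW hA => ?_⟩
  have hε1 : ε ≤ 1 := by linarith
  have hO := measurableSet_Om ε
  set u := (Om ε).indicator η with hu
  have hu2 : MemLp u 2 := (memLp_indicator_iff_restrict hO).2 hη.1
  have hum := hu2.aestronglyMeasurable
  have hsupp : ∀ X ∉ Om ε, u X = 0 := fun X hX => Set.indicator_of_notMem hX η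
  have hmul : ∀ f : ℝ × ℝ → ℝ, (fun X => f X * u X) = (Om ε).indicator fun X => f X * η X := by
    intro f; ext X; simp only [hu, Set.indicator]; split_ifs <;> simp
  have hW0 : ∀ X ∈ Om ε, 0 ≤ W X := fun X hX =>
    le_trans (by have := rad_nonneg X; positivity) (hW X hX)
  have hmrad := measurable_rad
  have eD : (fun X => (1 + rad X) ^ (2 * (n + 2) + 4) * u X ^ 2) =
      (Om ε).indicator fun X => (1 + rad X) ^ (2 * (n + 2) + 4) * η X ^ 2 := by
    ext X; simp only [hu, Set.indicator]; split_ifs <;> simp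
  have hbd : ∀ X ∈ Om ε, (1 + rad X) ^ (2 * (n + 2) + 4) * η X ^ 2 ≤ c⁻¹ * (W X * η X ^ 2) := by
    intro X hX
    rw [← mul_assoc]
    refine mul_le_mul_of_nonneg_right ?_ (sq_nonneg _)
    rw [le_inv_mul_iff₀ hc]
    exact hW X hX
  have iWη : IntegrableOn (fun X => c⁻¹ * (W X * η X ^ 2)) (Om ε) := hη.2.const_mul _
  have iDO : IntegrableOn (fun X => (1 + rad X) ^ (2 * (n + 2) + 4) * η X ^ 2) (Om ε) := by
    have hm : AEStronglyMeasurable (fun X => (1 + rad X) ^ (2 * (n + 2) + 4) * η X ^ 2)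
        (volume.restrict (Om ε)) :=
      (Measurable.aestronglyMeasurable (by fun_prop)).mul (hη.1.aestronglyMeasurable.pow 2)
    refine Integrable.mono' iWη hm ((ae_restrict_iff' hO).2 (.of_forall fun X hX => ?_))
    rw [Real.norm_of_nonneg (by have := rad_nonneg X; positivity)]
    exact hbd X hX
  have iD : Integrable fun X => (1 + rad X) ^ (2 * (n + 2) + 4) * u X ^ 2 := by
    rw [eD, integrable_indicator_iff hO]; exact iDO
  obtain ⟨iT, hT⟩ := H ε hε hε2 u hsupp hu2 iD
  obtain ⟨iM, -⟩ := hmom (n + 2) u hum iD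
  have h1 : ∀ X : ℝ × ℝ, 1 ≤ 1 + rad X := fun X => by linarith [rad_nonneg X]
  have ilin : ∀ f : ℝ × ℝ → ℝ, Measurable f → (∀ X, |f X| ≤ 1 + rad X) →
      IntegrableOn (fun X => f X * η X) (Om ε) := by
    intro f hf hle
    rw [← integrable_indicator_iff hO, ← hmul]
    refine iM.mono' (hf.aestronglyMeasurable.mul hum) (.of_forall fun X => ?_)
    rw [norm_mul]
    exact mul_le_mul_of_nonneg_right ((hle X).trans (le_self_pow₀ (h1 X) (by omega)))
      (abs_nonneg _)
  have eBS : ∀ X, BS ε η X * u X =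
      ∫ Y, 1 / (2 * Real.pi) * kernel ε X Y * (u X * u Y) := by
    intro X
    have e : ∫ Y in Om ε, kernel ε X Y * η Y = ∫ Y, kernel ε X Y * u Y := by
      rw [← integral_indicator hO, ← hmul]
    rw [BS, e, mul_comm, ← mul_assoc, ← integral_const_mul]
    congr 1; ext Y; ring
  have iB : IntegrableOn (fun X => BS ε η X * η X) (Om ε) := by
    rw [← integrable_indicator_iff hO, ← hmul]
    exact iT.integral_prod_left.congr (.of_forall fun X => (eBS X).symm)
  have hconv : IntegralsConverge ε η := by
    refine ⟨fun X hX => ?_, iB, ?_, ilin _ measurable_fst fun X => ?_,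
      ilin _ measurable_snd fun X => ?_⟩
    · obtain ⟨C', hC', hk⟩ := exists_kernel_bound hε hε1
      rw [← integrable_indicator_iff hO, ← hmul]
      have i0 := (integrable_singKernel_mul (n + 2) hum iD X).const_mul
        (2 * Real.pi * C' * (1 + rad X) ^ 2)
      have hmk : Measurable fun Y => kernel ε X Y := by
        have := measurable_F
        unfold kernel; fun_prop
      refine i0.mono' (hmk.aestronglyMeasurable.mul hum) ?_
      filter_upwards [compl_mem_ae_iff.2 (measure_singleton X)] with Y hY
      by_cases hYO : Y ∈ Om ε
      swap
      · simp [hsupp Y hYO]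
      have h2 := hk X hX Y hYO (Ne.symm hY)
      rw [abs_mul, abs_of_pos (by positivity : 0 < 1 / (2 * Real.pi)), one_div,
        inv_mul_le_iff₀ (by positivity)] at h2
      have h3 := one_le_singKernel X Y
      have h4 : (1 + rad Y) ^ 2 ≤ (1 + rad Y) ^ (n + 2) := pow_le_pow_right₀ (h1 Y) (by omega)
      rw [norm_mul, Real.norm_eq_abs, Real.norm_eq_abs]
      calc |kernel ε X Y| * |u Y|
          ≤ 2 * Real.pi * (C' * ((1 + rad X) ^ 2 * (1 + rad Y) ^ 2 * singKernel X Y)) * |u Y| := by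
            gcongr
        _ ≤ 2 * Real.pi * (C' * ((1 + rad X) ^ 2 * (1 + rad Y) ^ (n + 2) * singKernel X Y)) *
            |u Y| := by gcongr
        _ = _ := by ring
    · have := ilin (fun _ => 1) measurable_const fun X => by
        rw [abs_one]; exact h1 X
      simpa only [one_mul] using this
    · linarith [abs_fst_le_rad X]
    · linarith [abs_snd_le_rad X]
  refine ⟨hconv, ?_⟩
  have eE : 2 * Ekin ε η = ∫ p : (ℝ × ℝ) × (ℝ × ℝ),
      1 / (2 * Real.pi) * kernel ε p.1 p.2 * (u p.1 * u p.2) ∂(volume.prod volume) := by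
    rw [Ekin, ← integral_indicator hO, ← hmul, integral_prod _ iT]
    simp only [eBS]
    ring
  have e0 : ∫ X, u X = mu0 ε η := integral_indicator hO
  have e1 : ∫ X, X.1 * u X = mu1 ε η := by
    rw [mu1, ← integral_indicator hO, ← hmul]
  have e2 : ∫ X, X.2 * u X = mu2 ε η := by
    rw [mu2, ← integral_indicator hO, ← hmul]
  have bD : ∫ X, (1 + rad X) ^ (2 * (n + 2) + 4) * u X ^ 2 ≤ c⁻¹ * normSq ε W η := by
    rw [eD, integral_indicator hO, normSq, ← integral_const_mul]
    exact setIntegral_mono_on iDO iWη hO hbd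
  have bA : ∫ X, A (rad X) * (disc n ε).indicator u X ^ 2 ≤ 15 / 14 * normSq ε W η := by
    rw [normSq, ← integral_const_mul, ← integral_indicator hO]
    refine integral_mono (integrable_A_mul_sq (bddSuppL2_indicator_disc hn hu2))
      ((integrable_indicator_iff hO).2 (hη.2.const_mul _)) fun X => ?_
    by_cases hX : X ∈ Om ε
    · simp only [Set.indicator_of_mem hX]
      by_cases hB : X ∈ disc n ε
      · simp only [Set.indicator_of_mem hB, hu, Set.indicator_of_mem hX]
        rw [← mul_assoc]
        exact mul_le_mul_of_nonneg_right (hA X hX hB) (sq_nonneg _)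
      · simp only [Set.indicator_of_notMem hB]
        have := hW0 X hX
        rw [zero_pow two_ne_zero, mul_zero]
        positivity
    · have : (disc n ε).indicator u X = 0 := by
        simp only [Set.indicator, hsupp X hX, ite_self]
      simp only [this, Set.indicator_of_notMem hX]
      simp
  rw [e0, e1, e2] at hT
  rw [eE]
  have b2 : C * √ε * ∫ X, (1 + rad X) ^ (2 * (n + 2) + 4) * u X ^ 2 ≤
      C * √ε / c * normSq ε W η := by
    calc _ ≤ C * √ε * (c⁻¹ * normSq ε W η) := by gcongr
      _ = _ := by ring
  linarith

/-! ### Growth of the weight, the inner region and smallness of `ε`. -/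

theorem exists_const_mul_pow_le_exp (M : ℕ) {a : ℝ} (ha : 0 < a) :
    ∃ c : ℝ, 0 < c ∧ ∀ ρ : ℝ, 0 ≤ ρ → c * (1 + ρ) ^ M ≤ Real.exp (ρ ^ a / 4) := by
  obtain ⟨j, hj⟩ := exists_nat_ge (M / a)
  rw [div_le_iff₀ ha] at hj
  have hf : (1 : ℝ) ≤ j.factorial := by exact_mod_cast j.factorial_pos
  -- For `ρ ≥ 1` this is `t^j / j! ≤ e^t` at `t = ρ^a/4` with `a j ≥ M`; the factor `2^M` comes from
  -- `1 + ρ ≤ 2ρ`.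
  refine ⟨1 / (2 ^ M * 4 ^ j * j.factorial), by positivity, fun ρ hρ => ?_⟩
  rw [one_div, inv_mul_le_iff₀ (by positivity)]
  have he : 1 ≤ Real.exp (ρ ^ a / 4) := Real.one_le_exp (by positivity)
  rcases le_total ρ 1 with h | h
  · calc (1 + ρ) ^ M ≤ 2 ^ M := by gcongr; linarith
      _ = 2 ^ M * 1 * 1 * 1 := by ring
      _ ≤ _ := by
        gcongr
        exact one_le_pow₀ (by norm_num)
  · calc (1 + ρ) ^ M ≤ (2 * ρ) ^ M := by gcongr; linarith
      _ = 2 ^ M * ρ ^ (M : ℝ) := by rw [mul_pow, Real.rpow_natCast]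
      _ ≤ 2 ^ M * ρ ^ (a * j) := by
        gcongr
        linarith
      _ = 2 ^ M * 4 ^ j * j.factorial * ((ρ ^ a / 4) ^ j / j.factorial) := by
        rw [Real.rpow_mul hρ, Real.rpow_natCast, div_pow]
        field_simp
      _ ≤ _ := by
        gcongr
        exact Real.pow_div_factorial_le_exp _ (by positivity) j

theorem A_rad_le_exp (X : ℝ × ℝ) : A (rad X) ≤ Real.exp (rad X ^ 2 / 4) := by
  set t := rad X ^ 2 / 4 with ht
  rw [A]
  split_ifs with h
  · exact Real.one_le_exp (by positivity)
  · have ht0 : 0 < t := by positivity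
    have e : 4 / rad X ^ 2 = t⁻¹ := by rw [ht, inv_div]
    have h1 := Real.add_one_le_exp (-t)
    have h2 : Real.exp t * Real.exp (-t) = 1 := by rw [← Real.exp_add]; simp
    rw [e, inv_mul_le_iff₀ ht0]
    nlinarith [Real.exp_pos t]

/-- With `τ = ε^{-σ}`, the choice `n σ ≥ 2` gives `ρ² ≤ τ` on the disc. There the profile is at most
`2C exp(τ/4)`, far below the threshold `exp(τ²/4)`. -/
theorem disc_subset_innerRegion {χ : ℝ → ℝ} (hχ : IsCutoff χ) {σ ε C : ℝ} {n : ℕ}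
    {What : ℝ × ℝ → ℝ} (hn : 2 ≤ n * σ) (hσ : 0 < σ) (hC : 0 < C) (hε : 0 < ε)
    (hτ : 8 * C + 1 ≤ ε ^ (-σ)) {X : ℝ × ℝ} (hX : X ∈ Om ε)
    (hWA : weight χ ε What X ≤ C * A (rad X)) (hd : X ∈ disc n ε) :
    X ∈ innerRegion σ ε What := by
  refine ⟨hX, ?_⟩
  have hχX := (hχ.mem_Icc (ε * X.1)).1
  rw [weight] at hWA
  set τ := ε ^ (-σ) with hτdef
  have hr := rad_nonneg X
  have h1 : rad X ^ 2 ≤ τ := by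
    have hd' : (1 + rad X) ^ n ≤ 1 / ε := hd
    calc rad X ^ 2 ≤ (1 + rad X) ^ 2 := by gcongr; linarith
      _ = (1 + rad X) ^ (2 : ℝ) := by norm_cast
      _ ≤ (1 + rad X) ^ (n * σ) := Real.rpow_le_rpow_of_exponent_le (by linarith) hn
      _ = ((1 + rad X) ^ n) ^ σ := by rw [Real.rpow_mul (by linarith), Real.rpow_natCast]
      _ ≤ (1 / ε) ^ σ := by gcongr
      _ = τ := by rw [one_div, Real.inv_rpow hε.le, hτdef, Real.rpow_neg hε.le]
  have h2 : ε ^ (-(2 * σ)) = τ ^ 2 := by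
    rw [hτdef, ← Real.rpow_natCast, ← Real.rpow_mul hε.le]; congr 1; push_cast; ring
  have h3 : What X ≤ 2 * (C * Real.exp (τ / 4)) := by
    have hA : C * A (rad X) ≤ C * Real.exp (τ / 4) := by
      gcongr
      exact (A_rad_le_exp X).trans (Real.exp_le_exp.2 (by linarith))
    by_contra! h
    have h0 : 0 < What X := lt_of_le_of_lt (by positivity) h
    nlinarith [mul_le_mul_of_nonneg_right hχX h0.le]
  -- Since `τ ≥ 8C + 1`, one has `τ(τ-1)/4 ≥ 2C`.
  have h4 : 2 * C < Real.exp (τ ^ 2 / 4 - τ / 4) :=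
    lt_of_lt_of_le (by nlinarith) (Real.add_one_le_exp _)
  rw [h2]
  calc What X ≤ 2 * (C * Real.exp (τ / 4)) := h3
    _ = 2 * C * Real.exp (τ / 4) := by ring
    _ < Real.exp (τ ^ 2 / 4 - τ / 4) * Real.exp (τ / 4) := by gcongr
    _ = _ := by rw [← Real.exp_add]; congr 1; ring

theorem exists_small_parameter {γ σ K L M : ℝ} (hγ : 0 < γ) (hσ : 0 < σ) :
    ∃ ε₀ : ℝ, 0 < ε₀ ∧ ∀ ε : ℝ, 0 < ε → ε < ε₀ →
      ε ≤ 1 / 2 ∧ K * ε ^ γ ≤ 1 / 15 ∧ L ≤ ε ^ (-σ) ∧ M * √ε ≤ 1 / 32 := by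
  have t0 : Filter.Tendsto (fun ε : ℝ => ε) (nhdsWithin 0 (Set.Ioi 0)) (nhds 0) :=
    nhdsWithin_le_nhds
  have t1 : Filter.Tendsto (fun ε : ℝ => K * ε ^ γ) (nhdsWithin 0 (Set.Ioi 0)) (nhds 0) := by
    have := ((Real.continuous_rpow_const hγ.le).const_mul K).tendsto 0
    simp only [Real.zero_rpow hγ.ne', mul_zero] at this
    exact this.mono_left nhdsWithin_le_nhds
  have t2 : Filter.Tendsto (fun ε : ℝ => M * √ε) (nhdsWithin 0 (Set.Ioi 0)) (nhds 0) := by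
    have := (Real.continuous_sqrt.const_mul M).tendsto 0
    simp only [Real.sqrt_zero, mul_zero] at this
    exact this.mono_left nhdsWithin_le_nhds
  have t3 : Filter.Tendsto (fun ε : ℝ => ε ^ (-σ)) (nhdsWithin 0 (Set.Ioi 0)) Filter.atTop :=
    tendsto_rpow_neg_nhdsGT_zero (by linarith)
  have h := ((t0.eventually_le_const (show (0 : ℝ) < 1 / 2 by norm_num)).and
    ((t1.eventually_le_const (show (0 : ℝ) < 1 / 15 by norm_num)).and
    ((t3.eventually_ge_atTop L).and
      (t2.eventually_le_const (show (0 : ℝ) < 1 / 32 by norm_num)))))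
  obtain ⟨ε₀, hε₀, hsub⟩ := mem_nhdsGT_iff_exists_Ioo_subset.1 h
  exact ⟨ε₀, hε₀, fun ε h1 h2 => hsub ⟨h1, h2⟩⟩

end VortexRing

theorem proposition4p5
    (χ₁ : ℝ → ℝ) (hχ₁ : VortexRing.IsCutoff χ₁)
    (σ₁ σ₂ : ℝ) (hσ₁ : 0 < σ₁) (hσ₁' : σ₁ < 1) (hσ₂ : 1 < σ₂)
    (γ₁ : ℝ) (hγ₁ : 0 < γ₁) (hγ₁' : γ₁ < 1)
    (C₁ C₂ C₃ : ℝ) (hC₁ : 0 < C₁) (hC₂ : 0 < C₂) (hC₃ : 0 < C₃) :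
    ∃ C₆ : ℝ, 0 < C₆ ∧ ∃ C₇ : ℝ, 0 < C₇ ∧ ∃ ε₀ : ℝ, 0 < ε₀ ∧
      ∀ ε : ℝ, 0 < ε → ε < ε₀ →
      ∀ What : ℝ × ℝ → ℝ,
        AEMeasurable What (MeasureTheory.volume.restrict (VortexRing.Om ε)) →
        VortexRing.UniformBounds (σ₁ / σ₂) C₁ C₂ ε (VortexRing.weight χ₁ ε What) →
        VortexRing.CloseToA γ₁ C₃ ε (VortexRing.weight χ₁ ε What)
          (VortexRing.innerRegion σ₁ ε What) →
      ∀ η : ℝ × ℝ → ℝ, VortexRing.MemX ε (VortexRing.weight χ₁ ε What) η →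
        VortexRing.IntegralsConverge ε η ∧
        VortexRing.normSq ε (VortexRing.weight χ₁ ε What) η ≤
          C₆ * VortexRing.energy ε (VortexRing.weight χ₁ ε What) η +
          C₇ * (Real.log (1 / ε) * VortexRing.mu0 ε η ^ 2 +
            VortexRing.mu1 ε η ^ 2 + VortexRing.mu2 ε η ^ 2) := by
  open VortexRing in
  obtain ⟨n, hn⟩ := exists_nat_ge (2 / σ₁)
  rw [div_le_iff₀ hσ₁] at hn
  have hn0 : n ≠ 0 := by rintro rfl; norm_num at hn
  obtain ⟨C, hC, H⟩ := exists_kinetic_energy_le hn0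
  obtain ⟨c, hc, hexp⟩ := exists_const_mul_pow_le_exp (2 * (n + 2) + 4)
    (show 0 < 2 * (σ₁ / σ₂) by positivity)
  obtain ⟨ε₀, hε₀, hsmall⟩ := exists_small_parameter (K := C₃) (L := 8 * C₂ + 1)
    (M := C / (C₁ * c)) hγ₁ hσ₁
  -- From `15/16 + 1/32 = 31/32`, the energy is at least half of `normSq/32` minus `C` times the
  -- moment terms; multiplying by `64` gives these constants. The `+ 1` only secures positivity.
  refine ⟨64, by norm_num, 32 * C + 1, by positivity, ε₀, hε₀, ?_⟩
  intro ε hε hεlt What _ hbd hclose η hη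
  obtain ⟨hε2, hs1, hs2, hs3⟩ := hsmall ε hε hεlt
  set W := weight χ₁ ε What with hWdef
  have hlow : ∀ X ∈ Om ε, C₁ * c * (1 + rad X) ^ (2 * (n + 2) + 4) ≤ W X := fun X hX => by
    refine le_trans ?_ (hbd X hX).1
    rw [mul_assoc]
    exact mul_le_mul_of_nonneg_left (hexp _ (rad_nonneg X)) hC₁.le
  have hW0 : ∀ X ∈ Om ε, 0 ≤ W X := fun X hX => (by positivity : (0 : ℝ) ≤ _).trans (hbd X hX).1
  -- On the disc `|W - A| ≤ A/15`, hence `W ≥ (14/15) A`.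
  have hA : ∀ X ∈ Om ε, X ∈ disc n ε → A (rad X) ≤ 15 / 14 * W X := fun X hX hd => by
    have hin := disc_subset_innerRegion hχ₁ hn hσ₁ hC₂ hε hs2 hX (hbd X hX).2 hd
    have h1 := (hclose X hin).2
    have h2 : 0 ≤ gradDist W (fun Y => A (rad Y)) X := Real.sqrt_nonneg _
    have h3 := neg_abs_le (W X - A (rad X))
    have h4 := mul_le_mul_of_nonneg_right hs1 (A_rad_nonneg X)
    linarith
  obtain ⟨hconv, hE⟩ := H ε hε hε2 W η (C₁ * c) (by positivity) hη hlow hA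
  refine ⟨hconv, ?_⟩
  have hN : 0 ≤ normSq ε W η :=
    setIntegral_nonneg (measurableSet_Om ε) fun X hX => mul_nonneg (hW0 X hX) (sq_nonneg _)
  have h1 : C * √ε / (C₁ * c) ≤ 1 / 32 := by rwa [mul_div_right_comm]
  have h2 := mul_le_mul_of_nonneg_right h1 hN
  have hl : 0 ≤ Real.log (1 / ε) :=
    Real.log_nonneg (by rw [le_div_iff₀ hε]; linarith)
  have hμ : 0 ≤ Real.log (1 / ε) * mu0 ε η ^ 2 + mu1 ε η ^ 2 + mu2 ε η ^ 2 := by positivity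
  rw [energy]
  linarith
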